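/- **Language.** Let $C$ and $D$ be disjoint, arbitrary (possibly empty) sets of justification constants and of propositional constants, and let $V_J=\{v_0,v_1,\dots\}$ and $V_P=\{x_0,x_1,\dots\}$ be the well-ordered sets of justification variables and of propositional variables; $V=V_P\cup V_J$. Justification terms are built from $V_J\cup C$ by $s\cdot t$ and $s+t$; their set is $Tm(C)$. Formulas are built from $V_P\cup D$ by $\varphi\to\psi$, $\neg\varphi$, $\varphi\equiv\psi$, $\varphi<\psi$, $s\equiv t$, $s\le t$, $\varphi{:}true$, $\varphi{:}false$, $\square\varphi$, $\varphi{:}t$, $\forall x.\varphi$, $\bigwedge u.\varphi$ ($x\in V_P$, $u\in V_J$), where $\forall x.\varphi$ is formed only if $x$ is free in $\varphi$ and $\bigwedge u.\varphi$ only if $u$ is free in $\varphi$. Their set is $Fm(C,D)$. The symbols $\wedge,\leftrightarrow,\exists x,\bigvee u$ are the usual abbreviations; $fvar_P(\varphi)$, $fvar_J(\varphi)$ are the sets of free propositional and justification variables of $\varphi$, and $fvar(\varphi)$ is their union. A substitution $\sigma$ maps $V_P\cup D$ to formulas and $V_J\cup C$ to terms. It extends to all terms and formulas, commuting with everything except quantifiers,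 where $(\forall x.\varphi)[\sigma]=\forall y.\varphi[\sigma[x:=y]]$ and $(\bigwedge u.\varphi)[\sigma]=\bigwedge v.\varphi[\sigma[u:=v]]$, with $y\in V_P$ (resp. $v\in V_J$) the least variable greater than all variables of its sort that are free in some $\sigma(w)$, $w$ a free variable or a constant of the quantified formula. We write $\sigma:V\to Fm(C,D)\cup Tm(C)$ if $\sigma$ fixes all constants, and $[x:=\psi]$, $[u:=t]$ for the substitutions that move only $x$, only $u$. Alpha-congruence $=_\alpha$ is the least equivalence relation on $Fm(C,D)$ that is preserved by $\to,\equiv,<,\neg,\square$, ${:}true$, ${:}false$, ${:}t$ and satisfies: $\bigwedge u.\varphi=_\alpha\bigwedge v.\psi$ whenever $\varphi=_\alpha\psi[v:=u]$ and ($v\ne u$ implies $u\notin fvar_J(\psi)$); and likewise $\forall x.\varphi=_\alpha\forall y.\psi$ whenever $\varphi=_\alpha\psi[y:=x]$ and ($y\ne x$ implies $x\notin fvar_P(\psi)$). Syntactical reference: $\varphi\prec\psi$ iff $\psi'[x:=\varphi]=_\alpha\psi$ for some $x\in V_P$ and some formula $\psi'\neq x$ with $x\in fvar_P(\psi')$.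 **Calculus.** $Ax$ is the smallest set that contains a sufficient set of tautologies of classical propositional logic (any set of tautologies in $\to,\neg$ from which Modus Ponens yields all of them) and the following formulas, and that with $\varphi$ contains $\bigwedge u.\varphi$ for $u\in fvar_J(\varphi)$ and $\forall x.\varphi$ for $x\in fvar_P(\varphi)$: (i) $\varphi{:}true\leftrightarrow\varphi$; (ii) $\varphi{:}false\leftrightarrow\neg\varphi$; (iii) $(\varphi\to\psi){:}s\to(\varphi{:}t\to\psi{:}(s\cdot t))$; (iv) $\varphi{:}s\to\varphi{:}(s+t)$; (v) $\varphi{:}t\to\varphi{:}(s+t)$; (vi) $\square\varphi\leftrightarrow\bigvee u.(\varphi{:}u)$ if $u\notin fvar_J(\varphi)$; (vii) $\square\varphi\to\varphi$; (viii) $\varphi<\psi$ if $\varphi\prec\psi$; (ix) $(\varphi<\psi)\to((\psi<\chi)\to(\varphi<\chi))$; (x) $\varphi\equiv\psi$ if $\varphi=_\alpha\psi$; (xi) $(\varphi\equiv\psi)\to(\varphi\to\psi)$; (xii) $\bigwedge_{z\in fvar(\varphi)}(\sigma(z)\equiv\sigma'(z))\to(\varphi[\sigma]\equiv\varphi[\sigma'])$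 for $\sigma,\sigma':V\to Fm(C,D)\cup Tm(C)$ (a finite conjunction in the order of the variables; if it is empty, the formula is $\varphi[\sigma]\equiv\varphi[\sigma']$); (xiii) $\varphi[u:=t]\to\bigvee u.\varphi$; (xiv) $\bigwedge u.\varphi\to\varphi[u:=t]$; (xv) $\bigwedge u.(\psi\to\varphi)\to(\bigwedge u.\psi\to\bigwedge u.\varphi)$; (xvi) $\bigwedge u.(\psi\to\varphi)\to(\psi\to\bigwedge u.\varphi)$ if $u\notin fvar_J(\psi)$; (xvii) $\varphi[x:=\psi]\to\exists x.\varphi$; (xviii) $\forall x.\varphi\to\varphi[x:=\psi]$; (xix) $\forall x.(\psi\to\varphi)\to(\forall x.\psi\to\forall x.\varphi)$; (xx) $\forall x.(\psi\to\varphi)\to(\psi\to\forall x.\varphi)$ if $x\notin fvar_P(\psi)$; (xxi) $(s\le t)\leftrightarrow\forall x.(x{:}s\to x{:}t)$; (xxii) $(s\equiv t)\leftrightarrow(s\le t)\wedge(t\le s)$; (xxiii) $\bigwedge_{z\in var(t)}(\sigma(z)\equiv\sigma'(z))\to(t[\sigma]\equiv t[\sigma'])$ for $\sigma,\sigma'$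 as in (xii), with the same convention. Here every quantified formula written is assumed to be a formula. $\Phi\vdash\varphi$ means that $\varphi$ lies in the smallest set that contains $\Phi\cup Ax$ and is closed under Modus Ponens. $\Phi$ is consistent if there is no $\varphi$ with $\Phi\vdash\varphi$ and $\Phi\vdash\neg\varphi$. $\Phi$ is a Henkin set if it is maximally consistent and, for all $\varphi$, all $u\in fvar_J(\varphi)$ and all $x\in fvar_P(\varphi)$: $\Phi\vdash\bigwedge u.\varphi$ iff $\Phi\vdash\varphi[u:=c]$ for all $c\in C$; and $\Phi\vdash\forall x.\varphi$ iff $\Phi\vdash\varphi[x:=d]$ for all $d\in D$. **Semantics.** A model $\mathcal M$ consists of a partially ordered set $(L,\le)$ of indexes with two binary operations $+,\cdot$; a set $M$ that is the disjoint union of $TRUE$ and $FALSE$; sets $REASON_l\subseteq M$ ($l\in L$) such that $l\le l'$ iff $REASON_l\subseteq REASON_{l'}$ (so $l\mapsto REASON_l$ is an order isomorphism onto its image); the set $NECESSARY=\bigcup_{l\in L}REASON_l$, which is contained in $TRUE$; a transitive relation $<^{\mathcal M}$ on $M$; and a function $\Gamma$ that gives, for every assignment $\gamma$ (mapping $V_P$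 to $M$ and $V_J$ to $L$), values $\Gamma(\varphi,\gamma)\in M$ and $\Gamma(t,\gamma)\in L$. It satisfies the following conditions, for all assignments, formulas and terms. Structure conditions: $\Gamma(z,\gamma)=\gamma(z)$ for $z\in V$; $\Gamma(\varphi,\gamma)$ and $\Gamma(t,\gamma)$ depend only on the values of $\gamma$ at the free variables of $\varphi$, resp. the variables of $t$; $\Gamma(\varphi[\sigma],\gamma)=\Gamma(\varphi,\gamma\sigma)$ and $\Gamma(t[\sigma],\gamma)=\Gamma(t,\gamma\sigma)$ for $\sigma:V\to Fm(C,D)\cup Tm(C)$, where $\gamma\sigma(z)=\Gamma(\sigma(z),\gamma)$; $\varphi\prec\psi$ implies $\Gamma(\varphi,\gamma)<^{\mathcal M}\Gamma(\psi,\gamma)$; $\Gamma(s+t,\gamma)=\Gamma(s,\gamma)+\Gamma(t,\gamma)$ and $\Gamma(s\cdot t,\gamma)=\Gamma(s,\gamma)\cdot\Gamma(t,\gamma)$. Truth conditions, with $\|e\|=\Gamma(e,\gamma)$: $\|\varphi\to\psi\|\in TRUE$ iff $\|\varphi\|\in FALSE$ or $\|\psi\|\in TRUE$; $\|\neg\varphi\|\in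 TRUE$ iff $\|\varphi\|\notin TRUE$; $\|\varphi{:}true\|\in TRUE$ iff $\|\varphi\|\in TRUE$; $\|\varphi{:}false\|\in TRUE$ iff $\|\varphi\|\in FALSE$; $\|\varphi\equiv\psi\|\in TRUE$ iff $\|\varphi\|=\|\psi\|$; $\|\varphi<\psi\|\in TRUE$ iff $\|\varphi\|<^{\mathcal M}\|\psi\|$; $\|s\equiv t\|\in TRUE$ iff $\|s\|=\|t\|$; $\|s\le t\|\in TRUE$ iff $\|s\|\le\|t\|$; $\|\square\varphi\|\in TRUE$ iff $\|\varphi\|\in NECESSARY$; $\|\varphi{:}t\|\in TRUE$ iff $\|\varphi\|\in REASON_{\|t\|}$; if $\|\varphi\to\psi\|\in REASON_{\|s\|}$ and $\|\varphi\|\in REASON_{\|t\|}$, then $\|\psi\|\in REASON_{\|s\cdot t\|}$; if $\|\varphi\|\in REASON_{\|s\|}\cup REASON_{\|t\|}$, then $\|\varphi\|\in REASON_{\|s+t\|}$; $\Gamma(\bigwedge u.\varphi,\gamma)\in TRUE$ iff $\Gamma(\varphi,\gamma_u^l)\in TRUE$ for all $l\in L$; $\Gamma(\forall x.\varphi,\gamma)\in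 TRUE$ iff $\Gamma(\varphi,\gamma_x^m)\in TRUE$ for all $m\in M$, where $\gamma_z^a$ is $\gamma$ with the value at $z$ changed to $a$. $(\mathcal M,\gamma)\vDash\varphi$ means $\Gamma(\varphi,\gamma)\in TRUE$. A set $\Phi$ has a model if some $(\mathcal M,\gamma)$ satisfies all formulas of $\Phi$, and $\Phi\Vdash\varphi$ means that every $(\mathcal M,\gamma)$ that satisfies all formulas of $\Phi$ satisfies $\varphi$. **Theorem.** (a) Every Henkin set $\Phi\subseteq Fm(C,D)$ has a model. (b) Every consistent set $\Phi\subseteq Fm(C,D)$ has a model. (c) (Completeness) For all $\Phi\cup\{\varphi\}\subseteq Fm(C,D)$: $\Phi\Vdash\varphi$ if and only if $\Phi\vdash\varphi$. -/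

import Mathlib

universe u v w

namespace EpsilonJ

/-- Justification terms over the justification constants `C`; the justification variables
are indexed by `ℕ`. -/
inductive Tm (C : Type u) : Type u
  | var : ℕ → Tm C
  | const : C → Tm C
  | app : Tm C → Tm C → Tm C
  | sum : Tm C → Tm C → Tm C

namespace Tm

variable {C : Type u}

/-- The justification variables of a term. -/
def fvJ : Tm C → Finset ℕ
  | var u => {u}
  | const _ => ∅
  | app s t => s.fvJ ∪ t.fvJ
  | sum s t => s.fvJ ∪ t.fvJ

/-- The justification constants of a term. -/
def conJ : Tm C → Set C
  | var _ => ∅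
  | const c => {c}
  | app s t => s.conJ ∪ t.conJ
  | sum s t => s.conJ ∪ t.conJ

theorem finite_conJ (t : Tm C) : t.conJ.Finite := by
  induction t with
  | var => exact Set.finite_empty
  | const c => exact Set.finite_singleton c
  | app s t hs ht => exact hs.union ht
  | sum s t hs ht => exact hs.union ht

end Tm

/-- Formulas in which vacuous quantification is still allowed; `C` are the justification
constants, `D` the propositional constants, and the propositional variables are indexed by `ℕ`. -/
inductive RawFm (C : Type u) (D : Type v) : Type (max u v)
  | var : ℕ → RawFm C D
  | const : D → RawFm C D
  | imp : RawFm C D → RawFm C D → RawFm C D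
  | neg : RawFm C D → RawFm C D
  | eqv : RawFm C D → RawFm C D → RawFm C D
  | ref : RawFm C D → RawFm C D → RawFm C D
  | eqJ : Tm C → Tm C → RawFm C D
  | leJ : Tm C → Tm C → RawFm C D
  | isTrue : RawFm C D → RawFm C D
  | isFalse : RawFm C D → RawFm C D
  | box : RawFm C D → RawFm C D
  | just : RawFm C D → Tm C → RawFm C D
  | all : ℕ → RawFm C D → RawFm C D
  | allJ : ℕ → RawFm C D → RawFm C D

namespace RawFm

variable {C : Type u} {D : Type v}

/-- Free propositional variables. -/
def fvP : RawFm C D → Finset ℕ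
  | var x => {x}
  | const _ => ∅
  | imp φ ψ => φ.fvP ∪ ψ.fvP
  | neg φ => φ.fvP
  | eqv φ ψ => φ.fvP ∪ ψ.fvP
  | ref φ ψ => φ.fvP ∪ ψ.fvP
  | eqJ _ _ => ∅
  | leJ _ _ => ∅
  | isTrue φ => φ.fvP
  | isFalse φ => φ.fvP
  | box φ => φ.fvP
  | just φ _ => φ.fvP
  | all x φ => φ.fvP.erase x
  | allJ _ φ => φ.fvP

/-- Free justification variables. -/
def fvJ : RawFm C D → Finset ℕ
  | var _ => ∅
  | const _ => ∅
  | imp φ ψ => φ.fvJ ∪ ψ.fvJ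
  | neg φ => φ.fvJ
  | eqv φ ψ => φ.fvJ ∪ ψ.fvJ
  | ref φ ψ => φ.fvJ ∪ ψ.fvJ
  | eqJ s t => s.fvJ ∪ t.fvJ
  | leJ s t => s.fvJ ∪ t.fvJ
  | isTrue φ => φ.fvJ
  | isFalse φ => φ.fvJ
  | box φ => φ.fvJ
  | just φ t => φ.fvJ ∪ t.fvJ
  | all _ φ => φ.fvJ
  | allJ u φ => φ.fvJ.erase u

/-- Propositional constants. -/
def conP : RawFm C D → Set D
  | var _ => ∅
  | const d => {d}
  | imp φ ψ => φ.conP ∪ ψ.conP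
  | neg φ => φ.conP
  | eqv φ ψ => φ.conP ∪ ψ.conP
  | ref φ ψ => φ.conP ∪ ψ.conP
  | eqJ _ _ => ∅
  | leJ _ _ => ∅
  | isTrue φ => φ.conP
  | isFalse φ => φ.conP
  | box φ => φ.conP
  | just φ _ => φ.conP
  | all _ φ => φ.conP
  | allJ _ φ => φ.conP

/-- Justification constants. -/
def conJ : RawFm C D → Set C
  | var _ => ∅
  | const _ => ∅
  | imp φ ψ => φ.conJ ∪ ψ.conJ
  | neg φ => φ.conJ
  | eqv φ ψ => φ.conJ ∪ ψ.conJ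
  | ref φ ψ => φ.conJ ∪ ψ.conJ
  | eqJ s t => s.conJ ∪ t.conJ
  | leJ s t => s.conJ ∪ t.conJ
  | isTrue φ => φ.conJ
  | isFalse φ => φ.conJ
  | box φ => φ.conJ
  | just φ t => φ.conJ ∪ t.conJ
  | all _ φ => φ.conJ
  | allJ _ φ => φ.conJ

/-- A formula is proper if no quantifier in it is vacuous. -/
def Proper : RawFm C D → Prop
  | var _ => True
  | const _ => True
  | imp φ ψ => φ.Proper ∧ ψ.Proper
  | neg φ => φ.Proper
  | eqv φ ψ => φ.Proper ∧ ψ.Proper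
  | ref φ ψ => φ.Proper ∧ ψ.Proper
  | eqJ _ _ => True
  | leJ _ _ => True
  | isTrue φ => φ.Proper
  | isFalse φ => φ.Proper
  | box φ => φ.Proper
  | just φ _ => φ.Proper
  | all x φ => x ∈ φ.fvP ∧ φ.Proper
  | allJ u φ => u ∈ φ.fvJ ∧ φ.Proper

theorem finite_conP (φ : RawFm C D) : φ.conP.Finite := by
  induction φ <;> simp_all [conP]

theorem finite_conJ (φ : RawFm C D) : φ.conJ.Finite := by
  induction φ <;> simp_all [conJ, Tm.finite_conJ]

end RawFm

/-- The formulas of the language: the proper ones. -/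
@[ext]
structure Fm (C : Type u) (D : Type v) : Type (max u v) where
  val : RawFm C D
  proper : val.Proper

namespace Fm

variable {C : Type u} {D : Type v}

def fvP (φ : Fm C D) : Finset ℕ := φ.1.fvP
def fvJ (φ : Fm C D) : Finset ℕ := φ.1.fvJ

def var (x : ℕ) : Fm C D := ⟨.var x, trivial⟩
def const (d : D) : Fm C D := ⟨.const d, trivial⟩
def imp (φ ψ : Fm C D) : Fm C D := ⟨.imp φ.1 ψ.1, φ.2, ψ.2⟩
def neg (φ : Fm C D) : Fm C D := ⟨.neg φ.1, φ.2⟩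
def eqv (φ ψ : Fm C D) : Fm C D := ⟨.eqv φ.1 ψ.1, φ.2, ψ.2⟩
def ref (φ ψ : Fm C D) : Fm C D := ⟨.ref φ.1 ψ.1, φ.2, ψ.2⟩
def eqJ (s t : Tm C) : Fm C D := ⟨.eqJ s t, trivial⟩
def leJ (s t : Tm C) : Fm C D := ⟨.leJ s t, trivial⟩
def isTrue (φ : Fm C D) : Fm C D := ⟨.isTrue φ.1, φ.2⟩
def isFalse (φ : Fm C D) : Fm C D := ⟨.isFalse φ.1, φ.2⟩
def box (φ : Fm C D) : Fm C D := ⟨.box φ.1, φ.2⟩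
def just (φ : Fm C D) (t : Tm C) : Fm C D := ⟨.just φ.1 t, φ.2⟩
def all (x : ℕ) (φ : Fm C D) (h : x ∈ φ.fvP) : Fm C D := ⟨.all x φ.1, h, φ.2⟩
def allJ (u : ℕ) (φ : Fm C D) (h : u ∈ φ.fvJ) : Fm C D := ⟨.allJ u φ.1, h, φ.2⟩

/-! Defined connectives and quantifiers. -/

def and (φ ψ : Fm C D) : Fm C D := (φ.imp ψ.neg).neg
def iff (φ ψ : Fm C D) : Fm C D := (φ.imp ψ).and (ψ.imp φ)
def ex (x : ℕ) (φ : Fm C D) (h : x ∈ φ.fvP) : Fm C D := (all x φ.neg h).neg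
def exJ (u : ℕ) (φ : Fm C D) (h : u ∈ φ.fvJ) : Fm C D := (allJ u φ.neg h).neg

theorem mem_fvJ_just_var (φ : Fm C D) (u : ℕ) : u ∈ (φ.just (.var u)).fvJ :=
  Finset.mem_union_right _ (Finset.mem_singleton_self u)

theorem mem_fvP_imp_right {φ : Fm C D} (ψ : Fm C D) {x : ℕ} (h : x ∈ φ.fvP) :
    x ∈ (ψ.imp φ).fvP :=
  Finset.mem_union_right _ h

theorem mem_fvJ_imp_right {φ : Fm C D} (ψ : Fm C D) {u : ℕ} (h : u ∈ φ.fvJ) :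
    u ∈ (ψ.imp φ).fvJ :=
  Finset.mem_union_right _ h

theorem mem_fvP_just {φ : Fm C D} (t : Tm C) {x : ℕ} (h : x ∈ φ.fvP) : x ∈ (φ.just t).fvP := h

theorem mem_fvP_var (x : ℕ) : x ∈ (var x : Fm C D).fvP := Finset.mem_singleton_self x

/-- `impConj [χ₁, …, χₙ] χ` is `(χ₁ ∧ … ∧ χₙ) → χ`; for the empty list it is `χ`. -/
def impConj : List (Fm C D) → Fm C D → Fm C D
  | [], χ => χ
  | a :: l, χ => (l.foldl and a).imp χ

end Fm

/-- Substitutions: variables and constants of either sort go to formulas and terms of that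
sort. -/
@[ext]
structure Subst (C : Type u) (D : Type v) where
  varP : ℕ → Fm C D
  constP : D → Fm C D
  varJ : ℕ → Tm C
  constJ : C → Tm C

namespace Subst

variable {C : Type u} {D : Type v}

/-- The identity substitution. -/
def id : Subst C D := ⟨Fm.var, Fm.const, Tm.var, Tm.const⟩

/-- `σ[x := φ]` -/
def updP (σ : Subst C D) (x : ℕ) (φ : Fm C D) : Subst C D :=
  { σ with varP := Function.update σ.varP x φ }

/-- `σ[u := t]` -/
def updJ (σ : Subst C D) (u : ℕ) (t : Tm C) : Subst C D :=
  { σ with varJ := Function.update σ.varJ u t }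

/-- The substitution moves variables only. -/
def OnVars (σ : Subst C D) : Prop :=
  (∀ d, σ.constP d = Fm.const d) ∧ (∀ c, σ.constJ c = Tm.const c)

/-- The least propositional variable greater than all free propositional variables of the
formulas and terms that `σ` puts for the free variables and constants of `φ`. -/
noncomputable def forcedP (σ : Subst C D) (φ : RawFm C D) : ℕ :=
  sInf {y | (∀ x ∈ φ.fvP, ∀ z ∈ (σ.varP x).fvP, z < y) ∧
    (∀ d ∈ φ.conP, ∀ z ∈ (σ.constP d).fvP, z < y)}

/-- The least justification variable greater than all free justification variables of the
formulas and terms that `σ` puts for the free variables and constants of `φ`. -/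
noncomputable def forcedJ (σ : Subst C D) (φ : RawFm C D) : ℕ :=
  sInf {v | (∀ x ∈ φ.fvP, ∀ z ∈ (σ.varP x).fvJ, z < v) ∧
    (∀ d ∈ φ.conP, ∀ z ∈ (σ.constP d).fvJ, z < v) ∧
    (∀ u ∈ φ.fvJ, ∀ z ∈ (σ.varJ u).fvJ, z < v) ∧
    (∀ c ∈ φ.conJ, ∀ z ∈ (σ.constJ c).fvJ, z < v)}

theorem exists_bound {α : Type*} {S : Set α} (hS : S.Finite) (f : α → Finset ℕ) :
    ∃ b, ∀ a ∈ S, ∀ z ∈ f a, z < b := by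
  refine ⟨hS.toFinset.sup (fun a => (f a).sup (fun z => z + 1)), fun a ha z hz => ?_⟩
  have h1 : z + 1 ≤ (f a).sup (fun z => z + 1) :=
    Finset.le_sup (f := fun z => z + 1) hz
  have h2 : (f a).sup (fun z => z + 1) ≤ hS.toFinset.sup (fun a => (f a).sup (fun z => z + 1)) :=
    Finset.le_sup (f := fun a => (f a).sup (fun z => z + 1)) (hS.mem_toFinset.2 ha)
  omega

theorem forcedP_spec (σ : Subst C D) (φ : RawFm C D) :
    (∀ x ∈ φ.fvP, ∀ z ∈ (σ.varP x).fvP, z < σ.forcedP φ) ∧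
    (∀ d ∈ φ.conP, ∀ z ∈ (σ.constP d).fvP, z < σ.forcedP φ) := by
  refine Nat.sInf_mem (s := {y | (∀ x ∈ φ.fvP, ∀ z ∈ (σ.varP x).fvP, z < y) ∧
    (∀ d ∈ φ.conP, ∀ z ∈ (σ.constP d).fvP, z < y)}) ?_
  obtain ⟨a, ha⟩ := exists_bound φ.fvP.finite_toSet (fun x => (σ.varP x).fvP)
  obtain ⟨b, hb⟩ := exists_bound φ.finite_conP (fun d => (σ.constP d).fvP)
  exact ⟨max a b, fun x hx z hz => lt_max_of_lt_left (ha x hx z hz),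
    fun d hd z hz => lt_max_of_lt_right (hb d hd z hz)⟩

theorem forcedJ_spec (σ : Subst C D) (φ : RawFm C D) :
    (∀ x ∈ φ.fvP, ∀ z ∈ (σ.varP x).fvJ, z < σ.forcedJ φ) ∧
    (∀ d ∈ φ.conP, ∀ z ∈ (σ.constP d).fvJ, z < σ.forcedJ φ) ∧
    (∀ u ∈ φ.fvJ, ∀ z ∈ (σ.varJ u).fvJ, z < σ.forcedJ φ) ∧
    (∀ c ∈ φ.conJ, ∀ z ∈ (σ.constJ c).fvJ, z < σ.forcedJ φ) := by
  refine Nat.sInf_mem (s := {v | (∀ x ∈ φ.fvP, ∀ z ∈ (σ.varP x).fvJ, z < v) ∧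
    (∀ d ∈ φ.conP, ∀ z ∈ (σ.constP d).fvJ, z < v) ∧
    (∀ u ∈ φ.fvJ, ∀ z ∈ (σ.varJ u).fvJ, z < v) ∧
    (∀ c ∈ φ.conJ, ∀ z ∈ (σ.constJ c).fvJ, z < v)}) ?_
  obtain ⟨a, ha⟩ := exists_bound φ.fvP.finite_toSet (fun x => (σ.varP x).fvJ)
  obtain ⟨b, hb⟩ := exists_bound φ.finite_conP (fun d => (σ.constP d).fvJ)
  obtain ⟨c, hc⟩ := exists_bound φ.fvJ.finite_toSet (fun u => (σ.varJ u).fvJ)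
  obtain ⟨d, hd⟩ := exists_bound φ.finite_conJ (fun c => (σ.constJ c).fvJ)
  refine ⟨a + b + c + d, fun x hx z hz => ?_, fun x hx z hz => ?_, fun x hx z hz => ?_,
    fun x hx z hz => ?_⟩
  · have := ha x hx z hz; omega
  · have := hb x hx z hz; omega
  · have := hc x hx z hz; omega
  · have := hd x hx z hz; omega

end Subst

/-- `t[σ]` -/
def Tm.subst {C : Type u} {D : Type v} (σ : Subst C D) : Tm C → Tm C
  | .var u => σ.varJ u
  | .const c => σ.constJ c
  | .app s t => .app (s.subst σ) (t.subst σ)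
  | .sum s t => .sum (s.subst σ) (t.subst σ)

/-- `φ[σ]`, with the forced variable as the new bound variable at each quantifier. -/
noncomputable def RawFm.subst {C : Type u} {D : Type v} : RawFm C D → Subst C D → RawFm C D
  | .var x, σ => (σ.varP x).1
  | .const d, σ => (σ.constP d).1
  | .imp φ ψ, σ => .imp (φ.subst σ) (ψ.subst σ)
  | .neg φ, σ => .neg (φ.subst σ)
  | .eqv φ ψ, σ => .eqv (φ.subst σ) (ψ.subst σ)
  | .ref φ ψ, σ => .ref (φ.subst σ) (ψ.subst σ)
  | .eqJ s t, σ => .eqJ (s.subst σ) (t.subst σ)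
  | .leJ s t, σ => .leJ (s.subst σ) (t.subst σ)
  | .isTrue φ, σ => .isTrue (φ.subst σ)
  | .isFalse φ, σ => .isFalse (φ.subst σ)
  | .box φ, σ => .box (φ.subst σ)
  | .just φ t, σ => .just (φ.subst σ) (t.subst σ)
  | .all x φ, σ => .all (σ.forcedP (.all x φ))
      (φ.subst (σ.updP x (Fm.var (σ.forcedP (.all x φ)))))
  | .allJ u φ, σ => .allJ (σ.forcedJ (.allJ u φ))
      (φ.subst (σ.updJ u (Tm.var (σ.forcedJ (.allJ u φ)))))

section ProperSubst

variable {C : Type u} {D : Type v}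

theorem Tm.mem_fvJ_subst (σ : Subst C D) (t : Tm C) {u z : ℕ} (hu : u ∈ t.fvJ)
    (hz : z ∈ (σ.varJ u).fvJ) : z ∈ (t.subst σ).fvJ := by
  induction t with
  | var v => simp only [Tm.fvJ, Finset.mem_singleton] at hu; subst hu; exact hz
  | const c => simp [Tm.fvJ] at hu
  | app s t hs ht =>
    simp only [Tm.fvJ, Tm.subst, Finset.mem_union] at hu ⊢
    exact hu.imp hs ht
  | sum s t hs ht =>
    simp only [Tm.fvJ, Tm.subst, Finset.mem_union] at hu ⊢
    exact hu.imp hs ht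

theorem RawFm.mem_fvP_subst (φ : RawFm C D) (σ : Subst C D) {x z : ℕ} (hx : x ∈ φ.fvP)
    (hz : z ∈ (σ.varP x).fvP) : z ∈ (φ.subst σ).fvP := by
  induction φ generalizing σ with
  | var y => simp only [RawFm.fvP, Finset.mem_singleton] at hx; subst hx; exact hz
  | const | eqJ | leJ => simp [RawFm.fvP] at hx
  | imp _ _ h1 h2 | eqv _ _ h1 h2 | ref _ _ h1 h2 =>
    simp only [RawFm.fvP, RawFm.subst, Finset.mem_union] at hx ⊢
    exact hx.imp (fun h => h1 σ h hz) (fun h => h2 σ h hz)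
  | neg _ h | isTrue _ h | isFalse _ h | box _ h | just _ _ h => exact h σ hx hz
  | all y φ h =>
    have hlt := (σ.forcedP_spec (.all y φ)).1 x hx z hz
    simp only [RawFm.fvP, Finset.mem_erase] at hx
    simp only [RawFm.subst, RawFm.fvP, Finset.mem_erase]
    exact ⟨hlt.ne, h _ hx.2 (by simpa [Subst.updP, Function.update_of_ne hx.1] using hz)⟩
  | allJ v φ h => exact h _ hx hz

theorem RawFm.mem_fvJ_subst (φ : RawFm C D) (σ : Subst C D) {u z : ℕ} (hu : u ∈ φ.fvJ)
    (hz : z ∈ (σ.varJ u).fvJ) : z ∈ (φ.subst σ).fvJ := by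
  induction φ generalizing σ with
  | var | const => simp [RawFm.fvJ] at hu
  | eqJ | leJ =>
    simp only [RawFm.fvJ, RawFm.subst, Finset.mem_union] at hu ⊢
    exact hu.imp (fun h => Tm.mem_fvJ_subst σ _ h hz) (fun h => Tm.mem_fvJ_subst σ _ h hz)
  | imp _ _ h1 h2 | eqv _ _ h1 h2 | ref _ _ h1 h2 =>
    simp only [RawFm.fvJ, RawFm.subst, Finset.mem_union] at hu ⊢
    exact hu.imp (fun h => h1 σ h hz) (fun h => h2 σ h hz)
  | just _ _ h =>
    simp only [RawFm.fvJ, RawFm.subst, Finset.mem_union] at hu ⊢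
    exact hu.imp (fun h' => h σ h' hz) (fun h' => Tm.mem_fvJ_subst σ _ h' hz)
  | neg _ h | isTrue _ h | isFalse _ h | box _ h => exact h σ hu hz
  | all y φ h => exact h _ hu hz
  | allJ v φ h =>
    have hlt := (σ.forcedJ_spec (.allJ v φ)).2.2.1 u hu z hz
    simp only [RawFm.fvJ, Finset.mem_erase] at hu
    simp only [RawFm.subst, RawFm.fvJ, Finset.mem_erase]
    exact ⟨hlt.ne, h _ hu.2 (by simpa [Subst.updJ, Function.update_of_ne hu.1] using hz)⟩

theorem RawFm.Proper.subst {φ : RawFm C D} (hφ : φ.Proper) (σ : Subst C D) :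
    (φ.subst σ).Proper := by
  induction φ generalizing σ with
  | var x => exact (σ.varP x).2
  | const d => exact (σ.constP d).2
  | eqJ | leJ => trivial
  | imp _ _ h1 h2 | eqv _ _ h1 h2 | ref _ _ h1 h2 => exact ⟨h1 hφ.1 σ, h2 hφ.2 σ⟩
  | neg _ h | isTrue _ h | isFalse _ h | box _ h | just _ _ h => exact h hφ σ
  | all x φ h =>
    refine ⟨RawFm.mem_fvP_subst φ _ hφ.1 ?_, h hφ.2 _⟩
    have : (σ.updP x (Fm.var (σ.forcedP (.all x φ)))).varP x = Fm.var (σ.forcedP (.all x φ)) :=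
      Function.update_self ..
    rw [this]
    exact Fm.mem_fvP_var _
  | allJ u φ h =>
    refine ⟨RawFm.mem_fvJ_subst φ _ hφ.1 ?_, h hφ.2 _⟩
    simp [Subst.updJ, Tm.fvJ]

end ProperSubst

namespace Fm

variable {C : Type u} {D : Type v}

/-- `φ[σ]` -/
noncomputable def subst (φ : Fm C D) (σ : Subst C D) : Fm C D := ⟨φ.1.subst σ, φ.2.subst σ⟩

/-- `φ[x := ψ]` -/
noncomputable def substP (φ : Fm C D) (x : ℕ) (ψ : Fm C D) : Fm C D :=
  φ.subst (Subst.id.updP x ψ)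

/-- `φ[u := t]` -/
noncomputable def substJ (φ : Fm C D) (u : ℕ) (t : Tm C) : Fm C D :=
  φ.subst (Subst.id.updJ u t)

end Fm

section Calculus

variable {C : Type u} {D : Type v}

/-- Alpha-congruence. -/
inductive AlphaEq : Fm C D → Fm C D → Prop
  | refl (φ) : AlphaEq φ φ
  | symm {φ ψ} : AlphaEq φ ψ → AlphaEq ψ φ
  | trans {φ ψ χ} : AlphaEq φ ψ → AlphaEq ψ χ → AlphaEq φ χ
  | imp {φ₁ φ₂ ψ₁ ψ₂} : AlphaEq φ₁ ψ₁ → AlphaEq φ₂ ψ₂ → AlphaEq (φ₁.imp φ₂) (ψ₁.imp ψ₂)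
  | eqv {φ₁ φ₂ ψ₁ ψ₂} : AlphaEq φ₁ ψ₁ → AlphaEq φ₂ ψ₂ → AlphaEq (φ₁.eqv φ₂) (ψ₁.eqv ψ₂)
  | ref {φ₁ φ₂ ψ₁ ψ₂} : AlphaEq φ₁ ψ₁ → AlphaEq φ₂ ψ₂ → AlphaEq (φ₁.ref φ₂) (ψ₁.ref ψ₂)
  | isTrue {φ ψ} : AlphaEq φ ψ → AlphaEq φ.isTrue ψ.isTrue
  | isFalse {φ ψ} : AlphaEq φ ψ → AlphaEq φ.isFalse ψ.isFalse
  | just {φ ψ} (t : Tm C) : AlphaEq φ ψ → AlphaEq (φ.just t) (ψ.just t)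
  | neg {φ ψ} : AlphaEq φ ψ → AlphaEq φ.neg ψ.neg
  | box {φ ψ} : AlphaEq φ ψ → AlphaEq φ.box ψ.box
  | allJ {φ ψ} {u v : ℕ} (hu : u ∈ φ.fvJ) (hv : v ∈ ψ.fvJ) :
      AlphaEq φ (ψ.substJ v (.var u)) → (v ≠ u → u ∉ ψ.fvJ) →
      AlphaEq (.allJ u φ hu) (.allJ v ψ hv)
  | all {φ ψ} {x y : ℕ} (hx : x ∈ φ.fvP) (hy : y ∈ ψ.fvP) :
      AlphaEq φ (ψ.substP y (.var x)) → (y ≠ x → x ∉ ψ.fvP) →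
      AlphaEq (.all x φ hx) (.all y ψ hy)

/-- Syntactical reference `φ ≺ ψ`. -/
def SynRef (φ ψ : Fm C D) : Prop :=
  ∃ (x : ℕ) (ψ' : Fm C D), ψ' ≠ .var x ∧ x ∈ ψ'.fvP ∧ AlphaEq (ψ'.substP x φ) ψ

/-- The equations `σ(x) ≡ σ'(x)` for the propositional variables `x ∈ P` and then for the
justification variables `x ∈ J`, each in increasing order. -/
noncomputable def substEqs (P J : Finset ℕ) (σ σ' : Subst C D) : List (Fm C D) :=
  (P.sort (· ≤ ·)).map (fun x => (σ.varP x).eqv (σ'.varP x)) ++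
    (J.sort (· ≤ ·)).map (fun u => Fm.eqJ (σ.varJ u) (σ'.varJ u))

/-- Tautologies of classical propositional logic, over the connectives `→` and `¬`. -/
def IsTautology (φ : Fm C D) : Prop :=
  ∀ V : Fm C D → Prop, (∀ α β, V (α.imp β) ↔ (V α → V β)) → (∀ α, V α.neg ↔ ¬ V α) → V φ

/-- The smallest set that contains `S` and is closed under Modus Ponens. -/
inductive MPClosure (S : Set (Fm C D)) : Fm C D → Prop
  | base {φ} : φ ∈ S → MPClosure S φ
  | mp {φ ψ} : MPClosure S (φ.imp ψ) → MPClosure S φ → MPClosure S ψ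

/-- `T` is a sufficient set of tautologies: it consists of tautologies, and Modus Ponens
produces every tautology from it. -/
def IsSufficient (T : Set (Fm C D)) : Prop :=
  (∀ φ ∈ T, IsTautology φ) ∧ ∀ φ, IsTautology φ → MPClosure T φ

/-- The axioms, for the set `T` of tautologies. -/
inductive Ax (T : Set (Fm C D)) : Fm C D → Prop
  | taut {φ : Fm C D} : φ ∈ T → Ax T φ
  | genJ {φ : Fm C D} (u : ℕ) (h : u ∈ φ.fvJ) : Ax T φ → Ax T (.allJ u φ h)
  | gen {φ : Fm C D} (x : ℕ) (h : x ∈ φ.fvP) : Ax T φ → Ax T (.all x φ h)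
  | true_iff (φ : Fm C D) : Ax T (φ.isTrue.iff φ)
  | false_iff (φ : Fm C D) : Ax T (φ.isFalse.iff φ.neg)
  | application (φ ψ : Fm C D) (s t : Tm C) :
      Ax T (((φ.imp ψ).just s).imp ((φ.just t).imp (ψ.just (.app s t))))
  | weaken_left (φ : Fm C D) (s t : Tm C) : Ax T ((φ.just s).imp (φ.just (.sum s t)))
  | weaken_right (φ : Fm C D) (s t : Tm C) : Ax T ((φ.just t).imp (φ.just (.sum s t)))
  | box_iff (φ : Fm C D) (u : ℕ) (hu : u ∉ φ.fvJ) :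
      Ax T (φ.box.iff (.exJ u (φ.just (.var u)) (φ.mem_fvJ_just_var u)))
  | box_imp (φ : Fm C D) : Ax T (φ.box.imp φ)
  | ref_of_synRef {φ ψ : Fm C D} : SynRef φ ψ → Ax T (φ.ref ψ)
  | ref_trans (φ ψ χ : Fm C D) : Ax T ((φ.ref ψ).imp ((ψ.ref χ).imp (φ.ref χ)))
  | eqv_of_alphaEq {φ ψ : Fm C D} : AlphaEq φ ψ → Ax T (φ.eqv ψ)
  | eqv_imp (φ ψ : Fm C D) : Ax T ((φ.eqv ψ).imp (φ.imp ψ))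
  | subst_fm (φ : Fm C D) (σ σ' : Subst C D) : σ.OnVars → σ'.OnVars →
      Ax T (.impConj (substEqs φ.fvP φ.fvJ σ σ') ((φ.subst σ).eqv (φ.subst σ')))
  | exJ_intro (φ : Fm C D) (u : ℕ) (t : Tm C) (h : u ∈ φ.fvJ) :
      Ax T ((φ.substJ u t).imp (.exJ u φ h))
  | allJ_elim (φ : Fm C D) (u : ℕ) (t : Tm C) (h : u ∈ φ.fvJ) :
      Ax T ((Fm.allJ u φ h).imp (φ.substJ u t))
  | allJ_imp (φ ψ : Fm C D) (u : ℕ) (hψ : u ∈ ψ.fvJ) (hφ : u ∈ φ.fvJ) :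
      Ax T ((Fm.allJ u (ψ.imp φ) (Fm.mem_fvJ_imp_right ψ hφ)).imp
        ((Fm.allJ u ψ hψ).imp (.allJ u φ hφ)))
  | allJ_imp_const (φ ψ : Fm C D) (u : ℕ) (hψ : u ∉ ψ.fvJ) (hφ : u ∈ φ.fvJ) :
      Ax T ((Fm.allJ u (ψ.imp φ) (Fm.mem_fvJ_imp_right ψ hφ)).imp (ψ.imp (.allJ u φ hφ)))
  | ex_intro (φ : Fm C D) (x : ℕ) (ψ : Fm C D) (h : x ∈ φ.fvP) :
      Ax T ((φ.substP x ψ).imp (.ex x φ h))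
  | all_elim (φ : Fm C D) (x : ℕ) (ψ : Fm C D) (h : x ∈ φ.fvP) :
      Ax T ((Fm.all x φ h).imp (φ.substP x ψ))
  | all_imp (φ ψ : Fm C D) (x : ℕ) (hψ : x ∈ ψ.fvP) (hφ : x ∈ φ.fvP) :
      Ax T ((Fm.all x (ψ.imp φ) (Fm.mem_fvP_imp_right ψ hφ)).imp
        ((Fm.all x ψ hψ).imp (.all x φ hφ)))
  | all_imp_const (φ ψ : Fm C D) (x : ℕ) (hψ : x ∉ ψ.fvP) (hφ : x ∈ φ.fvP) :
      Ax T ((Fm.all x (ψ.imp φ) (Fm.mem_fvP_imp_right ψ hφ)).imp (ψ.imp (.all x φ hφ)))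
  | le_iff (s t : Tm C) (x : ℕ) :
      Ax T ((Fm.leJ s t).iff (.all x (((Fm.var x).just s).imp ((Fm.var x).just t))
        (Fm.mem_fvP_imp_right _ (Fm.mem_fvP_just t (Fm.mem_fvP_var x)))))
  | eqJ_iff (s t : Tm C) : Ax T ((Fm.eqJ s t).iff ((Fm.leJ s t).and (.leJ t s)))
  | subst_tm (t : Tm C) (σ σ' : Subst C D) : σ.OnVars → σ'.OnVars →
      Ax T (.impConj (substEqs ∅ t.fvJ σ σ') (.eqJ (t.subst σ) (t.subst σ')))

/-- `Φ ⊢ φ` -/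
def Derivable (T Φ : Set (Fm C D)) (φ : Fm C D) : Prop := MPClosure (Φ ∪ {α | Ax T α}) φ

def Consistent (T Φ : Set (Fm C D)) : Prop :=
  ¬ ∃ φ, Derivable T Φ φ ∧ Derivable T Φ φ.neg

/-- Henkin sets; `Maximal` refers to inclusion. -/
structure IsHenkin (T Φ : Set (Fm C D)) : Prop where
  maximal : Maximal (Consistent T) Φ
  allJ_iff (φ : Fm C D) (u : ℕ) (h : u ∈ φ.fvJ) :
    Derivable T Φ (.allJ u φ h) ↔ ∀ c : C, Derivable T Φ (φ.substJ u (.const c))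
  all_iff (φ : Fm C D) (x : ℕ) (h : x ∈ φ.fvP) :
    Derivable T Φ (.all x φ h) ↔ ∀ d : D, Derivable T Φ (φ.substP x (.const d))

end Calculus

/-- Assignments: propositional variables denote propositions, justification variables denote
indexes. -/
@[ext]
structure Assignment (M : Type w) (L : Type w) where
  p : ℕ → M
  j : ℕ → L

namespace Assignment

variable {M L : Type w}

def updP (γ : Assignment M L) (x : ℕ) (m : M) : Assignment M L :=
  { γ with p := Function.update γ.p x m }

def updJ (γ : Assignment M L) (u : ℕ) (l : L) : Assignment M L :=
  { γ with j := Function.update γ.j u l }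

end Assignment

/-- Models. `L` is the set of indexes and `M` the propositional universe; the Gamma-function
consists of its restrictions `Γ` to formulas and `ΓJ` to justification terms. -/
structure Model (C : Type u) (D : Type v) where
  L : Type w
  M : Type w
  [order : PartialOrder L]
  add : L → L → L
  mul : L → L → L
  TRUE : Set M
  FALSE : Set M
  NECESSARY : Set M
  REASON : L → Set M
  Ref : M → M → Prop
  Γ : Fm C D → Assignment M L → M
  ΓJ : Tm C → Assignment M L → L
  true_union_false : TRUE ∪ FALSE = Set.univ
  true_inter_false : TRUE ∩ FALSE = ∅
  necessary_subset : NECESSARY ⊆ TRUE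
  necessary_eq : NECESSARY = ⋃ l, REASON l
  /-- `l ↦ REASON l` is an order isomorphism from `L` onto the family of the `REASON l`. -/
  le_iff : ∀ l l' : L, l ≤ l' ↔ REASON l ⊆ REASON l'
  ref_trans : ∀ a b c, Ref a b → Ref b c → Ref a c
  /-- Extension property -/
  ep : ∀ x γ, Γ (.var x) γ = γ.p x
  epJ : ∀ u γ, ΓJ (.var u) γ = γ.j u
  /-- Coincidence property -/
  cp : ∀ φ γ γ', (∀ x ∈ φ.fvP, γ.p x = γ'.p x) → (∀ u ∈ φ.fvJ, γ.j u = γ'.j u) →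
    Γ φ γ = Γ φ γ'
  cpJ : ∀ t γ γ', (∀ u ∈ t.fvJ, γ.j u = γ'.j u) → ΓJ t γ = ΓJ t γ'
  /-- Substitution property -/
  sp : ∀ φ (σ : Subst C D) γ, σ.OnVars →
    Γ (φ.subst σ) γ = Γ φ ⟨fun x => Γ (σ.varP x) γ, fun u => ΓJ (σ.varJ u) γ⟩
  spJ : ∀ t (σ : Subst C D) γ, σ.OnVars →
    ΓJ (t.subst σ) γ = ΓJ t ⟨fun x => Γ (σ.varP x) γ, fun u => ΓJ (σ.varJ u) γ⟩
  /-- Reference property -/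
  rp : ∀ φ ψ γ, SynRef φ ψ → Ref (Γ φ γ) (Γ ψ γ)
  /-- Homomorphism property -/
  hp_sum : ∀ s t γ, ΓJ (.sum s t) γ = add (ΓJ s γ) (ΓJ t γ)
  hp_app : ∀ s t γ, ΓJ (.app s t) γ = mul (ΓJ s γ) (ΓJ t γ)
  /-- Truth conditions -/
  imp_true : ∀ φ ψ γ, Γ (φ.imp ψ) γ ∈ TRUE ↔ Γ φ γ ∈ FALSE ∨ Γ ψ γ ∈ TRUE
  neg_true : ∀ φ γ, Γ φ.neg γ ∈ TRUE ↔ Γ φ γ ∉ TRUE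
  isTrue_true : ∀ φ γ, Γ φ.isTrue γ ∈ TRUE ↔ Γ φ γ ∈ TRUE
  isFalse_true : ∀ φ γ, Γ φ.isFalse γ ∈ TRUE ↔ Γ φ γ ∈ FALSE
  eqv_true : ∀ φ ψ γ, Γ (φ.eqv ψ) γ ∈ TRUE ↔ Γ φ γ = Γ ψ γ
  ref_true : ∀ φ ψ γ, Γ (φ.ref ψ) γ ∈ TRUE ↔ Ref (Γ φ γ) (Γ ψ γ)
  eqJ_true : ∀ s t γ, Γ (.eqJ s t) γ ∈ TRUE ↔ ΓJ s γ = ΓJ t γ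
  leJ_true : ∀ s t γ, Γ (.leJ s t) γ ∈ TRUE ↔ ΓJ s γ ≤ ΓJ t γ
  box_true : ∀ φ γ, Γ φ.box γ ∈ TRUE ↔ Γ φ γ ∈ NECESSARY
  just_true : ∀ φ t γ, Γ (φ.just t) γ ∈ TRUE ↔ Γ φ γ ∈ REASON (ΓJ t γ)
  app_reason : ∀ φ ψ s t γ, Γ (φ.imp ψ) γ ∈ REASON (ΓJ s γ) → Γ φ γ ∈ REASON (ΓJ t γ) →
    Γ ψ γ ∈ REASON (ΓJ (.app s t) γ)
  sum_reason : ∀ φ s t γ, Γ φ γ ∈ REASON (ΓJ s γ) ∪ REASON (ΓJ t γ) →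
    Γ φ γ ∈ REASON (ΓJ (.sum s t) γ)
  allJ_true : ∀ u φ (h : u ∈ φ.fvJ) γ,
    Γ (.allJ u φ h) γ ∈ TRUE ↔ ∀ l, Γ φ (γ.updJ u l) ∈ TRUE
  all_true : ∀ x φ (h : x ∈ φ.fvP) γ,
    Γ (.all x φ h) γ ∈ TRUE ↔ ∀ m, Γ φ (γ.updP x m) ∈ TRUE

section Semantics

variable {C : Type u} {D : Type v}

/-- `(𝓜, γ) ⊨ φ` -/
def Model.Sat (𝓜 : Model.{u, v, w} C D) (γ : Assignment 𝓜.M 𝓜.L) (φ : Fm C D) : Prop :=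
  𝓜.Γ φ γ ∈ 𝓜.TRUE

/-- Some interpretation, with universes in `Type w`, satisfies all formulas of `Φ`. -/
def HasModel (Φ : Set (Fm C D)) : Prop :=
  ∃ (𝓜 : Model.{u, v, w} C D) (γ : Assignment 𝓜.M 𝓜.L), ∀ φ ∈ Φ, 𝓜.Sat γ φ

/-- `Φ ⊩ φ`: logical consequence over the interpretations with universes in `Type w`. -/
def Entails (Φ : Set (Fm C D)) (φ : Fm C D) : Prop :=
  ∀ (𝓜 : Model.{u, v, w} C D) (γ : Assignment 𝓜.M 𝓜.L), (∀ ψ ∈ Φ, 𝓜.Sat γ ψ) → 𝓜.Sat γ φ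

end Semantics

end EpsilonJ

namespace EpsilonJ

/-! ### Atoms and translations between languages -/

/-! Soundness is an induction over the axioms. The converse reduces to model existence: if `φ` is
not derivable from `Φ`, then `Φ` together with `¬φ` is consistent, and a model of it refutes `Φ ⊩
φ`.

A Henkin set has a term model (`termModel`). Propositions are formulas, and indexes are terms,
modulo provable `≡`; the value of `φ` is the class of the instance of `φ` in which representatives
of the assigned classes replace the free variables. The substitution axioms make this independent of
the representatives, and maximality makes derivability a truth valuation. A quantifier of the model
ranges over the classes of all formulas or terms: quantifier elimination covers all of them, and the
Henkin property says that the constants already suffice for the converse (`all_subst_iff`,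
`allJ_subst_iff`). Applied to the axioms for `≤` and `□`, the same property identifies the order of
indexes with inclusion of reasons, and necessity with justification by some term.

A consistent set becomes part of a Henkin set in a larger language. The inductive type `Wit` has a
constant for every variable and every raw formula over `Wit` itself, so one extension replaces the
usual infinite chain of languages. A witness is larger than every constant in its formula. Hence
finitely many witness axioms can be added in order of size, each witness being new when its axiom is
added (`consistent_union_range`). Compactness and Zorn's lemma give the Henkin set, and the reduct
of its term model to the original constants is the required model.

The technical core is the control of bound variables. Substitutions, renamings of constants and
replacements of constants by variables are all translations, whose bound variables depend only on
the atoms of the translated quantified formula. Therefore translations compose exactly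
(`RawFm.tr_tr`), the identity translation is a normal form for alpha-congruence (`alphaEq_iff`), and
every translation preserves derivability (`Derivable.tr`). The last fact yields generalization on
constants and the consistency of the language extension. -/

/-- The variables and constants of either sort. -/
inductive Atom (C : Type u) (D : Type v) : Type (max u v)
  | varP : ℕ → Atom C D
  | constP : D → Atom C D
  | varJ : ℕ → Atom C D
  | constJ : C → Atom C D

section

variable {C : Type u} {D : Type v}

/-- The variables and constants of a term. -/
def Tm.atoms (D : Type v) : Tm C → Set (Atom C D)
  | .var u => {.varJ u}
  | .const c => {.constJ c}
  | .app s t => s.atoms D ∪ t.atoms D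
  | .sum s t => s.atoms D ∪ t.atoms D

/-- The free variables and the constants of a formula. -/
def RawFm.atoms : RawFm C D → Set (Atom C D)
  | .var x => {.varP x}
  | .const d => {.constP d}
  | .imp φ ψ => φ.atoms ∪ ψ.atoms
  | .neg φ => φ.atoms
  | .eqv φ ψ => φ.atoms ∪ ψ.atoms
  | .ref φ ψ => φ.atoms ∪ ψ.atoms
  | .eqJ s t => s.atoms D ∪ t.atoms D
  | .leJ s t => s.atoms D ∪ t.atoms D
  | .isTrue φ => φ.atoms
  | .isFalse φ => φ.atoms
  | .box φ => φ.atoms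
  | .just φ t => φ.atoms ∪ t.atoms D
  | .all x φ => φ.atoms \ {.varP x}
  | .allJ u φ => φ.atoms \ {.varJ u}

def Fm.atoms (φ : Fm C D) : Set (Atom C D) := φ.1.atoms

theorem Tm.finite_atoms (t : Tm C) : (t.atoms D).Finite := by
  induction t with
  | var | const => exact Set.finite_singleton _
  | app _ _ h1 h2 | sum _ _ h1 h2 => exact h1.union h2

theorem RawFm.finite_atoms (φ : RawFm C D) : φ.atoms.Finite := by
  induction φ with
  | var | const => exact Set.finite_singleton _
  | imp _ _ h1 h2 | eqv _ _ h1 h2 | ref _ _ h1 h2 => exact h1.union h2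
  | eqJ s t | leJ s t => exact s.finite_atoms.union t.finite_atoms
  | neg _ h | isTrue _ h | isFalse _ h | box _ h => exact h
  | just _ t h => exact h.union t.finite_atoms
  | all _ _ h | allJ _ _ h => exact h.sdiff

theorem Tm.varJ_mem_atoms {t : Tm C} {u : ℕ} : Atom.varJ u ∈ t.atoms D ↔ u ∈ t.fvJ := by
  induction t <;> simp_all [atoms, fvJ]

theorem Tm.constJ_mem_atoms {t : Tm C} {c : C} : Atom.constJ c ∈ t.atoms D ↔ c ∈ t.conJ := by
  induction t <;> simp_all [atoms, conJ]

theorem Tm.varP_notMem_atoms {t : Tm C} {x : ℕ} : Atom.varP x ∉ t.atoms D := by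
  induction t <;> simp_all [atoms]

theorem Tm.constP_notMem_atoms {t : Tm C} {d : D} : Atom.constP d ∉ t.atoms D := by
  induction t <;> simp_all [atoms]

theorem RawFm.varP_mem_atoms {φ : RawFm C D} {x : ℕ} : Atom.varP x ∈ φ.atoms ↔ x ∈ φ.fvP := by
  induction φ <;> simp_all [atoms, fvP, Tm.varP_notMem_atoms, and_comm]

theorem RawFm.constP_mem_atoms {φ : RawFm C D} {d : D} :
    Atom.constP d ∈ φ.atoms ↔ d ∈ φ.conP := by
  induction φ <;> simp_all [atoms, conP, Tm.constP_notMem_atoms]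

theorem RawFm.varJ_mem_atoms {φ : RawFm C D} {u : ℕ} : Atom.varJ u ∈ φ.atoms ↔ u ∈ φ.fvJ := by
  induction φ <;> simp_all [atoms, fvJ, Tm.varJ_mem_atoms, and_comm]

theorem RawFm.constJ_mem_atoms {φ : RawFm C D} {c : C} :
    Atom.constJ c ∈ φ.atoms ↔ c ∈ φ.conJ := by
  induction φ <;> simp_all [atoms, conJ, Tm.constJ_mem_atoms]

theorem Fm.finite_atoms (φ : Fm C D) : φ.atoms.Finite := φ.1.finite_atoms

theorem Fm.varP_mem_atoms {φ : Fm C D} {x : ℕ} : Atom.varP x ∈ φ.atoms ↔ x ∈ φ.fvP :=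
  RawFm.varP_mem_atoms

theorem Fm.varJ_mem_atoms {φ : Fm C D} {u : ℕ} : Atom.varJ u ∈ φ.atoms ↔ u ∈ φ.fvJ :=
  RawFm.varJ_mem_atoms

end

/-- Formulas and terms, as values of substitutions. -/
inductive Entry (C : Type u) (D : Type v) : Type (max u v)
  | fm : Fm C D → Entry C D
  | tm : Tm C → Entry C D

def Entry.atoms {C : Type u} {D : Type v} : Entry C D → Set (Atom C D)
  | .fm φ => φ.atoms
  | .tm t => t.atoms D

theorem Entry.finite_atoms {C : Type u} {D : Type v} (e : Entry C D) : e.atoms.Finite := by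
  cases e with
  | fm φ => exact φ.finite_atoms
  | tm t => exact t.finite_atoms

/-- Substitutions that put formulas and terms of one language for the variables and constants
of another. -/
@[ext]
structure Translation (C D C' D' : Type*) where
  varP : ℕ → Fm C' D'
  constP : D → Fm C' D'
  varJ : ℕ → Tm C'
  constJ : C → Tm C'

namespace Translation

variable {C D C' D' : Type*}

def val (σ : Translation C D C' D') : Atom C D → Entry C' D'
  | .varP x => .fm (σ.varP x)
  | .constP d => .fm (σ.constP d)
  | .varJ u => .tm (σ.varJ u)
  | .constJ c => .tm (σ.constJ c)

def updP (σ : Translation C D C' D') (x : ℕ) (φ : Fm C' D') : Translation C D C' D' :=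
  { σ with varP := Function.update σ.varP x φ }

def updJ (σ : Translation C D C' D') (u : ℕ) (t : Tm C') : Translation C D C' D' :=
  { σ with varJ := Function.update σ.varJ u t }

theorem val_updP_self (σ : Translation C D C' D') (x : ℕ) (φ : Fm C' D') :
    (σ.updP x φ).val (.varP x) = .fm φ := by
  simp [val, updP]

theorem val_updP_of_ne (σ : Translation C D C' D') {x : ℕ} (φ : Fm C' D') {a : Atom C D}
    (h : a ≠ .varP x) : (σ.updP x φ).val a = σ.val a := by
  cases a <;> simp_all [val, updP]

theorem val_updJ_self (σ : Translation C D C' D') (u : ℕ) (t : Tm C') :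
    (σ.updJ u t).val (.varJ u) = .tm t := by
  simp [val, updJ]

theorem val_updJ_of_ne (σ : Translation C D C' D') {u : ℕ} (t : Tm C') {a : Atom C D}
    (h : a ≠ .varJ u) : (σ.updJ u t).val a = σ.val a := by
  cases a <;> simp_all [val, updJ]

/-- The atoms of the values of `σ` on `S`. -/
def image (σ : Translation C D C' D') (S : Set (Atom C D)) : Set (Atom C' D') :=
  {b | ∃ a ∈ S, b ∈ (σ.val a).atoms}

theorem finite_image (σ : Translation C D C' D') {S : Set (Atom C D)} (hS : S.Finite) :
    (σ.image S).Finite := by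
  have : σ.image S = ⋃ a ∈ S, (σ.val a).atoms := by ext; simp [image]
  rw [this]
  exact hS.biUnion fun a _ => (σ.val a).finite_atoms

theorem image_union (σ : Translation C D C' D') (S S' : Set (Atom C D)) :
    σ.image (S ∪ S') = σ.image S ∪ σ.image S' := by
  ext b
  simp only [image, Set.mem_ofPred_eq, Set.mem_union, or_and_right, exists_or]

theorem image_singleton (σ : Translation C D C' D') (a : Atom C D) :
    σ.image {a} = (σ.val a).atoms := by
  ext b; simp [image]

theorem image_congr {σ τ : Translation C D C' D'} {S : Set (Atom C D)}
    (h : ∀ a ∈ S, σ.val a = τ.val a) : σ.image S = τ.image S := by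
  ext b
  simp only [image, Set.mem_ofPred_eq]
  exact exists_congr fun a => and_congr_right fun ha => by rw [h a ha]

end Translation

/-- The least propositional variable greater than all those in `S`. -/
noncomputable def nextP {C : Type u} {D : Type v} (S : Set (Atom C D)) : ℕ :=
  sInf {y | ∀ z, Atom.varP z ∈ S → z < y}

/-- The least justification variable greater than all those in `S`. -/
noncomputable def nextJ {C : Type u} {D : Type v} (S : Set (Atom C D)) : ℕ :=
  sInf {y | ∀ z, Atom.varJ z ∈ S → z < y}

theorem lt_nextP {C : Type u} {D : Type v} {S : Set (Atom C D)} (hS : S.Finite) :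
    ∀ z, Atom.varP z ∈ S → z < nextP S := by
  refine Nat.sInf_mem (s := {y | ∀ z, Atom.varP z ∈ S → z < y}) ?_
  have hf : {z | (Atom.varP z : Atom C D) ∈ S}.Finite :=
    hS.preimage fun _ _ _ _ h => by simpa using h
  obtain ⟨b, hb⟩ := hf.bddAbove
  exact ⟨b + 1, fun z hz => Nat.lt_succ_of_le (hb hz)⟩

theorem lt_nextJ {C : Type u} {D : Type v} {S : Set (Atom C D)} (hS : S.Finite) :
    ∀ z, Atom.varJ z ∈ S → z < nextJ S := by
  refine Nat.sInf_mem (s := {y | ∀ z, Atom.varJ z ∈ S → z < y}) ?_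
  have hf : {z | (Atom.varJ z : Atom C D) ∈ S}.Finite :=
    hS.preimage fun _ _ _ _ h => by simpa using h
  obtain ⟨b, hb⟩ := hf.bddAbove
  exact ⟨b + 1, fun z hz => Nat.lt_succ_of_le (hb hz)⟩

theorem nextP_notMem {C : Type u} {D : Type v} {S : Set (Atom C D)} (hS : S.Finite) :
    Atom.varP (nextP S) ∉ S := fun h => (lt_nextP hS _ h).false

theorem nextJ_notMem {C : Type u} {D : Type v} {S : Set (Atom C D)} (hS : S.Finite) :
    Atom.varJ (nextJ S) ∉ S := fun h => (lt_nextJ hS _ h).false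

/-! ### Translation of terms and formulas: atoms, congruence, composition -/

section

variable {C D C' D' C'' D'' : Type*}

def Tm.tr (σ : Translation C D C' D') : Tm C → Tm C'
  | .var u => σ.varJ u
  | .const c => σ.constJ c
  | .app s t => .app (s.tr σ) (t.tr σ)
  | .sum s t => .sum (s.tr σ) (t.tr σ)

/-- The bound variable follows the rule of `RawFm.subst`, but it is expressed through the set of
atoms that the values contribute. This is what makes iterated translations comparable. -/
noncomputable def RawFm.tr : RawFm C D → Translation C D C' D' → RawFm C' D'
  | .var x, σ => (σ.varP x).1
  | .const d, σ => (σ.constP d).1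
  | .imp φ ψ, σ => .imp (φ.tr σ) (ψ.tr σ)
  | .neg φ, σ => .neg (φ.tr σ)
  | .eqv φ ψ, σ => .eqv (φ.tr σ) (ψ.tr σ)
  | .ref φ ψ, σ => .ref (φ.tr σ) (ψ.tr σ)
  | .eqJ s t, σ => .eqJ (s.tr σ) (t.tr σ)
  | .leJ s t, σ => .leJ (s.tr σ) (t.tr σ)
  | .isTrue φ, σ => .isTrue (φ.tr σ)
  | .isFalse φ, σ => .isFalse (φ.tr σ)
  | .box φ, σ => .box (φ.tr σ)
  | .just φ t, σ => .just (φ.tr σ) (t.tr σ)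
  | .all x φ, σ => .all (nextP (σ.image (RawFm.all x φ).atoms))
      (φ.tr (σ.updP x (Fm.var (nextP (σ.image (RawFm.all x φ).atoms)))))
  | .allJ u φ, σ => .allJ (nextJ (σ.image (RawFm.allJ u φ).atoms))
      (φ.tr (σ.updJ u (Tm.var (nextJ (σ.image (RawFm.allJ u φ).atoms)))))

theorem Tm.atoms_tr (σ : Translation C D C' D') (t : Tm C) :
    (t.tr σ).atoms D' = σ.image (t.atoms D) := by
  induction t with
  | var | const => simp [tr, atoms, Translation.image_singleton, Translation.val, Entry.atoms]
  | app _ _ h1 h2 | sum _ _ h1 h2 => simp [tr, atoms, Translation.image_union, h1, h2]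

/-- Since `y` is fresh, the value of `x` is the only source of `y`, so removing `y` afterwards
amounts to removing `x` beforehand. -/
theorem Translation.image_updP_diff (σ : Translation C D C' D') {S : Set (Atom C D)} {x y : ℕ}
    (hy : Atom.varP y ∉ σ.image (S \ {.varP x})) :
    (σ.updP x (Fm.var y)).image S \ {.varP y} = σ.image (S \ {.varP x}) := by
  ext b
  constructor
  · rintro ⟨⟨a, ha, hb⟩, hne⟩
    by_cases hax : a = .varP x
    · subst hax
      rw [val_updP_self] at hb
      exact absurd hb hne
    · rw [val_updP_of_ne _ _ hax] at hb
      exact ⟨a, ⟨ha, hax⟩, hb⟩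
  · intro hb
    refine ⟨?_, fun h => hy (h ▸ hb)⟩
    obtain ⟨a, ha, hb⟩ := hb
    exact ⟨a, ha.1, by rwa [val_updP_of_ne _ _ ha.2]⟩

theorem Translation.image_updJ_diff (σ : Translation C D C' D') {S : Set (Atom C D)} {u v : ℕ}
    (hv : Atom.varJ v ∉ σ.image (S \ {.varJ u})) :
    (σ.updJ u (Tm.var v)).image S \ {.varJ v} = σ.image (S \ {.varJ u}) := by
  ext b
  constructor
  · rintro ⟨⟨a, ha, hb⟩, hne⟩
    by_cases hax : a = .varJ u
    · subst hax
      rw [val_updJ_self] at hb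
      exact absurd hb hne
    · rw [val_updJ_of_ne _ _ hax] at hb
      exact ⟨a, ⟨ha, hax⟩, hb⟩
  · intro hb
    refine ⟨?_, fun h => hv (h ▸ hb)⟩
    obtain ⟨a, ha, hb⟩ := hb
    exact ⟨a, ha.1, by rwa [val_updJ_of_ne _ _ ha.2]⟩

/-- At a quantifier the new bound variable is fresh, so binding it removes exactly the contribution
of the old one. Consequently the bound variables chosen by a second translation can be computed from
images of atoms alone. -/
theorem RawFm.atoms_tr (φ : RawFm C D) (σ : Translation C D C' D') :
    (φ.tr σ).atoms = σ.image φ.atoms := by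
  induction φ generalizing σ with
  | var | const =>
    simp [tr, atoms, Translation.image_singleton, Translation.val, Entry.atoms, Fm.atoms]
  | imp _ _ h1 h2 | eqv _ _ h1 h2 | ref _ _ h1 h2 =>
    simp [tr, atoms, Translation.image_union, h1, h2]
  | eqJ | leJ => simp [tr, atoms, Translation.image_union, Tm.atoms_tr]
  | just _ _ h => simp [tr, atoms, Translation.image_union, Tm.atoms_tr, h]
  | neg _ h | isTrue _ h | isFalse _ h | box _ h => exact h σ
  | all x φ h =>
    simp only [tr, atoms, h]
    exact σ.image_updP_diff (nextP_notMem (σ.finite_image φ.finite_atoms.sdiff))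
  | allJ x φ h =>
    simp only [tr, atoms, h]
    exact σ.image_updJ_diff (nextJ_notMem (σ.finite_image φ.finite_atoms.sdiff))

theorem RawFm.Proper.tr {φ : RawFm C D} (hφ : φ.Proper) (σ : Translation C D C' D') :
    (φ.tr σ).Proper := by
  induction φ generalizing σ with
  | var x => exact (σ.varP x).2
  | const d => exact (σ.constP d).2
  | eqJ | leJ => trivial
  | imp _ _ h1 h2 | eqv _ _ h1 h2 | ref _ _ h1 h2 => exact ⟨h1 hφ.1 σ, h2 hφ.2 σ⟩
  | neg _ h | isTrue _ h | isFalse _ h | box _ h | just _ _ h => exact h hφ σ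
  | all x φ h =>
    refine ⟨?_, h hφ.2 _⟩
    rw [← RawFm.varP_mem_atoms, RawFm.atoms_tr]
    refine ⟨.varP x, RawFm.varP_mem_atoms.2 hφ.1, ?_⟩
    rw [Translation.val_updP_self]
    exact Set.mem_singleton _
  | allJ u φ h =>
    refine ⟨?_, h hφ.2 _⟩
    rw [← RawFm.varJ_mem_atoms, RawFm.atoms_tr]
    refine ⟨.varJ u, RawFm.varJ_mem_atoms.2 hφ.1, ?_⟩
    rw [Translation.val_updJ_self]
    exact Set.mem_singleton _

theorem Tm.tr_congr {σ τ : Translation C D C' D'} (t : Tm C)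
    (h : ∀ a ∈ t.atoms D, σ.val a = τ.val a) : t.tr σ = t.tr τ := by
  induction t with
  | var u => simpa [Translation.val, tr] using h (.varJ u) rfl
  | const c => simpa [Translation.val, tr] using h (.constJ c) rfl
  | app _ _ h1 h2 | sum _ _ h1 h2 =>
    simp only [tr]
    rw [h1 fun a ha => h a (.inl ha), h2 fun a ha => h a (.inr ha)]

/-- Values off the atoms of `φ` cannot even influence the chosen bound variables, because these
depend only on the image of the atoms. -/
theorem RawFm.tr_congr {σ τ : Translation C D C' D'} (φ : RawFm C D)
    (h : ∀ a ∈ φ.atoms, σ.val a = τ.val a) : φ.tr σ = φ.tr τ := by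
  induction φ generalizing σ τ with
  | var x =>
    have := h (.varP x) rfl
    simp only [Translation.val, Entry.fm.injEq] at this
    simp only [tr, this]
  | const d =>
    have := h (.constP d) rfl
    simp only [Translation.val, Entry.fm.injEq] at this
    simp only [tr, this]
  | imp _ _ h1 h2 | eqv _ _ h1 h2 | ref _ _ h1 h2 =>
    simp only [tr]
    rw [h1 fun a ha => h a (.inl ha), h2 fun a ha => h a (.inr ha)]
  | eqJ s t | leJ s t =>
    simp only [tr]
    rw [s.tr_congr fun a ha => h a (.inl ha), t.tr_congr fun a ha => h a (.inr ha)]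
  | just _ t h1 =>
    simp only [tr]
    rw [h1 fun a ha => h a (.inl ha), t.tr_congr fun a ha => h a (.inr ha)]
  | neg _ h1 | isTrue _ h1 | isFalse _ h1 | box _ h1 =>
    simp only [tr]
    rw [h1 h]
  | all x φ h1 =>
    simp only [tr]
    rw [Translation.image_congr h, h1]
    intro a ha
    by_cases hax : a = .varP x
    · subst hax; simp only [Translation.val_updP_self]
    · simp only [Translation.val_updP_of_ne _ _ hax]
      exact h a ⟨ha, hax⟩
  | allJ x φ h1 =>
    simp only [tr]
    rw [Translation.image_congr h, h1]
    intro a ha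
    by_cases hax : a = .varJ x
    · subst hax; simp only [Translation.val_updJ_self]
    · simp only [Translation.val_updJ_of_ne _ _ hax]
      exact h a ⟨ha, hax⟩

noncomputable def Fm.tr (φ : Fm C D) (σ : Translation C D C' D') : Fm C' D' :=
  ⟨φ.1.tr σ, φ.2.tr σ⟩

noncomputable def Entry.tr (σ : Translation C D C' D') : Entry C D → Entry C' D'
  | .fm φ => .fm (φ.tr σ)
  | .tm t => .tm (t.tr σ)

theorem Fm.atoms_tr (φ : Fm C D) (σ : Translation C D C' D') :
    (φ.tr σ).atoms = σ.image φ.atoms := RawFm.atoms_tr _ _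

theorem Fm.tr_congr {σ τ : Translation C D C' D'} (φ : Fm C D)
    (h : ∀ a ∈ φ.atoms, σ.val a = τ.val a) : φ.tr σ = φ.tr τ :=
  Fm.ext (φ.1.tr_congr h)

theorem Entry.atoms_tr (e : Entry C D) (σ : Translation C D C' D') :
    (e.tr σ).atoms = σ.image e.atoms := by
  cases e with
  | fm φ => exact φ.atoms_tr σ
  | tm t => exact t.atoms_tr σ

theorem Entry.tr_congr {σ τ : Translation C D C' D'} (e : Entry C D)
    (h : ∀ a ∈ e.atoms, σ.val a = τ.val a) : e.tr σ = e.tr τ := by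
  cases e with
  | fm φ => exact congrArg Entry.fm (φ.tr_congr h)
  | tm t => exact congrArg Entry.tm (t.tr_congr h)

/-- First `σ`, then `τ`. -/
noncomputable def Translation.comp (σ : Translation C D C' D') (τ : Translation C' D' C'' D'') :
    Translation C D C'' D'' where
  varP x := (σ.varP x).tr τ
  constP d := (σ.constP d).tr τ
  varJ u := (σ.varJ u).tr τ
  constJ c := (σ.constJ c).tr τ

theorem Translation.val_comp (σ : Translation C D C' D') (τ : Translation C' D' C'' D'')
    (a : Atom C D) : (σ.comp τ).val a = (σ.val a).tr τ := by
  cases a <;> rfl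

theorem Translation.image_comp (σ : Translation C D C' D') (τ : Translation C' D' C'' D'')
    (S : Set (Atom C D)) : (σ.comp τ).image S = τ.image (σ.image S) := by
  ext b
  simp only [image, val_comp, Entry.atoms_tr, Set.mem_ofPred_eq]
  constructor
  · rintro ⟨a, ha, c, hc, hb⟩
    exact ⟨c, ⟨a, ha, hc⟩, hb⟩
  · rintro ⟨c, ⟨a, ha, hc⟩, hb⟩
    exact ⟨a, ha, c, hc, hb⟩

theorem Tm.tr_tr (t : Tm C) (σ : Translation C D C' D') (τ : Translation C' D' C'' D'') :
    (t.tr σ).tr τ = t.tr (σ.comp τ) := by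
  induction t with
  | var | const => rfl
  | app _ _ h1 h2 | sum _ _ h1 h2 => simp only [tr, h1, h2]

/-- Freshness of `y` means that updating `τ` at `y` affects no value of `σ` other than the one at
`x`. This is the capture-avoidance step at a quantifier. -/
theorem Translation.val_updP_comp_updP (σ : Translation C D C' D')
    (τ : Translation C' D' C'' D'') {S : Set (Atom C D)} {x y : ℕ} (ψ : Fm C'' D'')
    (hy : Atom.varP y ∉ σ.image (S \ {.varP x})) :
    ∀ a ∈ S, ((σ.updP x (Fm.var y)).comp (τ.updP y ψ)).val a = ((σ.comp τ).updP x ψ).val a := by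
  intro a ha
  by_cases hax : a = .varP x
  · subst hax
    simp only [val_comp, val_updP_self, Entry.tr]
    congr 1
    simp [Fm.tr, Fm.var, RawFm.tr, updP]
  · simp only [val_comp, val_updP_of_ne _ _ hax]
    refine Entry.tr_congr _ fun b hb => val_updP_of_ne _ _ ?_
    rintro rfl
    exact hy ⟨a, ⟨ha, hax⟩, hb⟩

theorem Translation.val_updJ_comp_updJ (σ : Translation C D C' D')
    (τ : Translation C' D' C'' D'') {S : Set (Atom C D)} {u v : ℕ} (t : Tm C'')
    (hv : Atom.varJ v ∉ σ.image (S \ {.varJ u})) :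
    ∀ a ∈ S, ((σ.updJ u (Tm.var v)).comp (τ.updJ v t)).val a = ((σ.comp τ).updJ u t).val a := by
  intro a ha
  by_cases hax : a = .varJ u
  · subst hax
    simp only [val_comp, val_updJ_self, Entry.tr]
    congr 1
    simp [Tm.tr, updJ]
  · simp only [val_comp, val_updJ_of_ne _ _ hax]
    refine Entry.tr_congr _ fun b hb => val_updJ_of_ne _ _ ?_
    rintro rfl
    exact hv ⟨a, ⟨ha, hax⟩, hb⟩

/-- An equality and not merely an alpha-congruence: by `RawFm.atoms_tr` the last bound variable is
computed from the same set of atoms, whether the translation is done in one step or in two. -/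
theorem RawFm.tr_tr (φ : RawFm C D) (σ : Translation C D C' D')
    (τ : Translation C' D' C'' D'') : (φ.tr σ).tr τ = φ.tr (σ.comp τ) := by
  induction φ generalizing σ τ with
  | var | const => rfl
  | imp _ _ h1 h2 | eqv _ _ h1 h2 | ref _ _ h1 h2 => simp only [tr, h1, h2]
  | eqJ | leJ => simp only [tr, Tm.tr_tr]
  | just _ _ h => simp only [tr, h, Tm.tr_tr]
  | neg _ h | isTrue _ h | isFalse _ h | box _ h => simp only [tr, h]
  | all x φ h =>
    have e := RawFm.atoms_tr (.all x φ) σ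
    simp only [tr] at e
    simp only [tr, e, ← Translation.image_comp, h]
    rw [RawFm.tr_congr _ (σ.val_updP_comp_updP τ _ ?_)]
    exact nextP_notMem (σ.finite_image φ.finite_atoms.sdiff)
  | allJ x φ h =>
    have e := RawFm.atoms_tr (.allJ x φ) σ
    simp only [tr] at e
    simp only [tr, e, ← Translation.image_comp, h]
    rw [RawFm.tr_congr _ (σ.val_updJ_comp_updJ τ _ ?_)]
    exact nextJ_notMem (σ.finite_image φ.finite_atoms.sdiff)

theorem Fm.tr_tr (φ : Fm C D) (σ : Translation C D C' D') (τ : Translation C' D' C'' D'') :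
    (φ.tr σ).tr τ = φ.tr (σ.comp τ) := Fm.ext (φ.1.tr_tr σ τ)

end

/-! ### Substitutions as translations, and alpha-congruence -/

/-- On formulas this does not act as the identity: it renames bound variables canonically. -/
def Translation.id {C D : Type*} : Translation C D C D := ⟨Fm.var, Fm.const, Tm.var, Tm.const⟩

def Subst.toTr {C : Type u} {D : Type v} (σ : Subst C D) : Translation C D C D :=
  ⟨σ.varP, σ.constP, σ.varJ, σ.constJ⟩

section

variable {C : Type u} {D : Type v}

/-- Atoms of justification sort contribute no propositional variables, so the bound variable
prescribed for substitutions is the one chosen by `RawFm.tr`. -/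
theorem Subst.forcedP_eq (σ : Subst C D) (φ : RawFm C D) :
    σ.forcedP φ = nextP (σ.toTr.image φ.atoms) := by
  unfold Subst.forcedP nextP
  congr 1
  ext y
  constructor
  · rintro ⟨h1, h2⟩ z ⟨a, ha, hz⟩
    cases a with
    | varP x => exact h1 x (RawFm.varP_mem_atoms.1 ha) z (Fm.varP_mem_atoms.1 hz)
    | constP d => exact h2 d (RawFm.constP_mem_atoms.1 ha) z (Fm.varP_mem_atoms.1 hz)
    | varJ | constJ => exact absurd hz Tm.varP_notMem_atoms
  · intro h
    exact ⟨fun x hx z hz => h z ⟨.varP x, RawFm.varP_mem_atoms.2 hx, Fm.varP_mem_atoms.2 hz⟩,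
      fun d hd z hz => h z ⟨.constP d, RawFm.constP_mem_atoms.2 hd, Fm.varP_mem_atoms.2 hz⟩⟩

theorem Subst.forcedJ_eq (σ : Subst C D) (φ : RawFm C D) :
    σ.forcedJ φ = nextJ (σ.toTr.image φ.atoms) := by
  unfold Subst.forcedJ nextJ
  congr 1
  ext y
  constructor
  · rintro ⟨h1, h2, h3, h4⟩ z ⟨a, ha, hz⟩
    cases a with
    | varP x => exact h1 x (RawFm.varP_mem_atoms.1 ha) z (Fm.varJ_mem_atoms.1 hz)
    | constP d => exact h2 d (RawFm.constP_mem_atoms.1 ha) z (Fm.varJ_mem_atoms.1 hz)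
    | varJ u => exact h3 u (RawFm.varJ_mem_atoms.1 ha) z (Tm.varJ_mem_atoms.1 hz)
    | constJ c => exact h4 c (RawFm.constJ_mem_atoms.1 ha) z (Tm.varJ_mem_atoms.1 hz)
  · intro h
    exact ⟨fun x hx z hz => h z ⟨.varP x, RawFm.varP_mem_atoms.2 hx, Fm.varJ_mem_atoms.2 hz⟩,
      fun d hd z hz => h z ⟨.constP d, RawFm.constP_mem_atoms.2 hd, Fm.varJ_mem_atoms.2 hz⟩,
      fun x hx z hz => h z ⟨.varJ x, RawFm.varJ_mem_atoms.2 hx, Tm.varJ_mem_atoms.2 hz⟩,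
      fun x hx z hz => h z ⟨.constJ x, RawFm.constJ_mem_atoms.2 hx, Tm.varJ_mem_atoms.2 hz⟩⟩

theorem Tm.subst_eq_tr (t : Tm C) (σ : Subst C D) : t.subst σ = t.tr σ.toTr := by
  induction t with
  | var | const => rfl
  | app _ _ h1 h2 | sum _ _ h1 h2 => simp only [subst, tr, h1, h2]

theorem RawFm.subst_eq_tr (φ : RawFm C D) (σ : Subst C D) : φ.subst σ = φ.tr σ.toTr := by
  induction φ generalizing σ with
  | var | const => rfl
  | imp _ _ h1 h2 | eqv _ _ h1 h2 | ref _ _ h1 h2 => simp only [subst, tr, h1, h2]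
  | eqJ | leJ => simp only [subst, tr, Tm.subst_eq_tr]
  | just _ _ h => simp only [subst, tr, h, Tm.subst_eq_tr]
  | neg _ h | isTrue _ h | isFalse _ h | box _ h => simp only [subst, tr, h]
  | all x φ h =>
    simp only [subst, tr, h, Subst.forcedP_eq]
    rfl
  | allJ x φ h =>
    simp only [subst, tr, h, Subst.forcedJ_eq]
    rfl

theorem Fm.subst_eq_tr (φ : Fm C D) (σ : Subst C D) : φ.subst σ = φ.tr σ.toTr :=
  Fm.ext (φ.1.subst_eq_tr σ)

theorem Fm.substP_eq_tr (φ : Fm C D) (x : ℕ) (ψ : Fm C D) :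
    φ.substP x ψ = φ.tr (Translation.id.updP x ψ) := φ.subst_eq_tr _

theorem Fm.substJ_eq_tr (φ : Fm C D) (u : ℕ) (t : Tm C) :
    φ.substJ u t = φ.tr (Translation.id.updJ u t) := φ.subst_eq_tr _

end

section

variable {C D C' D' C'' D'' : Type*}

/-- The entry that consists of an atom. -/
def Atom.toEntry : Atom C D → Entry C D
  | .varP x => .fm (.var x)
  | .constP d => .fm (.const d)
  | .varJ u => .tm (.var u)
  | .constJ c => .tm (.const c)

theorem Translation.val_id (a : Atom C D) : Translation.id.val a = a.toEntry := by
  cases a <;> rfl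

theorem Atom.atoms_toEntry (a : Atom C D) : a.toEntry.atoms = {a} := by
  cases a <;> rfl

theorem Translation.image_id (S : Set (Atom C D)) : Translation.id.image S = S := by
  ext b
  simp [image, val_id, Atom.atoms_toEntry]

/-- Normalizing bound variables before a translation has no effect on the result. Composition in the
other order would normalize the values of `σ`, so there is no such law on that side. -/
theorem Translation.id_comp (σ : Translation C D C' D') : Translation.id.comp σ = σ := rfl

theorem Translation.updP_comp (σ : Translation C D C' D') (x : ℕ) (ψ : Fm C' D')
    (τ : Translation C' D' C'' D'') :
    (σ.updP x ψ).comp τ = (σ.comp τ).updP x (ψ.tr τ) := by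
  ext1 <;> try rfl
  funext y
  simp only [comp, updP, Function.update_apply]
  split_ifs <;> rfl

theorem Translation.updJ_comp (σ : Translation C D C' D') (u : ℕ) (t : Tm C')
    (τ : Translation C' D' C'' D'') :
    (σ.updJ u t).comp τ = (σ.comp τ).updJ u (t.tr τ) := by
  ext1 <;> try rfl
  funext y
  simp only [comp, updJ, Function.update_apply]
  split_ifs <;> rfl

theorem Tm.tr_id (t : Tm C) : t.tr (Translation.id : Translation C D C D) = t := by
  induction t with
  | var | const => rfl
  | app _ _ h1 h2 | sum _ _ h1 h2 => simp only [tr, h1, h2]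

theorem Fm.tr_id_tr (φ : Fm C D) (σ : Translation C D C' D') :
    (φ.tr Translation.id).tr σ = φ.tr σ := by
  rw [Fm.tr_tr, Translation.id_comp]

theorem Entry.tr_tr (e : Entry C D) (σ : Translation C D C' D')
    (τ : Translation C' D' C'' D'') : (e.tr σ).tr τ = e.tr (σ.comp τ) := by
  cases e with
  | fm φ => exact congrArg Entry.fm (φ.tr_tr σ τ)
  | tm t => exact congrArg Entry.tm (t.tr_tr σ τ)

theorem Fm.mem_fvP_tr {φ : Fm C D} {σ : Translation C D C' D'} {x : ℕ} :
    x ∈ (φ.tr σ).fvP ↔ Atom.varP x ∈ σ.image φ.atoms := by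
  rw [← Fm.varP_mem_atoms, Fm.atoms_tr]

theorem Fm.mem_fvJ_tr {φ : Fm C D} {σ : Translation C D C' D'} {u : ℕ} :
    u ∈ (φ.tr σ).fvJ ↔ Atom.varJ u ∈ σ.image φ.atoms := by
  rw [← Fm.varJ_mem_atoms, Fm.atoms_tr]

theorem Fm.mem_fvP_tr_updP {φ : Fm C D} (σ : Translation C D C' D') {x : ℕ} (h : x ∈ φ.fvP)
    (y : ℕ) : y ∈ (φ.tr (σ.updP x (.var y))).fvP := by
  rw [mem_fvP_tr]
  refine ⟨.varP x, varP_mem_atoms.2 h, ?_⟩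
  rw [Translation.val_updP_self]
  exact Set.mem_singleton _

theorem Fm.mem_fvJ_tr_updJ {φ : Fm C D} (σ : Translation C D C' D') {u : ℕ} (h : u ∈ φ.fvJ)
    (v : ℕ) : v ∈ (φ.tr (σ.updJ u (.var v))).fvJ := by
  rw [mem_fvJ_tr]
  refine ⟨.varJ u, varJ_mem_atoms.2 h, ?_⟩
  rw [Translation.val_updJ_self]
  exact Set.mem_singleton _

theorem Fm.tr_imp (φ ψ : Fm C D) (σ : Translation C D C' D') :
    (φ.imp ψ).tr σ = (φ.tr σ).imp (ψ.tr σ) := rfl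

theorem Fm.tr_neg (φ : Fm C D) (σ : Translation C D C' D') : φ.neg.tr σ = (φ.tr σ).neg := rfl

theorem Fm.tr_iff (φ ψ : Fm C D) (σ : Translation C D C' D') :
    (φ.iff ψ).tr σ = (φ.tr σ).iff (ψ.tr σ) := rfl

theorem Fm.exists_tr_all (φ : Fm C D) (x : ℕ) (h : x ∈ φ.fvP) (σ : Translation C D C' D') :
    ∃ y, Atom.varP y ∉ σ.image (φ.atoms \ {.varP x}) ∧
      (Fm.all x φ h).tr σ = Fm.all y (φ.tr (σ.updP x (.var y))) (mem_fvP_tr_updP σ h y) :=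
  ⟨_, nextP_notMem (σ.finite_image φ.finite_atoms.sdiff), rfl⟩

theorem Fm.exists_tr_allJ (φ : Fm C D) (u : ℕ) (h : u ∈ φ.fvJ) (σ : Translation C D C' D') :
    ∃ v, Atom.varJ v ∉ σ.image (φ.atoms \ {.varJ u}) ∧
      (Fm.allJ u φ h).tr σ = Fm.allJ v (φ.tr (σ.updJ u (.var v))) (mem_fvJ_tr_updJ σ h v) :=
  ⟨_, nextJ_notMem (σ.finite_image φ.finite_atoms.sdiff), rfl⟩

end

/-! ### The identity translation as a normal form for alpha-congruence -/

section

variable {C : Type u} {D : Type v} {C' D' : Type*}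

/-- The side condition of the quantifier clauses says that the bound variable on the left is fresh
on the right. Then both sides have the same free atoms, hence get the same canonical bound variable.
-/
theorem AlphaEq.tr_id_eq {φ ψ : Fm C D} (h : AlphaEq φ ψ) :
    φ.tr Translation.id = ψ.tr Translation.id := by
  induction h with
  | refl => rfl
  | symm _ h => exact h.symm
  | trans _ _ h1 h2 => exact h1.trans h2
  | imp _ _ h1 h2 => exact congrArg₂ Fm.imp h1 h2
  | eqv _ _ h1 h2 => exact congrArg₂ Fm.eqv h1 h2
  | ref _ _ h1 h2 => exact congrArg₂ Fm.ref h1 h2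
  | isTrue _ h => exact congrArg Fm.isTrue h
  | isFalse _ h => exact congrArg Fm.isFalse h
  | just t _ h => exact congrArg (Fm.just · _) h
  | neg _ h => exact congrArg Fm.neg h
  | box _ h => exact congrArg Fm.box h
  | @allJ φ ψ u v hu hv _ hne ih =>
    have hfr : Atom.varJ u ∉ Translation.id.image (ψ.atoms \ {.varJ v}) := by
      rw [Translation.image_id]
      rintro ⟨h1, h2⟩
      exact hne (fun h => h2 (h ▸ rfl)) (Fm.varJ_mem_atoms.1 h1)
    rw [Fm.substJ_eq_tr, Fm.tr_tr] at ih
    -- Reading off atoms on both sides of `ih` shows that the canonical bound variables agree.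
    have hat : φ.atoms \ {.varJ u} = ψ.atoms \ {.varJ v} := by
      have h := congrArg Fm.atoms ih
      rw [Fm.atoms_tr, Fm.atoms_tr, Translation.image_id, Translation.image_comp,
        Translation.image_id] at h
      rw [h, Translation.image_updJ_diff _ hfr, Translation.image_id]
    have hat' : (RawFm.allJ u φ.1).atoms = (RawFm.allJ v ψ.1).atoms := hat
    -- The bodies agree after renaming to any common variable: the renaming `u ↦ w` is applied after
    -- `ih`, and freshness of `u` collapses `v ↦ u ↦ w` to `v ↦ w`.
    have key : ∀ w, φ.tr (Translation.id.updJ u (.var w)) =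
        ψ.tr (Translation.id.updJ v (.var w)) := by
      intro w
      rw [← Fm.tr_id_tr, ih, Fm.tr_tr]
      have := Fm.tr_congr ψ (Translation.id.val_updJ_comp_updJ Translation.id (.var w) hfr)
      rw [Translation.id_comp] at this
      rw [← this]
      simp only [← Fm.tr_tr, Fm.tr_id_tr]
    refine Fm.ext ?_
    simp only [Fm.tr, Fm.allJ, RawFm.tr]
    rw [hat']
    exact congrArg (RawFm.allJ _) (congrArg Fm.val (key _))
  | @all φ ψ u v hu hv _ hne ih =>
    have hfr : Atom.varP u ∉ Translation.id.image (ψ.atoms \ {.varP v}) := by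
      rw [Translation.image_id]
      rintro ⟨h1, h2⟩
      exact hne (fun h => h2 (h ▸ rfl)) (Fm.varP_mem_atoms.1 h1)
    rw [Fm.substP_eq_tr, Fm.tr_tr] at ih
    have hat : φ.atoms \ {.varP u} = ψ.atoms \ {.varP v} := by
      have h := congrArg Fm.atoms ih
      rw [Fm.atoms_tr, Fm.atoms_tr, Translation.image_id, Translation.image_comp,
        Translation.image_id] at h
      rw [h, Translation.image_updP_diff _ hfr, Translation.image_id]
    have hat' : (RawFm.all u φ.1).atoms = (RawFm.all v ψ.1).atoms := hat
    have key : ∀ w, φ.tr (Translation.id.updP u (.var w)) =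
        ψ.tr (Translation.id.updP v (.var w)) := by
      intro w
      rw [← Fm.tr_id_tr, ih, Fm.tr_tr]
      have := Fm.tr_congr ψ (Translation.id.val_updP_comp_updP Translation.id (.var w) hfr)
      rw [Translation.id_comp] at this
      rw [← this]
      simp only [← Fm.tr_tr, Fm.tr_id_tr]
    refine Fm.ext ?_
    simp only [Fm.tr, Fm.all, RawFm.tr]
    rw [hat']
    exact congrArg (RawFm.all _) (congrArg Fm.val (key _))

theorem AlphaEq.tr_eq {φ ψ : Fm C D} (h : AlphaEq φ ψ) (σ : Translation C D C' D') :
    φ.tr σ = ψ.tr σ := by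
  rw [← Fm.tr_id_tr, h.tr_id_eq, Fm.tr_id_tr]

/-- A quantified formula needs a single alpha-step, because its normal form has as body precisely
the original body with the bound variable renamed. -/
theorem alphaEq_tr_id (φ : Fm C D) : AlphaEq φ (φ.tr Translation.id) := by
  obtain ⟨φ, hφ⟩ := φ
  induction φ with
  | var | const => exact .refl _
  | imp _ _ h1 h2 => exact .imp (h1 hφ.1) (h2 hφ.2)
  | eqv _ _ h1 h2 => exact .eqv (h1 hφ.1) (h2 hφ.2)
  | ref _ _ h1 h2 => exact .ref (h1 hφ.1) (h2 hφ.2)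
  | neg _ h => exact .neg (h hφ)
  | isTrue _ h => exact .isTrue (h hφ)
  | isFalse _ h => exact .isFalse (h hφ)
  | box _ h => exact .box (h hφ)
  | eqJ | leJ =>
    have : ∀ α β : Fm C D, α = β → AlphaEq α β := fun α _ h => h ▸ .refl α
    exact this _ _ (Fm.ext (by simp only [Fm.tr, RawFm.tr, Tm.tr_id]))
  | just φ t h =>
    have e : Fm.tr ⟨.just φ t, hφ⟩ Translation.id = (Fm.tr ⟨φ, hφ⟩ Translation.id).just t :=
      Fm.ext (by simp only [Fm.tr, Fm.just, RawFm.tr, Tm.tr_id])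
    rw [e]
    exact .just t (h hφ)
  | all x φ _ =>
    obtain ⟨y, hy, e⟩ := Fm.exists_tr_all ⟨φ, hφ.2⟩ x hφ.1 Translation.id
    rw [Translation.image_id] at hy
    have e' : Fm.tr ⟨.all x φ, hφ⟩ Translation.id = _ := e
    rw [e']
    refine (AlphaEq.all (Fm.mem_fvP_tr_updP _ hφ.1 y) (ψ := ⟨φ, hφ.2⟩) hφ.1 ?_ ?_).symm
    · rw [Fm.substP_eq_tr]
      exact .refl _
    · exact fun hne h => hy ⟨Fm.varP_mem_atoms.2 h, fun h => hne (by simpa using h.symm)⟩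
  | allJ x φ _ =>
    obtain ⟨y, hy, e⟩ := Fm.exists_tr_allJ ⟨φ, hφ.2⟩ x hφ.1 Translation.id
    rw [Translation.image_id] at hy
    have e' : Fm.tr ⟨.allJ x φ, hφ⟩ Translation.id = _ := e
    rw [e']
    refine (AlphaEq.allJ (Fm.mem_fvJ_tr_updJ _ hφ.1 y) (ψ := ⟨φ, hφ.2⟩) hφ.1 ?_ ?_).symm
    · rw [Fm.substJ_eq_tr]
      exact .refl _
    · exact fun hne h => hy ⟨Fm.varJ_mem_atoms.2 h, fun h => hne (by simpa using h.symm)⟩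

theorem alphaEq_iff {φ ψ : Fm C D} :
    AlphaEq φ ψ ↔ φ.tr Translation.id = ψ.tr Translation.id :=
  ⟨AlphaEq.tr_id_eq, fun h => (alphaEq_tr_id φ).trans (h ▸ (alphaEq_tr_id ψ).symm)⟩

end

/-! ### Instances of translated quantified formulas -/

section

variable {C D : Type*} {C' : Type u} {D' : Type v}

/-- Equality can fail here: on the left the values of `σ` at the other atoms pass through an
identity translation, which normalizes them. Comparing normal forms removes the difference. -/
theorem alphaEq_substP_tr (φ : Fm C D) (σ : Translation C D C' D') {x y : ℕ} (ψ : Fm C' D')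
    (hy : Atom.varP y ∉ σ.image (φ.atoms \ {.varP x})) :
    AlphaEq ((φ.tr (σ.updP x (.var y))).substP y ψ) (φ.tr (σ.updP x ψ)) := by
  rw [alphaEq_iff, Fm.substP_eq_tr, Fm.tr_tr, Fm.tr_tr, Fm.tr_tr]
  refine φ.tr_congr fun a ha => ?_
  rw [Translation.val_comp, ← Entry.tr_tr, ← Translation.val_comp,
    σ.val_updP_comp_updP _ _ hy a ha, ← Translation.val_comp,
    Translation.updP_comp, Translation.updP_comp]
  by_cases hax : a = .varP x
  · subst hax
    rw [Translation.val_updP_self, Translation.val_updP_self]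
  · simp only [Translation.val_updP_of_ne _ _ hax, Translation.val_comp, Entry.tr_tr,
      Translation.id_comp]

theorem alphaEq_substJ_tr (φ : Fm C D) (σ : Translation C D C' D') {u v : ℕ} (t : Tm C')
    (hv : Atom.varJ v ∉ σ.image (φ.atoms \ {.varJ u})) :
    AlphaEq ((φ.tr (σ.updJ u (.var v))).substJ v t) (φ.tr (σ.updJ u t)) := by
  rw [alphaEq_iff, Fm.substJ_eq_tr, Fm.tr_tr, Fm.tr_tr, Fm.tr_tr]
  refine φ.tr_congr fun a ha => ?_
  rw [Translation.val_comp, ← Entry.tr_tr, ← Translation.val_comp,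
    σ.val_updJ_comp_updJ _ _ hv a ha, ← Translation.val_comp,
    Translation.updJ_comp, Translation.updJ_comp]
  by_cases hax : a = .varJ u
  · subst hax
    rw [Translation.val_updJ_self, Translation.val_updJ_self]
  · simp only [Translation.val_updJ_of_ne _ _ hax, Translation.val_comp, Entry.tr_tr,
      Translation.id_comp]

/-- The bound variable of a translated quantified formula may be any fresh variable. -/
theorem alphaEq_tr_all (φ : Fm C D) {x : ℕ} (h : x ∈ φ.fvP) (σ : Translation C D C' D') {y : ℕ}
    (hy : Atom.varP y ∉ σ.image (φ.atoms \ {.varP x})) :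
    AlphaEq ((Fm.all x φ h).tr σ)
      (Fm.all y (φ.tr (σ.updP x (.var y))) (Fm.mem_fvP_tr_updP σ h y)) := by
  obtain ⟨n, hn, e⟩ := Fm.exists_tr_all φ x h σ
  rw [e]
  refine .all _ _ (alphaEq_substP_tr φ σ _ hy).symm fun hne hmem => hn ?_
  rw [← σ.image_updP_diff hy]
  exact ⟨Fm.mem_fvP_tr.1 hmem, fun h => hne (by simpa using h.symm)⟩

theorem alphaEq_tr_allJ (φ : Fm C D) {u : ℕ} (h : u ∈ φ.fvJ) (σ : Translation C D C' D') {v : ℕ}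
    (hv : Atom.varJ v ∉ σ.image (φ.atoms \ {.varJ u})) :
    AlphaEq ((Fm.allJ u φ h).tr σ)
      (Fm.allJ v (φ.tr (σ.updJ u (.var v))) (Fm.mem_fvJ_tr_updJ σ h v)) := by
  obtain ⟨n, hn, e⟩ := Fm.exists_tr_allJ φ u h σ
  rw [e]
  refine .allJ _ _ (alphaEq_substJ_tr φ σ _ hv).symm fun hne hmem => hn ?_
  rw [← σ.image_updJ_diff hv]
  exact ⟨Fm.mem_fvJ_tr.1 hmem, fun h => hne (by simpa using h.symm)⟩

theorem Fm.tr_updP_of_notMem {φ : Fm C D} {x : ℕ} (h : x ∉ φ.fvP) (σ : Translation C D C' D')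
    (ψ : Fm C' D') : φ.tr (σ.updP x ψ) = φ.tr σ :=
  φ.tr_congr fun _ ha => σ.val_updP_of_ne ψ fun e => h (Fm.varP_mem_atoms.1 (e ▸ ha))

theorem Fm.tr_updJ_of_notMem {φ : Fm C D} {u : ℕ} (h : u ∉ φ.fvJ) (σ : Translation C D C' D')
    (t : Tm C') : φ.tr (σ.updJ u t) = φ.tr σ :=
  φ.tr_congr fun _ ha => σ.val_updJ_of_ne t fun e => h (Fm.varJ_mem_atoms.1 (e ▸ ha))

end

theorem Fm.tr_substP {C : Type u} {D : Type v} {C' D' : Type*} (φ : Fm C D) (x : ℕ) (ψ : Fm C D)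
    (σ : Translation C D C' D') : (φ.substP x ψ).tr σ = φ.tr (σ.updP x (ψ.tr σ)) := by
  rw [Fm.substP_eq_tr, Fm.tr_tr, Translation.updP_comp, Translation.id_comp]

theorem Fm.tr_substJ {C : Type u} {D : Type v} {C' D' : Type*} (φ : Fm C D) (u : ℕ) (t : Tm C)
    (σ : Translation C D C' D') : (φ.substJ u t).tr σ = φ.tr (σ.updJ u (t.tr σ)) := by
  rw [Fm.substJ_eq_tr, Fm.tr_tr, Translation.updJ_comp, Translation.id_comp]

/-- The context is translated with its hole `x` sent to a fresh variable, so that filling the hole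
commutes with the translation up to alpha-congruence. -/
theorem SynRef.tr {C : Type u} {D : Type v} {C' : Type*} {D' : Type*} {φ ψ : Fm C D}
    (h : SynRef φ ψ) (σ : Translation C D C' D') : SynRef (φ.tr σ) (ψ.tr σ) := by
  obtain ⟨x, χ, hne, hx, hα⟩ := h
  have hfr := nextP_notMem (σ.finite_image (S := χ.atoms \ {.varP x}) χ.finite_atoms.sdiff)
  generalize nextP (σ.image (χ.atoms \ {.varP x})) = y at hfr
  refine ⟨y, χ.tr (σ.updP x (.var y)), ?_, Fm.mem_fvP_tr_updP σ hx y, ?_⟩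
  · intro e
    have e := congrArg Fm.val e
    obtain ⟨χ, hχ⟩ := χ
    -- Only variables and constants can be translated to a variable. A variable containing `x` would
    -- be `x` itself, and a constant has no free variable.
    cases χ <;> simp [Fm.tr, Fm.var, RawFm.tr] at e
    · simp only [Fm.fvP, RawFm.fvP, Finset.mem_singleton] at hx
      subst hx
      exact hne rfl
    · simp [Fm.fvP, RawFm.fvP] at hx
  · rw [← hα.tr_eq σ, Fm.tr_substP]
    exact alphaEq_substP_tr χ σ _ hfr

/-! ### The calculus -/

section

variable {C : Type u} {D : Type v}

/-- Truth valuations that respect the propositional connectives. -/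
structure IsValuation (V : Fm C D → Prop) : Prop where
  imp (α β) : V (α.imp β) ↔ (V α → V β)
  neg (α) : V α.neg ↔ ¬ V α

namespace IsValuation

variable {V : Fm C D → Prop}

theorem and (hV : IsValuation V) (α β) : V (α.and β) ↔ V α ∧ V β := by
  simp [Fm.and, hV.imp, hV.neg]

theorem iff (hV : IsValuation V) (α β) : V (α.iff β) ↔ (V α ↔ V β) := by
  simp only [Fm.iff, hV.and, hV.imp]
  tauto

theorem foldl_and (hV : IsValuation V) (l : List (Fm C D)) (a : Fm C D) :
    V (l.foldl Fm.and a) ↔ V a ∧ ∀ b ∈ l, V b := by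
  induction l generalizing a with
  | nil => simp
  | cons b l ih => simp [ih, hV.and, and_assoc]

theorem impConj (hV : IsValuation V) (l : List (Fm C D)) (χ : Fm C D) :
    V (Fm.impConj l χ) ↔ ((∀ a ∈ l, V a) → V χ) := by
  cases l with
  | nil => simp [Fm.impConj]
  | cons a l => simp [Fm.impConj, hV.imp, hV.foldl_and]

end IsValuation

theorem MPClosure.mono {S S' : Set (Fm C D)} (h : S ⊆ S') {φ : Fm C D} (hφ : MPClosure S φ) :
    MPClosure S' φ := by
  induction hφ with
  | base hm => exact .base (h hm)
  | mp _ _ h1 h2 => exact .mp h1 h2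

variable {T Φ Ψ : Set (Fm C D)}

namespace Derivable

theorem mono (h : Φ ⊆ Ψ) {φ : Fm C D} (hφ : Derivable T Φ φ) : Derivable T Ψ φ :=
  MPClosure.mono (Set.union_subset_union_left _ h) hφ

theorem of_empty {φ : Fm C D} (hφ : Derivable T ∅ φ) : Derivable T Φ φ :=
  hφ.mono (Set.empty_subset _)

theorem ax {φ : Fm C D} (h : Ax T φ) : Derivable T Φ φ := .base (.inr h)

theorem hyp {φ : Fm C D} (h : φ ∈ Φ) : Derivable T Φ φ := .base (.inl h)

theorem mp {φ ψ : Fm C D} (h : Derivable T Φ (φ.imp ψ)) (h' : Derivable T Φ φ) :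
    Derivable T Φ ψ := MPClosure.mp h h'

/-- The Modus Ponens case also supplies derivations of both premises. The proofs of `gen` and `genJ`
depend on this. -/
theorem induct {p : Fm C D → Prop} (hyp : ∀ φ ∈ Φ, p φ) (ax : ∀ φ, Ax T φ → p φ)
    (mp : ∀ φ ψ, Derivable T Φ (φ.imp ψ) → Derivable T Φ φ → p (φ.imp ψ) → p φ → p ψ)
    {φ : Fm C D} (h : Derivable T Φ φ) : p φ := by
  have h' : MPClosure (Φ ∪ {α | Ax T α}) φ := h
  induction h' with
  | base hm => exact hm.elim (hyp _) (ax _)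
  | mp h1 h2 ih1 ih2 => exact mp _ _ h1 h2 (ih1 h1) (ih2 h2)

theorem taut (hT : IsSufficient T) {φ : Fm C D} (h : ∀ V, IsValuation V → V φ) :
    Derivable T Φ φ :=
  (hT.2 φ fun V h1 h2 => h V ⟨h1, h2⟩).mono fun _ hα => .inr (.taut hα)

/-- Tautological consequence, from one or two premises. -/
theorem taut₁ (hT : IsSufficient T) {α φ : Fm C D} (hα : Derivable T Φ α)
    (h : ∀ V, IsValuation V → V α → V φ) : Derivable T Φ φ :=
  (taut hT fun V hV => (hV.imp _ _).2 (h V hV)).mp hα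

theorem taut₂ (hT : IsSufficient T) {α β φ : Fm C D} (hα : Derivable T Φ α)
    (hβ : Derivable T Φ β) (h : ∀ V, IsValuation V → V α → V β → V φ) : Derivable T Φ φ :=
  (taut₁ hT hα fun V hV h' => (hV.imp _ _).2 (h V hV h')).mp hβ

theorem exists_finite {φ : Fm C D} (h : Derivable T Φ φ) :
    ∃ F ⊆ Φ, F.Finite ∧ Derivable T F φ := by
  refine induct (p := fun φ => ∃ F ⊆ Φ, F.Finite ∧ Derivable T F φ) ?_ ?_ ?_ h
  · exact fun φ hφ => ⟨{φ}, by simpa using hφ, Set.finite_singleton _, hyp rfl⟩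
  · exact fun φ hφ => ⟨∅, Set.empty_subset _, Set.finite_empty, ax hφ⟩
  · rintro φ ψ - - ⟨F, h1, h2, h3⟩ ⟨G, g1, g2, g3⟩
    exact ⟨F ∪ G, Set.union_subset h1 g1, h2.union g2,
      (h3.mono Set.subset_union_left).mp (g3.mono Set.subset_union_right)⟩

/-- No condition on free variables is needed, because Modus Ponens is the only rule and
generalization is built into the axioms. -/
theorem deduction (hT : IsSufficient T) {α β : Fm C D} (h : Derivable T (insert α Φ) β) :
    Derivable T Φ (α.imp β) := by
  refine induct (p := fun β => Derivable T Φ (α.imp β)) ?_ ?_ ?_ h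
  · rintro φ (rfl | hφ)
    · exact taut hT fun V hV => by simp [hV.imp]
    · exact taut₁ hT (hyp hφ) fun V hV h => by simp [hV.imp, h]
  · exact fun φ hφ => taut₁ hT (ax hφ) fun V hV h => by simp [hV.imp, h]
  · exact fun φ ψ _ _ h1 h2 => taut₂ hT h1 h2 fun V hV => by
      simp only [hV.imp]
      tauto

theorem impConj_elim (hT : IsSufficient T) (l : List (Fm C D)) {χ : Fm C D}
    (h : Derivable T Φ (Fm.impConj l χ)) (hl : ∀ a ∈ l, Derivable T Φ a) : Derivable T Φ χ := by
  cases l with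
  | nil => exact h
  | cons a l =>
    refine h.mp ?_
    have ha := hl a (by simp)
    have hl' : ∀ b ∈ l, Derivable T Φ b := fun b hb => hl b (by simp [hb])
    clear hl h
    induction l generalizing a with
    | nil => exact ha
    | cons b l ih =>
      exact ih (a.and b) (taut₂ hT ha (hl' b (by simp)) fun V hV h1 h2 => (hV.and _ _).2 ⟨h1, h2⟩)
        fun c hc => hl' c (by simp [hc])

theorem impConj_intro (hT : IsSufficient T) (l : List (Fm C D)) {χ : Fm C D}
    (h : Derivable T (Φ ∪ {a | a ∈ l}) χ) : Derivable T Φ (Fm.impConj l χ) := by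
  cases l with
  | nil => exact h.mono (by simp)
  | cons a l =>
    refine deduction hT ?_
    refine induct (p := fun χ => Derivable T (insert (l.foldl Fm.and a) Φ) χ) ?_ ?_ ?_ h
    · rintro φ (hφ | hφ)
      · exact hyp (.inr hφ)
      · refine taut₁ hT (hyp (.inl rfl)) fun V hV h => ?_
        rw [hV.foldl_and] at h
        rcases List.mem_cons.1 hφ with rfl | hφ
        · exact h.1
        · exact h.2 _ hφ
    · exact fun φ hφ => ax hφ
    · exact fun φ ψ _ _ h1 h2 => h1.mp h2

/-- Axioms are closed under generalization, and quantifiers distribute over Modus Ponens. If `x` is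
not free in the minor premise, that premise cannot be quantified and is used as it stands, by
`Ax.all_imp_const`. -/
theorem gen {x : ℕ} (hx : ∀ ψ ∈ Φ, x ∉ ψ.fvP) {φ : Fm C D} (h : Derivable T Φ φ)
    (hφ : x ∈ φ.fvP) : Derivable T Φ (.all x φ hφ) := by
  revert hφ
  refine induct (p := fun φ => ∀ hφ, Derivable T Φ (.all x φ hφ)) ?_ ?_ ?_ h
  · exact fun φ hφ hm => absurd hm (hx φ hφ)
  · exact fun φ hφ hm => ax (.gen x hm hφ)
  · intro φ ψ _ h2 h3 h4 hm
    by_cases hc : x ∈ φ.fvP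
    · exact ((ax (.all_imp ψ φ x hc hm)).mp (h3 _)).mp (h4 hc)
    · exact ((ax (.all_imp_const ψ φ x hc hm)).mp (h3 _)).mp h2

theorem genJ {u : ℕ} (hu : ∀ ψ ∈ Φ, u ∉ ψ.fvJ) {φ : Fm C D} (h : Derivable T Φ φ)
    (hφ : u ∈ φ.fvJ) : Derivable T Φ (.allJ u φ hφ) := by
  revert hφ
  refine induct (p := fun φ => ∀ hφ, Derivable T Φ (.allJ u φ hφ)) ?_ ?_ ?_ h
  · exact fun φ hφ hm => absurd hm (hu φ hφ)
  · exact fun φ hφ hm => ax (.genJ u hm hφ)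
  · intro φ ψ _ h2 h3 h4 hm
    by_cases hc : u ∈ φ.fvJ
    · exact ((ax (.allJ_imp ψ φ u hc hm)).mp (h3 _)).mp (h4 hc)
    · exact ((ax (.allJ_imp_const ψ φ u hc hm)).mp (h3 _)).mp h2

theorem alpha {φ ψ : Fm C D} (hα : AlphaEq φ ψ) (h : Derivable T Φ φ) : Derivable T Φ ψ :=
  ((ax (.eqv_imp φ ψ)).mp (ax (.eqv_of_alphaEq hα))).mp h

theorem eqv_refl (φ : Fm C D) : Derivable T Φ (φ.eqv φ) := ax (.eqv_of_alphaEq (.refl φ))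

theorem leJ_refl (hT : IsSufficient T) (t : Tm C) : Derivable T Φ (.leJ t t) := by
  -- The tautology is generalized without premises, since variable `0` may be free in `Φ`.
  refine taut₂ hT (ax (.le_iff t t 0)) (of_empty (gen (x := 0) (by simp)
    (φ := ((Fm.var 0).just t).imp ((Fm.var 0).just t)) ?_ ?_)) fun V hV h1 h2 => ?_
  · exact taut hT fun V hV => by simp [hV.imp]
  · simp [Fm.fvP, Fm.imp, Fm.just, Fm.var, RawFm.fvP]
  · exact ((hV.iff _ _).1 h1).2 h2

theorem eqJ_refl (hT : IsSufficient T) (t : Tm C) : Derivable T Φ (.eqJ t t) :=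
  taut₂ hT (ax (.eqJ_iff t t)) (leJ_refl hT t) fun V hV h1 h2 => by
    simp only [hV.iff, hV.and] at h1
    exact h1.2 ⟨h2, h2⟩

theorem eqv_subst (hT : IsSufficient T) (φ : Fm C D) {σ τ : Subst C D} (hσ : σ.OnVars)
    (hτ : τ.OnVars) (hP : ∀ x ∈ φ.fvP, Derivable T Φ ((σ.varP x).eqv (τ.varP x)))
    (hJ : ∀ u ∈ φ.fvJ, Derivable T Φ (.eqJ (σ.varJ u) (τ.varJ u))) :
    Derivable T Φ ((φ.subst σ).eqv (φ.subst τ)) := by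
  refine impConj_elim hT _ (ax (.subst_fm φ σ τ hσ hτ)) fun a ha => ?_
  simp only [substEqs, List.mem_append, List.mem_map, Finset.mem_sort] at ha
  rcases ha with ⟨x, hx, rfl⟩ | ⟨u, hu, rfl⟩
  · exact hP x hx
  · exact hJ u hu

theorem eqJ_subst (hT : IsSufficient T) (t : Tm C) {σ τ : Subst C D} (hσ : σ.OnVars)
    (hτ : τ.OnVars) (hJ : ∀ u ∈ t.fvJ, Derivable T Φ (.eqJ (σ.varJ u) (τ.varJ u))) :
    Derivable T Φ (.eqJ (t.subst σ) (t.subst τ)) := by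
  refine impConj_elim hT _ (ax (.subst_tm t σ τ hσ hτ)) fun a ha => ?_
  simp only [substEqs, List.mem_append, List.mem_map, Finset.mem_sort] at ha
  rcases ha with ⟨x, hx, rfl⟩ | ⟨u, hu, rfl⟩
  · simp at hx
  · exact hJ u hu

end Derivable

/-- The substitution of two formulas and two terms. -/
def Subst.pair (a b : Fm C D) (s t : Tm C) : Subst C D where
  varP n := if n = 0 then a else b
  constP := Fm.const
  varJ n := if n = 0 then s else t
  constJ := Tm.const

theorem Subst.onVars_pair (a b : Fm C D) (s t : Tm C) : (Subst.pair a b s t).OnVars :=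
  ⟨fun _ => rfl, fun _ => rfl⟩

namespace Derivable

/-- Replacement of equals by equals. -/
theorem replace (hT : IsSufficient T) (χ : Fm C D) {a a' b b' : Fm C D} {s s' t t' : Tm C}
    (ha : Derivable T Φ (a.eqv a')) (hb : Derivable T Φ (b.eqv b'))
    (hs : Derivable T Φ (.eqJ s s')) (ht : Derivable T Φ (.eqJ t t'))
    (h : Derivable T Φ (χ.subst (Subst.pair a b s t))) :
    Derivable T Φ (χ.subst (Subst.pair a' b' s' t')) := by
  refine ((ax (.eqv_imp _ _)).mp (eqv_subst hT χ (Subst.onVars_pair ..) (Subst.onVars_pair ..)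
    (fun x _ => ?_) fun u _ => ?_)).mp h
  · by_cases h : x = 0 <;> simp [Subst.pair, h, ha, hb]
  · by_cases h : u = 0 <;> simp [Subst.pair, h, hs, ht]

/-- Leibniz's argument: in `φ ≡ φ`, read as an instance of `x₀ ≡ x₁`, only the left side is
replaced. -/
theorem eqv_symm (hT : IsSufficient T) {φ ψ : Fm C D} (h : Derivable T Φ (φ.eqv ψ)) :
    Derivable T Φ (ψ.eqv φ) :=
  replace hT ((Fm.var 0).eqv (.var 1)) h (eqv_refl φ) (eqJ_refl hT (.var 0))
    (eqJ_refl hT (.var 0)) (eqv_refl φ)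

theorem eqv_trans (hT : IsSufficient T) {φ ψ χ : Fm C D} (h : Derivable T Φ (φ.eqv ψ))
    (h' : Derivable T Φ (ψ.eqv χ)) : Derivable T Φ (φ.eqv χ) :=
  replace hT ((Fm.var 0).eqv (.var 1)) (eqv_refl φ) h' (eqJ_refl hT (.var 0))
    (eqJ_refl hT (.var 0)) h

theorem eqJ_symm (hT : IsSufficient T) {s t : Tm C} (h : Derivable T Φ (.eqJ s t)) :
    Derivable T Φ (.eqJ t s) :=
  replace hT (.eqJ (.var 0) (.var 1)) (eqv_refl (.var 0)) (eqv_refl (.var 0)) h (eqJ_refl hT s)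
    (eqJ_refl hT s)

theorem eqJ_trans (hT : IsSufficient T) {r s t : Tm C} (h : Derivable T Φ (.eqJ r s))
    (h' : Derivable T Φ (.eqJ s t)) : Derivable T Φ (.eqJ r t) :=
  replace hT (.eqJ (.var 0) (.var 1)) (eqv_refl (.var 0)) (eqv_refl (.var 0)) (eqJ_refl hT r) h' h

end Derivable

/-- Provable equality of entries. -/
def EntryEq (T Φ : Set (Fm C D)) : Entry C D → Entry C D → Prop
  | .fm φ, .fm ψ => Derivable T Φ (φ.eqv ψ)
  | .tm s, .tm t => Derivable T Φ (.eqJ s t)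
  | _, _ => False

theorem EntryEq.refl (hT : IsSufficient T) (e : Entry C D) : EntryEq T Φ e e := by
  cases e with
  | fm φ => exact Derivable.eqv_refl φ
  | tm t => exact Derivable.eqJ_refl hT t

end

/-! ### Congruence for translations between languages -/

section

variable {C D C' D' : Type*}

/-- The formula in an entry, with a default value. -/
def Entry.fmD (ψ : Fm C D) : Entry C D → Fm C D
  | .fm φ => φ
  | .tm _ => ψ

/-- The term in an entry, with a default value. -/
def Entry.tmD (s : Tm C) : Entry C D → Tm C
  | .fm _ => s
  | .tm t => t

/-- Every translation factors on a finite set of atoms through one that replaces the atoms by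
distinct variables. -/
theorem Translation.exists_factor {S : Set (Atom C D)} (hS : S.Finite) :
    ∃ (ρ : Translation C D C' D') (F : Translation C D C' D' → Subst C' D'),
      (∀ τ, (F τ).OnVars) ∧ (∀ τ, ∀ a ∈ S, (ρ.comp (F τ).toTr).val a = τ.val a) ∧
      (∀ x, Atom.varP x ∈ ρ.image S → ∃ a ∈ S,
        ∀ τ : Translation C D C' D', τ.val a = .fm ((F τ).varP x)) ∧
      (∀ u, Atom.varJ u ∈ ρ.image S → ∃ a ∈ S,
        ∀ τ : Translation C D C' D', τ.val a = .tm ((F τ).varJ u)) := by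
  obtain ⟨f, hf⟩ := Set.countable_iff_exists_injOn.1 hS.countable
  have : Nonempty (Atom C D) := ⟨.varP 0⟩
  have hg := hf.leftInvOn_invFunOn
  generalize Function.invFunOn f S = g at hg
  -- Each atom of `S` becomes the variable of its own sort that carries its number, and `F τ` puts
  -- back the value under `τ` of the atom with that number. The default values only matter for
  -- variables that no atom of `S` uses.
  refine ⟨⟨fun x => .var (f (.varP x)), fun d => .var (f (.constP d)),
    fun u => .var (f (.varJ u)), fun c => .var (f (.constJ c))⟩,
    fun τ => ⟨fun n => (τ.val (g n)).fmD (.var n), .const,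
      fun n => (τ.val (g n)).tmD (.var n), .const⟩,
    fun τ => ⟨fun _ => rfl, fun _ => rfl⟩, ?_, ?_, ?_⟩
  · intro τ a ha
    cases a <;>
    simp [comp, val, Fm.tr, Fm.var, RawFm.tr, Tm.tr, Subst.toTr, Entry.fmD, Entry.tmD, hg ha]
  · rintro x ⟨a, ha, hx⟩
    refine ⟨a, ha, fun τ => ?_⟩
    cases a with
    | varP | constP =>
      simp only [val, Entry.atoms, Fm.atoms, Fm.var, RawFm.atoms, Set.mem_singleton_iff,
        Atom.varP.injEq] at hx
      subst hx
      simp [val, Entry.fmD, hg ha]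
    | varJ | constJ => simp [val, Entry.atoms, Tm.atoms] at hx
  · rintro x ⟨a, ha, hx⟩
    refine ⟨a, ha, fun τ => ?_⟩
    cases a with
    | varJ | constJ =>
      simp only [val, Entry.atoms, Tm.atoms, Set.mem_singleton_iff, Atom.varJ.injEq] at hx
      subst hx
      simp [val, Entry.tmD, hg ha]
    | varP | constP => simp [val, Entry.atoms, Fm.atoms, Fm.var, RawFm.atoms] at hx

end

section

variable {C D : Type*} {C' : Type u} {D' : Type v} {T Φ : Set (Fm C' D')}

namespace Derivable

/-- The substitution axiom concerns substitutions within one language that fix the constants.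
Factoring through distinct variables turns arbitrary translations into such substitutions. -/
theorem eqv_tr (hT : IsSufficient T) (φ : Fm C D) {σ τ : Translation C D C' D'}
    (h : ∀ a ∈ φ.atoms, EntryEq T Φ (σ.val a) (τ.val a)) :
    Derivable T Φ ((φ.tr σ).eqv (φ.tr τ)) := by
  obtain ⟨ρ, F, hF, hval, hP, hJ⟩ := Translation.exists_factor (C' := C') (D' := D')
    φ.finite_atoms
  rw [← φ.tr_congr (hval σ), ← φ.tr_congr (hval τ), ← Fm.tr_tr, ← Fm.tr_tr, ← Fm.subst_eq_tr,
    ← Fm.subst_eq_tr]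
  refine eqv_subst hT _ (hF σ) (hF τ) (fun x hx => ?_) fun u hu => ?_
  · obtain ⟨a, ha, e⟩ := hP x (Fm.mem_fvP_tr.1 hx)
    have := h a ha
    rwa [e σ, e τ] at this
  · obtain ⟨a, ha, e⟩ := hJ u (Fm.mem_fvJ_tr.1 hu)
    have := h a ha
    rwa [e σ, e τ] at this

theorem eqJ_tr (hT : IsSufficient T) (t : Tm C) {σ τ : Translation C D C' D'}
    (h : ∀ a ∈ t.atoms D, EntryEq T Φ (σ.val a) (τ.val a)) :
    Derivable T Φ (.eqJ (t.tr σ) (t.tr τ)) := by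
  obtain ⟨ρ, F, hF, hval, hP, hJ⟩ := Translation.exists_factor (C' := C') (D' := D')
    (t.finite_atoms (D := D))
  rw [← t.tr_congr (hval σ), ← t.tr_congr (hval τ), ← Tm.tr_tr, ← Tm.tr_tr, ← Tm.subst_eq_tr,
    ← Tm.subst_eq_tr]
  refine eqJ_subst hT _ (hF σ) (hF τ) fun u hu => ?_
  obtain ⟨a, ha, e⟩ := hJ u (by rwa [← Tm.atoms_tr, Tm.varJ_mem_atoms])
  have := h a ha
  rwa [e σ, e τ] at this

end Derivable

end

/-! ### Derivations are preserved by translations -/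

/-- Allows rewriting the body although the quantified formula carries a proof about it. -/
theorem Fm.all_congr {C : Type u} {D : Type v} {x : ℕ} {φ ψ : Fm C D} (e : φ = ψ)
    (h : x ∈ φ.fvP) : Fm.all x φ h = Fm.all x ψ (e ▸ h) := by
  subst e; rfl

theorem Fm.allJ_congr {C : Type u} {D : Type v} {u : ℕ} {φ ψ : Fm C D} (e : φ = ψ)
    (h : u ∈ φ.fvJ) : Fm.allJ u φ h = Fm.allJ u ψ (e ▸ h) := by
  subst e; rfl

section

variable {C D C' D' : Type*}

theorem Translation.image_mono (σ : Translation C D C' D') {S S' : Set (Atom C D)} (h : S ⊆ S') :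
    σ.image S ⊆ σ.image S' := fun _ ⟨a, ha, hb⟩ => ⟨a, h ha, hb⟩

theorem Fm.notMem_fvP_tr {φ : Fm C D} {σ : Translation C D C' D'} {S : Set (Atom C D)} {x y : ℕ}
    (hy : Atom.varP y ∉ σ.image (S \ {.varP x})) (hS : φ.atoms ⊆ S) (hx : x ∉ φ.fvP) :
    y ∉ (φ.tr σ).fvP := fun hm =>
  hy (σ.image_mono (Set.subset_sdiff_singleton hS (mt Fm.varP_mem_atoms.1 hx))
    (Fm.mem_fvP_tr.1 hm))

theorem Fm.notMem_fvJ_tr {φ : Fm C D} {σ : Translation C D C' D'} {S : Set (Atom C D)} {u v : ℕ}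
    (hv : Atom.varJ v ∉ σ.image (S \ {.varJ u})) (hS : φ.atoms ⊆ S) (hu : u ∉ φ.fvJ) :
    v ∉ (φ.tr σ).fvJ := fun hm =>
  hv (σ.image_mono (Set.subset_sdiff_singleton hS (mt Fm.varJ_mem_atoms.1 hu))
    (Fm.mem_fvJ_tr.1 hm))

theorem Tm.tr_updP (t : Tm C) (σ : Translation C D C' D') (x : ℕ) (ψ : Fm C' D') :
    t.tr (σ.updP x ψ) = t.tr σ :=
  t.tr_congr fun _ ha => σ.val_updP_of_ne ψ fun e => Tm.varP_notMem_atoms (e ▸ ha)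

theorem Fm.tr_impConj (l : List (Fm C D)) (χ : Fm C D) (σ : Translation C D C' D') :
    (Fm.impConj l χ).tr σ = Fm.impConj (l.map (·.tr σ)) (χ.tr σ) := by
  have key : ∀ (l : List (Fm C D)) (a : Fm C D),
      (l.foldl Fm.and a).tr σ = (l.map (·.tr σ)).foldl Fm.and (a.tr σ) := by
    intro l
    induction l with
    | nil => exact fun _ => rfl
    | cons b l ih => exact fun a => ih _
  cases l with
  | nil => rfl
  | cons a l => exact congrArg (Fm.imp · (χ.tr σ)) (key l a)

end

section

variable {C : Type*} {D : Type*} {C' : Type u} {D' : Type v} {T : Set (Fm C D)}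
  {T' : Set (Fm C' D')}

/-- Substitution instances of equations between substitutions. -/
theorem entryEq_of_substEqs (hT' : IsSufficient T') {σ τ : Subst C D} (hσ : σ.OnVars)
    (hτ : τ.OnVars) {P J : Finset ℕ} (ρ : Translation C D C' D') {a : Atom C D}
    (hP : ∀ x, a = .varP x → x ∈ P) (hJ : ∀ u, a = .varJ u → u ∈ J) :
    EntryEq T' (∅ ∪ {χ | χ ∈ (substEqs P J σ τ).map (·.tr ρ)})
      ((σ.toTr.comp ρ).val a) ((τ.toTr.comp ρ).val a) := by
  cases a with
  | varP x =>
    refine Derivable.hyp (.inr ?_)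
    refine List.mem_map.2 ⟨(σ.varP x).eqv (τ.varP x), ?_, rfl⟩
    simp only [substEqs, List.mem_append, List.mem_map, Finset.mem_sort]
    exact .inl ⟨x, hP x rfl, rfl⟩
  | varJ u =>
    refine Derivable.hyp (.inr ?_)
    refine List.mem_map.2 ⟨Fm.eqJ (σ.varJ u) (τ.varJ u), ?_, rfl⟩
    simp only [substEqs, List.mem_append, List.mem_map, Finset.mem_sort]
    exact .inr ⟨u, hJ u rfl, rfl⟩
  | constP d =>
    have e : (σ.toTr.comp ρ).val (.constP d) = (τ.toTr.comp ρ).val (.constP d) := by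
      simp only [Translation.comp, Translation.val, Subst.toTr, hσ.1, hτ.1]
    rw [e]
    exact .refl hT' _
  | constJ c =>
    have e : (σ.toTr.comp ρ).val (.constJ c) = (τ.toTr.comp ρ).val (.constJ c) := by
      simp only [Translation.comp, Translation.val, Subst.toTr, hσ.2, hτ.2]
    rw [e]
    exact .refl hT' _

/-- Most schemas translate to instances of themselves, possibly with other bound variables, which
alpha-congruence absorbs. The two sets of tautologies need not correspond: sufficiency of `T'`
rederives whatever is required. -/
theorem Ax.tr (hT : IsSufficient T) (hT' : IsSufficient T') {φ : Fm C D} (h : Ax T φ)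
    (σ : Translation C D C' D') : Derivable T' ∅ (φ.tr σ) := by
  induction h generalizing σ with
  | taut h =>
    -- A valuation pulled back along a translation is again a valuation.
    exact Derivable.taut hT' fun V hV => hT.1 _ h (fun α => V (α.tr σ))
      (fun α β => hV.imp (α.tr σ) (β.tr σ)) fun α => hV.neg (α.tr σ)
  | genJ u h _ ih =>
    obtain ⟨v, _, e⟩ := Fm.exists_tr_allJ _ u h σ
    rw [e]
    exact Derivable.genJ (by simp) (ih _) _
  | gen x h _ ih =>
    obtain ⟨v, _, e⟩ := Fm.exists_tr_all _ x h σ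
    rw [e]
    exact Derivable.gen (by simp) (ih _) _
  | true_iff φ => exact .ax (.true_iff (φ.tr σ))
  | false_iff φ => exact .ax (.false_iff (φ.tr σ))
  | application φ ψ s t => exact .ax (.application (φ.tr σ) (ψ.tr σ) (s.tr σ) (t.tr σ))
  | weaken_left φ s t => exact .ax (.weaken_left (φ.tr σ) (s.tr σ) (t.tr σ))
  | weaken_right φ s t => exact .ax (.weaken_right (φ.tr σ) (s.tr σ) (t.tr σ))
  | box_iff φ u hu =>
    obtain ⟨v, hv, e⟩ := Fm.exists_tr_allJ (φ.just (.var u)).neg u (φ.mem_fvJ_just_var u) σ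
    have e' : ((φ.just (.var u)).neg).tr (σ.updJ u (.var v)) =
        ((φ.tr σ).just (.var v)).neg := by
      rw [← Fm.tr_updJ_of_notMem hu σ (.var v)]
      simp [Fm.tr, Fm.neg, Fm.just, RawFm.tr, Tm.tr, Translation.updJ]
    have hv' : v ∉ (φ.tr σ).fvJ :=
      Fm.notMem_fvJ_tr hv Set.subset_union_left hu
    rw [Fm.tr_iff, Fm.exJ, Fm.tr_neg, e, Fm.allJ_congr e']
    exact .ax (.box_iff _ v hv')
  | box_imp φ => exact .ax (.box_imp (φ.tr σ))
  | ref_of_synRef h => exact .ax (.ref_of_synRef (h.tr σ))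
  | ref_trans φ ψ χ => exact .ax (.ref_trans (φ.tr σ) (ψ.tr σ) (χ.tr σ))
  | @eqv_of_alphaEq φ ψ h =>
    have e : (φ.eqv ψ).tr σ = (φ.tr σ).eqv (φ.tr σ) :=
      congrArg (Fm.eqv (φ.tr σ)) (h.tr_eq σ).symm
    rw [e]
    exact .eqv_refl _
  | eqv_imp φ ψ => exact .ax (.eqv_imp (φ.tr σ) (ψ.tr σ))
  | subst_fm φ τ τ' hτ hτ' =>
    rw [Fm.tr_impConj]
    refine Derivable.impConj_intro hT' _ ?_
    have e : ((φ.subst τ).eqv (φ.subst τ')).tr σ =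
        (φ.tr (τ.toTr.comp σ)).eqv (φ.tr (τ'.toTr.comp σ)) := by
      rw [← Fm.tr_tr, ← Fm.tr_tr, ← Fm.subst_eq_tr, ← Fm.subst_eq_tr]
      rfl
    rw [e]
    -- After composition with `σ` constants may move, so the axiom itself no longer applies. As `τ`
    -- and `τ'` fix the constants, both composites still agree on them.
    refine Derivable.eqv_tr hT' φ fun a ha => entryEq_of_substEqs hT' hτ hτ' σ ?_ ?_
    · rintro x rfl
      exact Fm.varP_mem_atoms.1 ha
    · rintro x rfl
      exact Fm.varJ_mem_atoms.1 ha
  | subst_tm t τ τ' hτ hτ' =>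
    rw [Fm.tr_impConj]
    refine Derivable.impConj_intro hT' _ ?_
    have e : (Fm.eqJ (t.subst τ) (t.subst τ')).tr σ =
        .eqJ (t.tr (τ.toTr.comp σ)) (t.tr (τ'.toTr.comp σ)) := by
      rw [← Tm.tr_tr, ← Tm.tr_tr, ← Tm.subst_eq_tr, ← Tm.subst_eq_tr]
      rfl
    rw [e]
    refine Derivable.eqJ_tr hT' t fun a ha => entryEq_of_substEqs hT' hτ hτ' σ ?_ ?_
    · rintro x rfl
      exact absurd ha Tm.varP_notMem_atoms
    · rintro x rfl
      exact Tm.varJ_mem_atoms.1 ha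
  | exJ_intro φ u t h =>
    obtain ⟨v, hv, e⟩ := Fm.exists_tr_allJ φ.neg u h σ
    rw [Fm.tr_imp, Fm.exJ, Fm.tr_neg, e, Fm.tr_substJ]
    exact (Derivable.ax (.exJ_intro _ v (t.tr σ) (Fm.mem_fvJ_tr_updJ σ h v))).alpha
      (.imp (alphaEq_substJ_tr φ σ _ hv) (.refl _))
  | allJ_elim φ u t h =>
    obtain ⟨v, hv, e⟩ := Fm.exists_tr_allJ φ u h σ
    rw [Fm.tr_imp, e, Fm.tr_substJ]
    exact (Derivable.ax (.allJ_elim _ v (t.tr σ) _)).alpha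
      (.imp (.refl _) (alphaEq_substJ_tr φ σ _ hv))
  | allJ_imp φ ψ u hψ hφ =>
    obtain ⟨v, hv, e⟩ := Fm.exists_tr_allJ (ψ.imp φ) u (Fm.mem_fvJ_imp_right ψ hφ) σ
    rw [Fm.tr_imp, Fm.tr_imp, e]
    -- The variable chosen for the implication is fresh for both sides, though each side alone may
    -- be given another one.
    refine (Derivable.ax (.allJ_imp _ _ v (Fm.mem_fvJ_tr_updJ σ hψ v)
      (Fm.mem_fvJ_tr_updJ σ hφ v))).alpha (.imp (.refl _) (.imp ?_ ?_))
    · exact (alphaEq_tr_allJ ψ hψ σ fun h =>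
        hv (σ.image_mono (Set.sdiff_subset_sdiff_left Set.subset_union_left) h)).symm
    · exact (alphaEq_tr_allJ φ hφ σ fun h =>
        hv (σ.image_mono (Set.sdiff_subset_sdiff_left Set.subset_union_right) h)).symm
  | allJ_imp_const φ ψ u hψ hφ =>
    obtain ⟨v, hv, e⟩ := Fm.exists_tr_allJ (ψ.imp φ) u (Fm.mem_fvJ_imp_right ψ hφ) σ
    have e' := congrArg (Fm.imp · (φ.tr (σ.updJ u (.var v))))
      (Fm.tr_updJ_of_notMem hψ σ (.var v))
    rw [Fm.tr_imp, Fm.tr_imp, e, Fm.allJ_congr (Fm.tr_imp ..), Fm.allJ_congr e']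
    have hv' : v ∉ (ψ.tr σ).fvJ := Fm.notMem_fvJ_tr hv Set.subset_union_left hψ
    refine (Derivable.ax (.allJ_imp_const _ _ v hv'
      (Fm.mem_fvJ_tr_updJ σ hφ v))).alpha (.imp (.refl _) (.imp (.refl _) ?_))
    exact (alphaEq_tr_allJ φ hφ σ fun h =>
      hv (σ.image_mono (Set.sdiff_subset_sdiff_left Set.subset_union_right) h)).symm
  | ex_intro φ x ψ h =>
    obtain ⟨y, hy, e⟩ := Fm.exists_tr_all φ.neg x h σ
    rw [Fm.tr_imp, Fm.ex, Fm.tr_neg, e, Fm.tr_substP]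
    exact (Derivable.ax (.ex_intro _ y (ψ.tr σ) (Fm.mem_fvP_tr_updP σ h y))).alpha
      (.imp (alphaEq_substP_tr φ σ _ hy) (.refl _))
  | all_elim φ x ψ h =>
    obtain ⟨y, hy, e⟩ := Fm.exists_tr_all φ x h σ
    rw [Fm.tr_imp, e, Fm.tr_substP]
    exact (Derivable.ax (.all_elim _ y (ψ.tr σ) _)).alpha
      (.imp (.refl _) (alphaEq_substP_tr φ σ _ hy))
  | all_imp φ ψ x hψ hφ =>
    obtain ⟨y, hy, e⟩ := Fm.exists_tr_all (ψ.imp φ) x (Fm.mem_fvP_imp_right ψ hφ) σ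
    rw [Fm.tr_imp, Fm.tr_imp, e]
    refine (Derivable.ax (.all_imp _ _ y (Fm.mem_fvP_tr_updP σ hψ y)
      (Fm.mem_fvP_tr_updP σ hφ y))).alpha (.imp (.refl _) (.imp ?_ ?_))
    · exact (alphaEq_tr_all ψ hψ σ fun h =>
        hy (σ.image_mono (Set.sdiff_subset_sdiff_left Set.subset_union_left) h)).symm
    · exact (alphaEq_tr_all φ hφ σ fun h =>
        hy (σ.image_mono (Set.sdiff_subset_sdiff_left Set.subset_union_right) h)).symm
  | all_imp_const φ ψ x hψ hφ =>
    obtain ⟨y, hy, e⟩ := Fm.exists_tr_all (ψ.imp φ) x (Fm.mem_fvP_imp_right ψ hφ) σ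
    have e' := congrArg (Fm.imp · (φ.tr (σ.updP x (.var y))))
      (Fm.tr_updP_of_notMem hψ σ (.var y))
    rw [Fm.tr_imp, Fm.tr_imp, e, Fm.all_congr (Fm.tr_imp ..), Fm.all_congr e']
    have hy' : y ∉ (ψ.tr σ).fvP := Fm.notMem_fvP_tr hy Set.subset_union_left hψ
    refine (Derivable.ax (.all_imp_const _ _ y hy'
      (Fm.mem_fvP_tr_updP σ hφ y))).alpha (.imp (.refl _) (.imp (.refl _) ?_))
    exact (alphaEq_tr_all φ hφ σ fun h =>
      hy (σ.image_mono (Set.sdiff_subset_sdiff_left Set.subset_union_right) h)).symm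
  | le_iff s t x =>
    obtain ⟨y, hy, e⟩ := Fm.exists_tr_all (((Fm.var x).just s).imp ((Fm.var x).just t)) x
      (Fm.mem_fvP_imp_right _ (Fm.mem_fvP_just t (Fm.mem_fvP_var x))) σ
    have e' : (((Fm.var x).just s).imp ((Fm.var x).just t)).tr (σ.updP x (.var y)) =
        ((Fm.var y).just (s.tr σ)).imp ((Fm.var y).just (t.tr σ)) := by
      rw [← s.tr_updP σ x (.var y), ← t.tr_updP σ x (.var y)]
      simp [Fm.tr, Fm.imp, Fm.var, Fm.just, RawFm.tr, Translation.updP]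
    rw [Fm.tr_iff, e, Fm.all_congr e']
    exact .ax (.le_iff (s.tr σ) (t.tr σ) y)
  | eqJ_iff s t => exact .ax (.eqJ_iff (s.tr σ) (t.tr σ))

theorem Derivable.tr (hT : IsSufficient T) (hT' : IsSufficient T') {Φ : Set (Fm C D)}
    {φ : Fm C D} (h : Derivable T Φ φ) (σ : Translation C D C' D') :
    Derivable T' ((·.tr σ) '' Φ) (φ.tr σ) := by
  refine Derivable.induct (p := fun φ => Derivable T' ((·.tr σ) '' Φ) (φ.tr σ)) ?_ ?_ ?_ h
  · exact fun φ hφ => .hyp ⟨φ, hφ, rfl⟩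
  · exact fun φ hφ => .of_empty (hφ.tr hT hT' σ)
  · exact fun φ ψ _ _ h1 h2 => h1.mp h2

end

/-! ### Soundness -/

section

variable {C : Type u} {D : Type v}

theorem Subst.onVars_id : (Subst.id : Subst C D).OnVars := ⟨fun _ => rfl, fun _ => rfl⟩

theorem Subst.OnVars.updP {σ : Subst C D} (h : σ.OnVars) (x : ℕ) (ψ : Fm C D) :
    (σ.updP x ψ).OnVars := h

theorem Subst.OnVars.updJ {σ : Subst C D} (h : σ.OnVars) (u : ℕ) (t : Tm C) :
    (σ.updJ u t).OnVars := h

namespace Model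

variable (𝓜 : Model.{u, v, w} C D)

theorem mem_FALSE {m : 𝓜.M} : m ∈ 𝓜.FALSE ↔ m ∉ 𝓜.TRUE := by
  constructor
  · intro h h'
    have : m ∈ 𝓜.TRUE ∩ 𝓜.FALSE := ⟨h', h⟩
    rw [𝓜.true_inter_false] at this
    exact this
  · intro h
    have : m ∈ 𝓜.TRUE ∪ 𝓜.FALSE := 𝓜.true_union_false ▸ Set.mem_univ m
    exact this.resolve_left h

theorem isValuation (γ : Assignment 𝓜.M 𝓜.L) : IsValuation (𝓜.Sat γ) where
  imp α β := by
    simp only [Sat, 𝓜.imp_true, 𝓜.mem_FALSE]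
    tauto
  neg α := 𝓜.neg_true α γ

theorem Γ_subst_id (φ : Fm C D) (γ : Assignment 𝓜.M 𝓜.L) :
    𝓜.Γ (φ.subst Subst.id) γ = 𝓜.Γ φ γ := by
  rw [𝓜.sp φ _ γ Subst.onVars_id]
  exact 𝓜.cp _ _ _ (fun x _ => 𝓜.ep x γ) fun u _ => 𝓜.epJ u γ

/-- Alpha-congruent formulas have literally the same instance under the identity substitution, and
the substitution property says that this instance has the original value. -/
theorem Γ_alphaEq {φ ψ : Fm C D} (h : AlphaEq φ ψ) (γ : Assignment 𝓜.M 𝓜.L) :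
    𝓜.Γ φ γ = 𝓜.Γ ψ γ := by
  have e : φ.subst Subst.id = ψ.subst Subst.id := by
    rw [Fm.subst_eq_tr, Fm.subst_eq_tr]
    exact h.tr_eq _
  rw [← Γ_subst_id, e, Γ_subst_id]

theorem Γ_substP (φ : Fm C D) (x : ℕ) (ψ : Fm C D) (γ : Assignment 𝓜.M 𝓜.L) :
    𝓜.Γ (φ.substP x ψ) γ = 𝓜.Γ φ (γ.updP x (𝓜.Γ ψ γ)) := by
  rw [Fm.substP, 𝓜.sp φ _ γ (Subst.onVars_id.updP x ψ)]
  refine 𝓜.cp _ _ _ (fun y _ => ?_) fun u _ => 𝓜.epJ u γ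
  by_cases h : y = x
  · subst h
    simp [Subst.updP, Assignment.updP]
  · simp [Subst.updP, Assignment.updP, h, Subst.id, 𝓜.ep]

theorem Γ_substJ (φ : Fm C D) (u : ℕ) (t : Tm C) (γ : Assignment 𝓜.M 𝓜.L) :
    𝓜.Γ (φ.substJ u t) γ = 𝓜.Γ φ (γ.updJ u (𝓜.ΓJ t γ)) := by
  rw [Fm.substJ, 𝓜.sp φ _ γ (Subst.onVars_id.updJ u t)]
  refine 𝓜.cp _ _ _ (fun y _ => 𝓜.ep y γ) fun y _ => ?_
  by_cases h : y = u
  · subst h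
    simp [Subst.updJ, Assignment.updJ]
  · simp [Subst.updJ, Assignment.updJ, h, Subst.id, 𝓜.epJ]

theorem Γ_updP_of_notMem {φ : Fm C D} {x : ℕ} (h : x ∉ φ.fvP) (γ : Assignment 𝓜.M 𝓜.L)
    (m : 𝓜.M) : 𝓜.Γ φ (γ.updP x m) = 𝓜.Γ φ γ :=
  𝓜.cp _ _ _ (fun y hy => by
    simp [Assignment.updP, Function.update_of_ne (fun e : y = x => h (e ▸ hy))]) fun _ _ => rfl

theorem Γ_updJ_of_notMem {φ : Fm C D} {u : ℕ} (h : u ∉ φ.fvJ) (γ : Assignment 𝓜.M 𝓜.L)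
    (l : 𝓜.L) : 𝓜.Γ φ (γ.updJ u l) = 𝓜.Γ φ γ :=
  𝓜.cp _ _ _ (fun _ _ => rfl) fun y hy => by
    simp [Assignment.updJ, Function.update_of_ne (fun e : y = u => h (e ▸ hy))]

theorem ΓJ_updP (t : Tm C) (x : ℕ) (γ : Assignment 𝓜.M 𝓜.L)
    (m : 𝓜.M) : 𝓜.ΓJ t (γ.updP x m) = 𝓜.ΓJ t γ :=
  𝓜.cpJ _ _ _ fun _ _ => rfl

theorem sat_exJ {u : ℕ} {φ : Fm C D} (h : u ∈ φ.fvJ) (γ : Assignment 𝓜.M 𝓜.L) :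
    𝓜.Sat γ (.exJ u φ h) ↔ ∃ l, 𝓜.Sat (γ.updJ u l) φ := by
  refine ((𝓜.neg_true _ γ).trans (not_congr (𝓜.allJ_true u φ.neg h γ))).trans ?_
  simp only [Sat, 𝓜.neg_true, not_forall, not_not]

theorem sat_ex {x : ℕ} {φ : Fm C D} (h : x ∈ φ.fvP) (γ : Assignment 𝓜.M 𝓜.L) :
    𝓜.Sat γ (.ex x φ h) ↔ ∃ m, 𝓜.Sat (γ.updP x m) φ := by
  refine ((𝓜.neg_true _ γ).trans (not_congr (𝓜.all_true x φ.neg h γ))).trans ?_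
  simp only [Sat, 𝓜.neg_true, not_forall, not_not]

theorem sat_of_ax {T : Set (Fm C D)} (hT : IsSufficient T) {φ : Fm C D} (h : Ax T φ)
    (γ : Assignment 𝓜.M 𝓜.L) : 𝓜.Sat γ φ := by
  induction h generalizing γ with
  | taut h => exact hT.1 _ h _ (𝓜.isValuation γ).imp (𝓜.isValuation γ).neg
  | genJ u h _ ih => exact (𝓜.allJ_true u _ h γ).2 fun l => ih _
  | gen x h _ ih => exact (𝓜.all_true x _ h γ).2 fun l => ih _
  | true_iff φ => exact ((𝓜.isValuation γ).iff _ _).2 (𝓜.isTrue_true φ γ)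
  | false_iff φ =>
    rw [(𝓜.isValuation γ).iff, (𝓜.isValuation γ).neg]
    exact (𝓜.isFalse_true φ γ).trans 𝓜.mem_FALSE
  | application φ ψ s t =>
    simp only [(𝓜.isValuation γ).imp]
    simp only [Sat, 𝓜.just_true]
    exact 𝓜.app_reason φ ψ s t γ
  | weaken_left φ s t =>
    simp only [(𝓜.isValuation γ).imp]
    simp only [Sat, 𝓜.just_true]
    exact fun h => 𝓜.sum_reason φ s t γ (.inl h)
  | weaken_right φ s t =>
    simp only [(𝓜.isValuation γ).imp]
    simp only [Sat, 𝓜.just_true]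
    exact fun h => 𝓜.sum_reason φ s t γ (.inr h)
  | box_iff φ u hu =>
    rw [(𝓜.isValuation γ).iff, sat_exJ]
    simp only [Sat, 𝓜.box_true, 𝓜.just_true, 𝓜.necessary_eq, Set.mem_iUnion,
      𝓜.Γ_updJ_of_notMem hu, 𝓜.epJ]
    simp [Assignment.updJ]
  | box_imp φ =>
    rw [(𝓜.isValuation γ).imp]
    exact fun h => 𝓜.necessary_subset ((𝓜.box_true φ γ).1 h)
  | ref_of_synRef h => exact (𝓜.ref_true _ _ γ).2 (𝓜.rp _ _ γ h)
  | ref_trans φ ψ χ =>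
    simp only [(𝓜.isValuation γ).imp]
    simp only [Sat, 𝓜.ref_true]
    exact 𝓜.ref_trans _ _ _
  | eqv_of_alphaEq h => exact (𝓜.eqv_true _ _ γ).2 (𝓜.Γ_alphaEq h γ)
  | eqv_imp φ ψ =>
    simp only [(𝓜.isValuation γ).imp]
    simp only [Sat, 𝓜.eqv_true]
    exact fun h h' => h ▸ h'
  | subst_fm φ σ τ hσ hτ =>
    rw [(𝓜.isValuation γ).impConj]
    intro h
    refine (𝓜.eqv_true _ _ γ).2 ?_
    rw [𝓜.sp φ σ γ hσ, 𝓜.sp φ τ γ hτ]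
    refine 𝓜.cp _ _ _ (fun x hx => ?_) fun u hu => ?_
    · refine (𝓜.eqv_true _ _ γ).1 (h _ ?_)
      simp only [substEqs, List.mem_append, List.mem_map, Finset.mem_sort]
      exact .inl ⟨x, hx, rfl⟩
    · refine (𝓜.eqJ_true _ _ γ).1 (h _ ?_)
      simp only [substEqs, List.mem_append, List.mem_map, Finset.mem_sort]
      exact .inr ⟨u, hu, rfl⟩
  | subst_tm t σ τ hσ hτ =>
    rw [(𝓜.isValuation γ).impConj]
    intro h
    refine (𝓜.eqJ_true _ _ γ).2 ?_
    rw [𝓜.spJ t σ γ hσ, 𝓜.spJ t τ γ hτ]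
    refine 𝓜.cpJ _ _ _ fun u hu => ?_
    refine (𝓜.eqJ_true _ _ γ).1 (h _ ?_)
    simp only [substEqs, List.mem_append, List.mem_map, Finset.mem_sort]
    exact .inr ⟨u, hu, rfl⟩
  | exJ_intro φ u t h =>
    rw [(𝓜.isValuation γ).imp, sat_exJ, Sat, 𝓜.Γ_substJ]
    exact fun h => ⟨_, h⟩
  | allJ_elim φ u t h =>
    rw [(𝓜.isValuation γ).imp]
    simp only [Sat, 𝓜.allJ_true, 𝓜.Γ_substJ]
    exact fun h => h _
  | allJ_imp φ ψ u hψ hφ =>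
    simp only [(𝓜.isValuation γ).imp]
    simp only [Sat, 𝓜.allJ_true]
    exact fun h h' l => ((𝓜.isValuation _).imp ψ φ).1 (h l) (h' l)
  | allJ_imp_const φ ψ u hψ hφ =>
    simp only [(𝓜.isValuation γ).imp]
    simp only [Sat, 𝓜.allJ_true]
    refine fun h h' l => ((𝓜.isValuation _).imp ψ φ).1 (h l) ?_
    rwa [Sat, 𝓜.Γ_updJ_of_notMem hψ]
  | ex_intro φ x ψ h =>
    rw [(𝓜.isValuation γ).imp, sat_ex, Sat, 𝓜.Γ_substP]
    exact fun h => ⟨_, h⟩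
  | all_elim φ x ψ h =>
    rw [(𝓜.isValuation γ).imp]
    simp only [Sat, 𝓜.all_true, 𝓜.Γ_substP]
    exact fun h => h _
  | all_imp φ ψ x hψ hφ =>
    simp only [(𝓜.isValuation γ).imp]
    simp only [Sat, 𝓜.all_true]
    exact fun h h' m => ((𝓜.isValuation _).imp ψ φ).1 (h m) (h' m)
  | all_imp_const φ ψ x hψ hφ =>
    simp only [(𝓜.isValuation γ).imp]
    simp only [Sat, 𝓜.all_true]
    refine fun h h' m => ((𝓜.isValuation _).imp ψ φ).1 (h m) ?_
    rwa [Sat, 𝓜.Γ_updP_of_notMem hψ]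
  | le_iff s t x =>
    rw [(𝓜.isValuation γ).iff]
    simp only [Sat, 𝓜.all_true, 𝓜.leJ_true, 𝓜.le_iff]
    refine forall_congr' fun m => ?_
    rw [← Sat, (𝓜.isValuation _).imp]
    simp only [Sat, 𝓜.just_true, 𝓜.ep, 𝓜.ΓJ_updP]
    simp [Assignment.updP]
  | eqJ_iff s t =>
    let := 𝓜.order
    rw [(𝓜.isValuation γ).iff, (𝓜.isValuation γ).and]
    simp only [Sat, 𝓜.eqJ_true, 𝓜.leJ_true]
    exact le_antisymm_iff

theorem sat_of_derivable {T : Set (Fm C D)} (hT : IsSufficient T) {Φ : Set (Fm C D)}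
    {φ : Fm C D} (h : Derivable T Φ φ) (γ : Assignment 𝓜.M 𝓜.L) (hΦ : ∀ ψ ∈ Φ, 𝓜.Sat γ ψ) :
    𝓜.Sat γ φ :=
  Derivable.induct (p := 𝓜.Sat γ) hΦ (fun _ hφ => 𝓜.sat_of_ax hT hφ γ)
    (fun _ _ _ _ h1 h2 => ((𝓜.isValuation γ).imp _ _).1 h1 h2) h

end Model

end

/-! ### The term model of a Henkin set -/

section

variable {C : Type u} {D : Type v} {T Φ : Set (Fm C D)}

theorem derivable_neg_of_not_consistent (hT : IsSufficient T) {α : Fm C D}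
    (h : ¬ Consistent T (insert α Φ)) : Derivable T Φ α.neg := by
  obtain ⟨φ, h1, h2⟩ := not_not.1 h
  exact Derivable.taut₂ hT (h1.deduction hT) (h2.deduction hT) fun V hV h1 h2 => by
    simp only [hV.imp, hV.neg] at *
    tauto

/-- A formula that cannot be derived cannot be added consistently, so its negation is derivable;
tautological reasoning does the rest. -/
theorem isValuation_of_maximal (hT : IsSufficient T) (h : Maximal (Consistent T) Φ) :
    IsValuation (Derivable T Φ) := by
  have hneg : ∀ α, Derivable T Φ α.neg ↔ ¬ Derivable T Φ α := by
    refine fun α => ⟨fun h1 h2 => h.1 ⟨α, h2, h1⟩, fun h1 => ?_⟩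
    by_contra h2
    have hc : Consistent T (insert α Φ) :=
      not_not.1 fun hc => h2 (derivable_neg_of_not_consistent hT hc)
    exact h1 (.hyp (h.2 hc (Set.subset_insert _ _) (.inl rfl)))
  refine ⟨fun α β => ⟨fun h1 h2 => h1.mp h2, fun h1 => ?_⟩, hneg⟩
  by_cases h2 : Derivable T Φ α
  · exact (h1 h2).taut₁ hT fun V hV h => by simp [hV.imp, h]
  · exact ((hneg α).2 h2).taut₁ hT fun V hV h => by
      rw [hV.neg] at h
      simp [hV.imp, h]

namespace IsHenkin

theorem isValuation (hT : IsSufficient T) (h : IsHenkin T Φ) : IsValuation (Derivable T Φ) :=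
  isValuation_of_maximal hT h.maximal

/-- The axiom for `≤` gives a universal formula: elimination yields every instance, and the Henkin
property needs only the instances by constants. This is why the order of the term model can be
inclusion of reasons. -/
theorem leJ_iff (hT : IsSufficient T) (h : IsHenkin T Φ) (s t : Tm C) :
    Derivable T Φ (.leJ s t) ↔
      ∀ φ : Fm C D, Derivable T Φ (φ.just s) → Derivable T Φ (φ.just t) := by
  have hV := h.isValuation hT
  have hm := Fm.mem_fvP_imp_right ((Fm.var 0).just s)
    (Fm.mem_fvP_just t (Fm.mem_fvP_var (C := C) (D := D) 0))
  have hs : ∀ ψ : Fm C D, (((Fm.var 0).just s).imp ((Fm.var 0).just t)).substP 0 ψ =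
      (ψ.just s).imp (ψ.just t) := by
    intro ψ
    rw [Fm.substP_eq_tr, Fm.tr_imp]
    have : ∀ r : Tm C, ((Fm.var 0 : Fm C D).just r).tr (Translation.id.updP 0 ψ) = ψ.just r := by
      intro r
      have e := r.tr_updP (Translation.id : Translation C D C D) 0 ψ
      rw [Tm.tr_id] at e
      simp only [Fm.tr, Fm.just, RawFm.tr, e, Fm.var]
      simp [Translation.updP]
    rw [this, this]
  rw [((hV.iff _ _).1 (.ax (.le_iff s t 0)))]
  constructor
  · intro h' φ
    have := (Derivable.ax (.all_elim _ 0 φ hm)).mp h'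
    rwa [hs, hV.imp] at this
  · intro h'
    rw [h.all_iff]
    intro d
    rw [hs, hV.imp]
    exact h' _

theorem box_iff (hT : IsSufficient T) (h : IsHenkin T Φ) (φ : Fm C D) :
    Derivable T Φ φ.box ↔ ∃ t, Derivable T Φ (φ.just t) := by
  have hV := h.isValuation hT
  obtain ⟨u, hu⟩ := Infinite.exists_notMem_finset φ.fvJ
  have hs : ∀ t, AlphaEq ((φ.just (.var u)).substJ u t) (φ.just t) := by
    intro t
    have e : (φ.just (.var u)).substJ u t = (φ.substJ u t).just t := by
      simp [Fm.substJ, Fm.subst, Fm.just, RawFm.subst, Tm.subst, Subst.updJ]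
    rw [e, Fm.substJ_eq_tr, Fm.tr_updJ_of_notMem hu]
    exact .just t (alphaEq_tr_id φ).symm
  rw [(hV.iff _ _).1 (.ax (.box_iff φ u hu))]
  constructor
  · intro h'
    -- The existential is a negated universal, so the Henkin property produces a constant at which
    -- the negated body is not derivable.
    rw [Fm.exJ, hV.neg, h.allJ_iff (φ.just (.var u)).neg u (φ.mem_fvJ_just_var u),
      not_forall] at h'
    obtain ⟨c, hc⟩ := h'
    refine ⟨.const c, .alpha (hs _) (not_not.1 fun hn => hc ?_)⟩
    exact (hV.neg _).2 hn
  · rintro ⟨t, ht⟩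
    exact (Derivable.ax (.exJ_intro _ u t (φ.mem_fvJ_just_var u))).mp (.alpha (hs t).symm ht)

/-- Elimination reaches all formulas `ψ`, while the converse uses only constants. Thus the
quantifier of the term model may range over all classes, even if some contain no constant. -/
theorem all_subst_iff (h : IsHenkin T Φ) {φ : Fm C D} {x : ℕ}
    (hx : x ∈ φ.fvP) {σ : Subst C D} :
    Derivable T Φ ((Fm.all x φ hx).subst σ) ↔ ∀ ψ, Derivable T Φ (φ.subst (σ.updP x ψ)) := by
  obtain ⟨y, hy, e⟩ := Fm.exists_tr_all φ x hx σ.toTr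
  rw [Fm.subst_eq_tr, e]
  constructor
  · intro h' ψ
    rw [Fm.subst_eq_tr]
    exact .alpha (alphaEq_substP_tr φ σ.toTr ψ hy) ((Derivable.ax (.all_elim _ y ψ _)).mp h')
  · intro h'
    rw [h.all_iff]
    intro d
    have := h' (.const d)
    rw [Fm.subst_eq_tr] at this
    exact .alpha (alphaEq_substP_tr φ σ.toTr _ hy).symm this

theorem allJ_subst_iff (h : IsHenkin T Φ) {φ : Fm C D} {u : ℕ}
    (hu : u ∈ φ.fvJ) {σ : Subst C D} :
    Derivable T Φ ((Fm.allJ u φ hu).subst σ) ↔ ∀ t, Derivable T Φ (φ.subst (σ.updJ u t)) := by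
  obtain ⟨v, hv, e⟩ := Fm.exists_tr_allJ φ u hu σ.toTr
  rw [Fm.subst_eq_tr, e]
  constructor
  · intro h' t
    rw [Fm.subst_eq_tr]
    exact .alpha (alphaEq_substJ_tr φ σ.toTr t hv) ((Derivable.ax (.allJ_elim _ v t _)).mp h')
  · intro h'
    rw [h.allJ_iff]
    intro c
    have := h' (.const c)
    rw [Fm.subst_eq_tr] at this
    exact .alpha (alphaEq_substJ_tr φ σ.toTr _ hv).symm this

end IsHenkin

end

/-! ### Representatives and the construction of the term model -/

section

variable {C : Type u} {D : Type v}

/-- The substitution that puts a representative for the value of each variable. -/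
noncomputable def Assignment.rep {M L : Type w} {p : Fm C D → M} {j : Tm C → L}
    (hp : Function.Surjective p) (hj : Function.Surjective j) (γ : Assignment M L) :
    Subst C D where
  varP x := Function.surjInv hp (γ.p x)
  constP := Fm.const
  varJ u := Function.surjInv hj (γ.j u)
  constJ := Tm.const

variable {T Φ : Set (Fm C D)} {M L : Type w} {p : Fm C D → M} {j : Tm C → L}

theorem Assignment.onVars_rep (hp : Function.Surjective p) (hj : Function.Surjective j)
    (γ : Assignment M L) : (γ.rep hp hj).OnVars := ⟨fun _ => rfl, fun _ => rfl⟩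

theorem Assignment.rep_updP (hp : Function.Surjective p) (hj : Function.Surjective j)
    (γ : Assignment M L) (x : ℕ) (m : M) :
    (γ.updP x m).rep hp hj = (γ.rep hp hj).updP x (Function.surjInv hp m) := by
  ext1 <;> try rfl
  funext y
  simp only [rep, updP, Subst.updP, Function.update_apply]
  split_ifs <;> rfl

theorem Assignment.rep_updJ (hp : Function.Surjective p) (hj : Function.Surjective j)
    (γ : Assignment M L) (u : ℕ) (l : L) :
    (γ.updJ u l).rep hp hj = (γ.rep hp hj).updJ u (Function.surjInv hj l) := by
  ext1 <;> try rfl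
  funext y
  simp only [rep, updJ, Subst.updJ, Function.update_apply]
  split_ifs <;> rfl

/-- Substitutions that agree on the free variables of a formula. -/
theorem Fm.subst_congr {σ τ : Subst C D} (hσ : σ.OnVars) (hτ : τ.OnVars) (φ : Fm C D)
    (hP : ∀ x ∈ φ.fvP, σ.varP x = τ.varP x) (hJ : ∀ u ∈ φ.fvJ, σ.varJ u = τ.varJ u) :
    φ.subst σ = φ.subst τ := by
  rw [Fm.subst_eq_tr, Fm.subst_eq_tr]
  refine φ.tr_congr fun a ha => ?_
  cases a with
  | varP x => exact congrArg Entry.fm (hP x (Fm.varP_mem_atoms.1 ha))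
  | varJ u => exact congrArg Entry.tm (hJ u (Fm.varJ_mem_atoms.1 ha))
  | constP d => exact congrArg Entry.fm ((hσ.1 d).trans (hτ.1 d).symm)
  | constJ c => exact congrArg Entry.tm ((hσ.2 c).trans (hτ.2 c).symm)

theorem Tm.subst_congr {σ τ : Subst C D} (hσ : σ.OnVars) (hτ : τ.OnVars) (t : Tm C)
    (hJ : ∀ u ∈ t.fvJ, σ.varJ u = τ.varJ u) : t.subst σ = t.subst τ := by
  rw [Tm.subst_eq_tr, Tm.subst_eq_tr]
  refine t.tr_congr fun a ha => ?_
  cases a with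
  | varP x => exact absurd ha Tm.varP_notMem_atoms
  | varJ u => exact congrArg Entry.tm (hJ u (Tm.varJ_mem_atoms.1 ha))
  | constP d => exact absurd ha Tm.constP_notMem_atoms
  | constJ c => exact congrArg Entry.tm ((hσ.2 c).trans (hτ.2 c).symm)

/-- First `σ`, then `τ`. -/
noncomputable def Subst.comp (σ τ : Subst C D) : Subst C D where
  varP x := (σ.varP x).subst τ
  constP d := (σ.constP d).subst τ
  varJ u := (σ.varJ u).subst τ
  constJ c := (σ.constJ c).subst τ

theorem Subst.OnVars.comp {σ τ : Subst C D} (hσ : σ.OnVars) (hτ : τ.OnVars) :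
    (σ.comp τ).OnVars := by
  refine ⟨fun d => ?_, fun c => ?_⟩
  · simp only [Subst.comp, hσ.1]
    exact hτ.1 d
  · simp only [Subst.comp, hσ.2]
    exact hτ.2 c

theorem Subst.toTr_comp (σ τ : Subst C D) : (σ.comp τ).toTr = σ.toTr.comp τ.toTr := by
  ext1 <;> funext <;> simp only [toTr, comp, Translation.comp, Fm.subst_eq_tr, Tm.subst_eq_tr]

theorem Fm.subst_subst (φ : Fm C D) (σ τ : Subst C D) :
    (φ.subst σ).subst τ = φ.subst (σ.comp τ) := by
  simp only [Fm.subst_eq_tr, Subst.toTr_comp, Fm.tr_tr]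

theorem Tm.subst_subst (t : Tm C) (σ τ : Subst C D) :
    (t.subst σ).subst τ = t.subst (σ.comp τ) := by
  simp only [Tm.subst_eq_tr, Subst.toTr_comp, Tm.tr_tr]

/-- The term model of a Henkin set, on presentations `p` and `j` of the quotients by provable
equality. -/
noncomputable def termModel (hT : IsSufficient T) (h : IsHenkin T Φ)
    (hp : Function.Surjective p) (hj : Function.Surjective j)
    (hpe : ∀ φ ψ, p φ = p ψ ↔ Derivable T Φ (φ.eqv ψ))
    (hje : ∀ s t, j s = j t ↔ Derivable T Φ (.eqJ s t)) : Model.{u, v, w} C D := by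
  have hV := h.isValuation hT
  have hpi : ∀ φ, Derivable T Φ ((Function.surjInv hp (p φ)).eqv φ) := fun φ =>
    (hpe _ _).1 (Function.surjInv_eq hp _)
  have hji : ∀ t, Derivable T Φ (.eqJ (Function.surjInv hj (j t)) t) := fun t =>
    (hje _ _).1 (Function.surjInv_eq hj _)
  let TRUE : Set M := {m | ∃ φ, p φ = m ∧ Derivable T Φ φ}
  let REASON : L → Set M := fun l => {m | ∃ φ t, p φ = m ∧ j t = l ∧ Derivable T Φ (φ.just t)}
  let Ref : M → M → Prop := fun m m' => ∃ φ ψ, p φ = m ∧ p ψ = m' ∧ Derivable T Φ (φ.ref ψ)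
  have eP := @Derivable.eqv_refl C D T Φ
  have eJ := @Derivable.eqJ_refl C D T Φ hT
  -- Truth, reasons and reference are defined through some representative; this and the next two
  -- facts show that any representative will do.
  have mem_TRUE : ∀ φ, p φ ∈ TRUE ↔ Derivable T Φ φ := by
    refine fun φ => ⟨?_, fun h => ⟨φ, rfl, h⟩⟩
    rintro ⟨ψ, e, hψ⟩
    exact ((Derivable.ax (.eqv_imp _ _)).mp ((hpe _ _).1 e)).mp hψ
  have mem_REASON : ∀ φ t, p φ ∈ REASON (j t) ↔ Derivable T Φ (φ.just t) := by
    refine fun φ t => ⟨?_, fun h => ⟨φ, t, rfl, rfl, h⟩⟩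
    rintro ⟨ψ, s, e, e', hψ⟩
    exact Derivable.replace hT ((Fm.var 0).just (.var 0)) ((hpe _ _).1 e) (eP φ)
      ((hje _ _).1 e') (eJ t) hψ
  have Ref_iff : ∀ φ ψ, Ref (p φ) (p ψ) ↔ Derivable T Φ (φ.ref ψ) := by
    refine fun φ ψ => ⟨?_, fun h => ⟨φ, ψ, rfl, rfl, h⟩⟩
    rintro ⟨φ', ψ', e, e', hψ⟩
    exact Derivable.replace hT ((Fm.var 0).ref (.var 1)) ((hpe _ _).1 e) ((hpe _ _).1 e')
      (eJ (.var 0)) (eJ (.var 0)) hψ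
  -- With the axiom relating `≡` and `≤`, this makes inclusion of reasons antisymmetric on indexes.
  have subset_iff : ∀ s t, REASON (j s) ⊆ REASON (j t) ↔ Derivable T Φ (.leJ s t) := by
    intro s t
    rw [h.leJ_iff hT]
    refine ⟨fun h' φ hφ => (mem_REASON φ t).1 (h' ((mem_REASON φ s).2 hφ)), fun h' m hm => ?_⟩
    obtain ⟨φ, rfl⟩ := hp m
    exact (mem_REASON φ t).2 (h' φ ((mem_REASON φ s).1 hm))
  let order : PartialOrder L :=
    { le := fun l l' => REASON l ⊆ REASON l'
      le_refl := fun _ => subset_rfl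
      le_trans := fun _ _ _ h1 h2 => h1.trans h2
      le_antisymm := by
        intro l l' h1 h2
        obtain ⟨s, rfl⟩ := hj l
        obtain ⟨t, rfl⟩ := hj l'
        rw [hje, (hV.iff _ _).1 (.ax (.eqJ_iff s t)), hV.and]
        exact ⟨(subset_iff _ _).1 h1, (subset_iff _ _).1 h2⟩ }
  exact
    { L := L
      M := M
      order := order
      add := fun l l' => j (.sum (Function.surjInv hj l) (Function.surjInv hj l'))
      mul := fun l l' => j (.app (Function.surjInv hj l) (Function.surjInv hj l'))
      TRUE := TRUE
      FALSE := TRUEᶜ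
      NECESSARY := ⋃ l, REASON l
      REASON := REASON
      Ref := Ref
      Γ := fun φ γ => p (φ.subst (γ.rep hp hj))
      ΓJ := fun t γ => j (t.subst (γ.rep hp hj))
      true_union_false := Set.union_compl_self _
      true_inter_false := Set.inter_compl_self _
      necessary_subset := by
        refine Set.iUnion_subset fun l m hm => ?_
        obtain ⟨φ, t, rfl, rfl, hφ⟩ := hm
        exact ⟨φ, rfl, (Derivable.ax (.box_imp φ)).mp ((h.box_iff hT φ).2 ⟨t, hφ⟩)⟩
      necessary_eq := rfl
      le_iff := fun _ _ => Iff.rfl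
      ref_trans := by
        intro a b c h1 h2
        obtain ⟨φ, rfl⟩ := hp a
        obtain ⟨ψ, rfl⟩ := hp b
        obtain ⟨χ, rfl⟩ := hp c
        rw [Ref_iff] at h1 h2 ⊢
        exact ((Derivable.ax (.ref_trans φ ψ χ)).mp h1).mp h2
      ep := fun x γ => Function.surjInv_eq hp _
      epJ := fun u γ => Function.surjInv_eq hj _
      cp := by
        intro φ γ γ' h1 h2
        refine congrArg p (φ.subst_congr (γ.onVars_rep hp hj) (γ'.onVars_rep hp hj)
          (fun x hx => ?_) fun u hu => ?_)
        · simp only [Assignment.rep, h1 x hx]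
        · simp only [Assignment.rep, h2 u hu]
      cpJ := by
        intro t γ γ' h2
        refine congrArg j (t.subst_congr (γ.onVars_rep hp hj) (γ'.onVars_rep hp hj)
          fun u hu => ?_)
        simp only [Assignment.rep, h2 u hu]
      sp := by
        intro φ σ γ hσ
        rw [hpe, Fm.subst_subst]
        -- One side substitutes the instance of `σ x` itself, the other the chosen representative of
        -- its class; these are provably equal.
        exact Derivable.eqv_subst hT φ (hσ.comp (γ.onVars_rep hp hj))
          (Assignment.onVars_rep hp hj _) (fun x _ => (hpi _).eqv_symm hT)
          fun u _ => (hji _).eqJ_symm hT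
      spJ := by
        intro t σ γ hσ
        rw [hje, Tm.subst_subst]
        exact Derivable.eqJ_subst hT t (hσ.comp (γ.onVars_rep hp hj))
          (Assignment.onVars_rep hp hj _) fun u _ => (hji _).eqJ_symm hT
      rp := by
        intro φ ψ γ hr
        rw [Ref_iff, Fm.subst_eq_tr, Fm.subst_eq_tr]
        exact .ax (.ref_of_synRef (hr.tr _))
      hp_sum := by
        intro s t γ
        rw [hje]
        -- The operation on indexes is computed on chosen representatives, and congruence for `v₀ +
        -- v₁` returns to the given terms.
        exact Derivable.eqJ_subst hT (.sum (.var 0) (.var 1))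
          (σ := Subst.pair (.var 0) (.var 0) (s.subst (γ.rep hp hj)) (t.subst (γ.rep hp hj)))
          (τ := Subst.pair (.var 0) (.var 0) _ _) (Subst.onVars_pair ..) (Subst.onVars_pair ..)
          fun u _ => by
            by_cases hu : u = 0 <;> simp only [Subst.pair, hu, if_true, if_false] <;>
              exact (hji _).eqJ_symm hT
      hp_app := by
        intro s t γ
        rw [hje]
        exact Derivable.eqJ_subst hT (.app (.var 0) (.var 1))
          (σ := Subst.pair (.var 0) (.var 0) (s.subst (γ.rep hp hj)) (t.subst (γ.rep hp hj)))
          (τ := Subst.pair (.var 0) (.var 0) _ _) (Subst.onVars_pair ..) (Subst.onVars_pair ..)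
          fun u _ => by
            by_cases hu : u = 0 <;> simp only [Subst.pair, hu, if_true, if_false] <;>
              exact (hji _).eqJ_symm hT
      imp_true := by
        intro φ ψ γ
        rw [Set.mem_compl_iff, mem_TRUE, mem_TRUE, mem_TRUE]
        refine (hV.imp (φ.subst _) (ψ.subst _)).trans ?_
        tauto
      neg_true := by
        intro φ γ
        rw [mem_TRUE, mem_TRUE]
        exact hV.neg (φ.subst _)
      isTrue_true := by
        intro φ γ
        rw [mem_TRUE, mem_TRUE]
        exact (hV.iff _ _).1 (.ax (.true_iff (φ.subst _)))
      isFalse_true := by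
        intro φ γ
        rw [Set.mem_compl_iff, mem_TRUE, mem_TRUE, ← hV.neg]
        exact (hV.iff _ _).1 (.ax (.false_iff (φ.subst _)))
      eqv_true := by
        intro φ ψ γ
        rw [mem_TRUE, hpe]
        rfl
      ref_true := by
        intro φ ψ γ
        rw [mem_TRUE, Ref_iff]
        rfl
      eqJ_true := by
        intro s t γ
        rw [mem_TRUE, hje]
        rfl
      leJ_true := by
        intro s t γ
        rw [mem_TRUE]
        exact (subset_iff _ _).symm
      box_true := by
        intro φ γ
        rw [mem_TRUE, Set.mem_iUnion]
        refine (h.box_iff hT (φ.subst _)).trans ⟨fun ⟨t, ht⟩ => ⟨j t, (mem_REASON _ _).2 ht⟩, ?_⟩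
        rintro ⟨l, hl⟩
        obtain ⟨t, rfl⟩ := hj l
        exact ⟨t, (mem_REASON _ _).1 hl⟩
      just_true := by
        intro φ t γ
        rw [mem_TRUE, mem_REASON]
        rfl
      app_reason := by
        intro φ ψ s t γ h1 h2
        rw [mem_REASON] at h1 h2 ⊢
        exact ((Derivable.ax (.application (φ.subst _) (ψ.subst _) _ _)).mp h1).mp h2
      sum_reason := by
        intro φ s t γ h
        rw [Set.mem_union, mem_REASON, mem_REASON] at h
        rw [mem_REASON]
        rcases h with h | h
        · exact (Derivable.ax (.weaken_left _ _ _)).mp h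
        · exact (Derivable.ax (.weaken_right _ _ _)).mp h
      allJ_true := by
        intro u φ hu γ
        rw [mem_TRUE, h.allJ_subst_iff]
        constructor
        · intro h' l
          rw [mem_TRUE, Assignment.rep_updJ]
          exact h' _
        · intro h' t
          have h1 := h' (j t)
          rw [mem_TRUE, Assignment.rep_updJ] at h1
          -- The hypothesis speaks of the chosen representative of the class of `t`; congruence
          -- transfers it to `t`.
          refine ((Derivable.ax (.eqv_imp _ _)).mp (Derivable.eqv_subst hT φ
            ((γ.onVars_rep hp hj).updJ u (Function.surjInv hj (j t)))
            ((γ.onVars_rep hp hj).updJ u t)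
            (fun x _ => eP _) fun v _ => ?_)).mp h1
          by_cases e : v = u
          · subst e
            simp only [Subst.updJ, Function.update_self]
            exact hji t
          · simp only [Subst.updJ, Function.update_of_ne e]
            exact eJ _
      all_true := by
        intro x φ hx γ
        rw [mem_TRUE, h.all_subst_iff]
        constructor
        · intro h' l
          rw [mem_TRUE, Assignment.rep_updP]
          exact h' _
        · intro h' ψ
          have h1 := h' (p ψ)
          rw [mem_TRUE, Assignment.rep_updP] at h1
          refine ((Derivable.ax (.eqv_imp _ _)).mp (Derivable.eqv_subst hT φ
            ((γ.onVars_rep hp hj).updP x (Function.surjInv hp (p ψ)))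
            ((γ.onVars_rep hp hj).updP x ψ)
            (fun y _ => ?_) fun v _ => eJ _)).mp h1
          by_cases e : y = x
          · subst e
            simp only [Subst.updP, Function.update_self]
            exact hpi ψ
          · simp only [Subst.updP, Function.update_of_ne e]
            exact eP _ }

def eqvSetoid (hT : IsSufficient T) (Φ : Set (Fm C D)) : Setoid (Fm C D) where
  r φ ψ := Derivable T Φ (φ.eqv ψ)
  iseqv := ⟨Derivable.eqv_refl, Derivable.eqv_symm hT, Derivable.eqv_trans hT⟩

def eqJSetoid (hT : IsSufficient T) (Φ : Set (Fm C D)) : Setoid (Tm C) where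
  r s t := Derivable T Φ (.eqJ s t)
  iseqv := ⟨Derivable.eqJ_refl hT, Derivable.eqJ_symm hT, Derivable.eqJ_trans hT⟩

theorem hasModel_of_isHenkin (hT : IsSufficient T) (h : IsHenkin T Φ) :
    HasModel.{u, v, max u v w} Φ := by
  -- The two quotients live in different universes, so both are lifted to a common one.
  let p : Fm C D → ULift.{w} (Quotient (eqvSetoid hT Φ)) := fun φ => ⟨Quotient.mk _ φ⟩
  let j : Tm C → ULift.{max v w} (Quotient (eqJSetoid hT Φ)) := fun t => ⟨Quotient.mk _ t⟩
  have hp : Function.Surjective p := fun ⟨q⟩ => by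
    obtain ⟨φ, rfl⟩ := Quotient.exists_rep q
    exact ⟨φ, rfl⟩
  have hj : Function.Surjective j := fun ⟨q⟩ => by
    obtain ⟨t, rfl⟩ := Quotient.exists_rep q
    exact ⟨t, rfl⟩
  have hpe : ∀ φ ψ, p φ = p ψ ↔ Derivable T Φ (φ.eqv ψ) := fun φ ψ =>
    ULift.up_inj.trans Quotient.eq
  have hje : ∀ s t, j s = j t ↔ Derivable T Φ (.eqJ s t) := fun s t =>
    ULift.up_inj.trans Quotient.eq
  let γ : Assignment (ULift.{w} (Quotient (eqvSetoid hT Φ)))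
    (ULift.{max v w} (Quotient (eqJSetoid hT Φ))) := ⟨fun x => p (.var x), fun u => j (.var u)⟩
  refine ⟨termModel hT h hp hj hpe hje, γ, fun φ hφ => ⟨φ, ?_, .hyp hφ⟩⟩
  -- Under `γ` each variable denotes its own class, so its representative is provably equal to it.
  -- The identity instance in turn is only an alpha-variant of `φ`.
  have e : p (φ.subst Subst.id) = p (φ.subst (γ.rep hp hj)) := by
    rw [hpe]
    refine Derivable.eqv_subst hT φ Subst.onVars_id (γ.onVars_rep hp hj) (fun x _ => ?_)
      fun u _ => ?_
    · exact (hpe _ _).1 (Function.surjInv_eq hp _).symm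
    · exact (hje _ _).1 (Function.surjInv_eq hj _).symm
  refine Eq.trans ?_ e
  rw [hpe, Fm.subst_eq_tr]
  exact .ax (.eqv_of_alphaEq (alphaEq_tr_id φ))

end

/-! ### Extension of consistent sets to Henkin sets -/

section

variable {C : Type u} {D : Type v} {T Φ Ψ : Set (Fm C D)}

theorem Derivable.cut (h : ∀ ψ ∈ Ψ, Derivable T Φ ψ) {φ : Fm C D} (hφ : Derivable T Ψ φ) :
    Derivable T Φ φ :=
  Derivable.induct (p := Derivable T Φ) h (fun _ h => .ax h) (fun _ _ _ _ h1 h2 => h1.mp h2) hφ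

theorem Consistent.mono (h : Consistent T Ψ) (hs : Φ ⊆ Ψ) : Consistent T Φ :=
  fun ⟨φ, h1, h2⟩ => h ⟨φ, h1.mono hs, h2.mono hs⟩

theorem consistent_of_finite (h : ∀ F ⊆ Φ, F.Finite → Consistent T F) : Consistent T Φ := by
  rintro ⟨φ, h1, h2⟩
  obtain ⟨F, hF, hF', h1⟩ := h1.exists_finite
  obtain ⟨G, hG, hG', h2⟩ := h2.exists_finite
  exact h (F ∪ G) (Set.union_subset hF hG) (hF'.union hG')
    ⟨φ, h1.mono Set.subset_union_left, h2.mono Set.subset_union_right⟩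

/-- Derivations use finitely many premises, so unions of chains of consistent sets are consistent
and Zorn's lemma applies. -/
theorem Consistent.exists_maximal (h : Consistent T Φ) :
    ∃ Ψ, Φ ⊆ Ψ ∧ Maximal (Consistent T) Ψ := by
  refine zorn_subset_nonempty {Ψ | Consistent T Ψ} (fun c hc hchain hne => ?_) Φ h
  refine ⟨⋃₀ c, consistent_of_finite fun F hF hfin => ?_, fun s hs => Set.subset_sUnion_of_mem hs⟩
  obtain ⟨s, hs, hFs⟩ := DirectedOn.exists_mem_subset_of_finite_of_subset_sUnion hne
    hchain.directedOn hfin hF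
  exact Consistent.mono (hc hs) hFs

-- Generalization on constants. If the witness axiom were refutable, `Φ` would prove both `φ[x :=
-- d]` and `¬∀x.φ`. As `d` is new, it can be replaced throughout the derivation by a fresh variable,
-- which may then be generalized.
open Classical in
theorem Consistent.insert_witness (hT : IsSufficient T) (hΦ : Consistent T Φ) {φ : Fm C D} {x : ℕ}
    (hx : x ∈ φ.fvP) {d : D} (hd : ∀ ψ ∈ Φ, Atom.constP d ∉ ψ.atoms)
    (hd' : Atom.constP d ∉ φ.atoms) :
    Consistent T (insert ((φ.substP x (.const d)).imp (.all x φ hx)) Φ) := by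
  by_contra hc
  have hn := derivable_neg_of_not_consistent hT hc
  have h1 : Derivable T Φ (φ.substP x (.const d)) := hn.taut₁ hT fun V hV h => by
    rw [hV.neg, hV.imp] at h
    tauto
  have h2 : Derivable T Φ (Fm.all x φ hx).neg := hn.taut₁ hT fun V hV h => by
    rw [hV.neg, hV.imp] at h
    rw [hV.neg]
    tauto
  -- All of `Φ` might use up every variable, so a fresh one exists only for the finitely many
  -- premises used.
  obtain ⟨F, hF, hfin, h1⟩ := h1.exists_finite
  let S : Set (Atom C D) := φ.atoms ∪ ⋃ ψ ∈ F, ψ.atoms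
  have hS : S.Finite := φ.finite_atoms.union (hfin.biUnion fun ψ _ => ψ.finite_atoms)
  have hy := nextP_notMem hS
  generalize nextP S = y at hy
  let σ : Translation C D C D :=
    { Translation.id with constP := Function.update Fm.const d (.var y) }
  have hσ : ∀ a, a ≠ .constP d → σ.val a = Translation.id.val a := by
    intro a ha
    cases a with
    | constP e =>
      have : e ≠ d := fun h => ha (h ▸ rfl)
      simp [σ, Translation.val, Translation.id, this]
    | _ => rfl
  -- As `d` does not occur in the premises, `σ` merely normalizes their bound variables.
  have hFσ : (·.tr σ) '' F = (·.tr Translation.id) '' F := by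
    refine Set.image_congr fun ψ hψ => ψ.tr_congr fun a ha => hσ a ?_
    rintro rfl
    exact hd ψ (hF hψ) ha
  have h3 := h1.tr hT hT σ
  rw [hFσ, Fm.tr_substP] at h3
  have e : φ.tr (σ.updP x ((Fm.const d).tr σ)) = φ.tr (Translation.id.updP x (.var y)) := by
    refine φ.tr_congr fun a ha => ?_
    by_cases hax : a = .varP x
    · subst hax
      simp [Translation.val_updP_self, Fm.tr, Fm.const, RawFm.tr, σ]
    · simp only [Translation.val_updP_of_ne _ _ hax]
      exact hσ a fun h => hd' (h ▸ ha)
  rw [e] at h3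
  have h4 := h3.gen (x := y) (by
    rintro _ ⟨ψ, hψ, rfl⟩ hm
    rw [Fm.mem_fvP_tr, Translation.image_id] at hm
    exact hy (.inr (Set.mem_biUnion hψ hm))) (Fm.mem_fvP_tr_updP _ hx y)
  have hfr : Atom.varP y ∉ Translation.id.image (φ.atoms \ {.varP x}) := by
    rw [Translation.image_id]
    exact fun h => hy (.inl h.1)
  -- The bound variable is renamed back and the normalization undone, leaving the formula whose
  -- negation is derivable.
  have h5 := (h4.alpha (alphaEq_tr_all φ hx Translation.id hfr).symm).alpha (alphaEq_tr_id _).symm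
  refine hΦ ⟨_, Derivable.cut ?_ h5, h2⟩
  rintro _ ⟨ψ, hψ, rfl⟩
  exact .alpha (alphaEq_tr_id ψ) (.hyp (hF hψ))

open Classical in
theorem Consistent.insert_witnessJ (hT : IsSufficient T) (hΦ : Consistent T Φ) {φ : Fm C D}
    {u : ℕ} (hu : u ∈ φ.fvJ) {c : C} (hc : ∀ ψ ∈ Φ, Atom.constJ c ∉ ψ.atoms)
    (hc' : Atom.constJ c ∉ φ.atoms) :
    Consistent T (insert ((φ.substJ u (.const c)).imp (.allJ u φ hu)) Φ) := by
  by_contra hcon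
  have hn := derivable_neg_of_not_consistent hT hcon
  have h1 : Derivable T Φ (φ.substJ u (.const c)) := hn.taut₁ hT fun V hV h => by
    rw [hV.neg, hV.imp] at h
    tauto
  have h2 : Derivable T Φ (Fm.allJ u φ hu).neg := hn.taut₁ hT fun V hV h => by
    rw [hV.neg, hV.imp] at h
    rw [hV.neg]
    tauto
  obtain ⟨F, hF, hfin, h1⟩ := h1.exists_finite
  let S : Set (Atom C D) := φ.atoms ∪ ⋃ ψ ∈ F, ψ.atoms
  have hS : S.Finite := φ.finite_atoms.union (hfin.biUnion fun ψ _ => ψ.finite_atoms)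
  have hv := nextJ_notMem hS
  generalize nextJ S = v at hv
  let σ : Translation C D C D :=
    { Translation.id with constJ := Function.update Tm.const c (.var v) }
  have hσ : ∀ a, a ≠ .constJ c → σ.val a = Translation.id.val a := by
    intro a ha
    cases a with
    | constJ e =>
      have : e ≠ c := fun h => ha (h ▸ rfl)
      simp [σ, Translation.val, Translation.id, this]
    | _ => rfl
  have hFσ : (·.tr σ) '' F = (·.tr Translation.id) '' F := by
    refine Set.image_congr fun ψ hψ => ψ.tr_congr fun a ha => hσ a ?_
    rintro rfl
    exact hc ψ (hF hψ) ha
  have h3 := h1.tr hT hT σ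
  rw [hFσ, Fm.tr_substJ] at h3
  have e : φ.tr (σ.updJ u ((Tm.const c).tr σ)) = φ.tr (Translation.id.updJ u (.var v)) := by
    refine φ.tr_congr fun a ha => ?_
    by_cases hau : a = .varJ u
    · subst hau
      simp [Translation.val_updJ_self, Tm.tr, σ]
    · simp only [Translation.val_updJ_of_ne _ _ hau]
      exact hσ a fun h => hc' (h ▸ ha)
  rw [e] at h3
  have h4 := h3.genJ (u := v) (by
    rintro _ ⟨ψ, hψ, rfl⟩ hm
    rw [Fm.mem_fvJ_tr, Translation.image_id] at hm
    exact hv (.inr (Set.mem_biUnion hψ hm))) (Fm.mem_fvJ_tr_updJ _ hu v)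
  have hfr : Atom.varJ v ∉ Translation.id.image (φ.atoms \ {.varJ u}) := by
    rw [Translation.image_id]
    exact fun h => hv (.inl h.1)
  have h5 := (h4.alpha (alphaEq_tr_allJ φ hu Translation.id hfr).symm).alpha
    (alphaEq_tr_id _).symm
  refine hΦ ⟨_, Derivable.cut ?_ h5, h2⟩
  rintro _ ⟨ψ, hψ, rfl⟩
  exact .alpha (alphaEq_tr_id ψ) (.hyp (hF hψ))

end

/-! ### Witnessing constants, all added at once -/

/-- The constants of the extended language, for both sorts: the given ones, and a witness for
each formula and variable. -/
inductive Wit (C : Type u) (D : Type v) : Type (max u v)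
  | baseJ : C → Wit C D
  | baseP : D → Wit C D
  | wit : ℕ → RawFm (Wit C D) (Wit C D) → Wit C D

section

variable {C : Type u} {D : Type v}

theorem Tm.sizeOf_lt_of_mem_conJ [SizeOf C] {c : C} {t : Tm C} (h : c ∈ t.conJ) :
    sizeOf c < sizeOf t := by
  induction t <;> simp_all [Tm.conJ] <;> grind

theorem RawFm.sizeOf_lt_of_mem_conP [SizeOf C] [SizeOf D] {d : D} {φ : RawFm C D}
    (h : d ∈ φ.conP) : sizeOf d < sizeOf φ := by
  induction φ <;> simp_all [RawFm.conP] <;> grind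

theorem RawFm.sizeOf_lt_of_mem_conJ [SizeOf C] [SizeOf D] {c : C} {φ : RawFm C D}
    (h : c ∈ φ.conJ) : sizeOf c < sizeOf φ := by
  induction φ with
  | var | const => exact absurd h (Set.notMem_empty _)
  | imp _ _ h1 h2 | eqv _ _ h1 h2 | ref _ _ h1 h2 =>
    simp only [imp.sizeOf_spec, eqv.sizeOf_spec, ref.sizeOf_spec]
    exact h.elim (fun h => by have := h1 h; omega) fun h => by have := h2 h; omega
  | eqJ | leJ =>
    simp only [eqJ.sizeOf_spec, leJ.sizeOf_spec]
    exact h.elim (fun h => by have := Tm.sizeOf_lt_of_mem_conJ h; omega)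
      fun h => by have := Tm.sizeOf_lt_of_mem_conJ h; omega
  | just _ _ h1 =>
    simp only [just.sizeOf_spec]
    exact h.elim (fun h => by have := h1 h; omega)
      fun h => by have := Tm.sizeOf_lt_of_mem_conJ h; omega
  | neg _ h1 | isTrue _ h1 | isFalse _ h1 | box _ h1 | all _ _ h1 | allJ _ _ h1 =>
    have := h1 h
    simp only [neg.sizeOf_spec, isTrue.sizeOf_spec, isFalse.sizeOf_spec, box.sizeOf_spec,
      all.sizeOf_spec, allJ.sizeOf_spec]
    omega

/-- The quantified formulas of the extended language. -/
inductive WitKey (C : Type u) (D : Type v) : Type (max u v)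
  | all (x : ℕ) (φ : Fm (Wit C D) (Wit C D)) (h : x ∈ φ.fvP) : WitKey C D
  | allJ (u : ℕ) (φ : Fm (Wit C D) (Wit C D)) (h : u ∈ φ.fvJ) : WitKey C D

namespace WitKey

/-- The body of the quantified formula. -/
def body : WitKey C D → Fm (Wit C D) (Wit C D)
  | all _ φ _ => φ
  | allJ _ φ _ => φ

def wit : WitKey C D → Wit C D
  | all x φ _ => .wit x φ.1
  | allJ u φ _ => .wit u φ.1

/-- The witness, as a constant of the sort of the quantified variable. -/
def atom : WitKey C D → Atom (Wit C D) (Wit C D)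
  | all x φ _ => .constP (.wit x φ.1)
  | allJ u φ _ => .constJ (.wit u φ.1)

/-- The formula that makes the witness a witness. -/
noncomputable def fm : WitKey C D → Fm (Wit C D) (Wit C D)
  | all x φ h => (φ.substP x (.const (.wit x φ.1))).imp (.all x φ h)
  | allJ u φ h => (φ.substJ u (.const (.wit u φ.1))).imp (.allJ u φ h)

/-- The element of `Wit` alone does not record whether the quantifier was `∀` or `⋀`; its sort as an
atom does. -/
theorem atom_injective : Function.Injective (atom : WitKey C D → _) := by
  intro k k' h
  cases k <;> cases k' <;>
    simp only [atom, Atom.constP.injEq, Atom.constJ.injEq, Wit.wit.injEq, reduceCtorEq] at h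
  · obtain ⟨rfl, h⟩ := h
    obtain rfl := Fm.ext h
    rfl
  · obtain ⟨rfl, h⟩ := h
    obtain rfl := Fm.ext h
    rfl

theorem atoms_fm_subset (k : WitKey C D) : k.fm.atoms ⊆ k.body.atoms ∪ {k.atom} := by
  cases k with
  | all x φ h =>
    rintro b (hb | hb)
    · have hb : b ∈ (φ.substP x (.const (.wit x φ.1))).atoms := hb
      rw [Fm.substP_eq_tr, Fm.atoms_tr] at hb
      obtain ⟨a, ha, hb⟩ := hb
      by_cases hax : a = .varP x
      · subst hax
        rw [Translation.val_updP_self] at hb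
        exact .inr hb
      · rw [Translation.val_updP_of_ne _ _ hax, Translation.val_id, Atom.atoms_toEntry] at hb
        exact .inl (Set.mem_singleton_iff.1 hb ▸ ha)
    · exact .inl hb.1
  | allJ x φ h =>
    rintro b (hb | hb)
    · have hb : b ∈ (φ.substJ x (.const (.wit x φ.1))).atoms := hb
      rw [Fm.substJ_eq_tr, Fm.atoms_tr] at hb
      obtain ⟨a, ha, hb⟩ := hb
      by_cases hax : a = .varJ x
      · subst hax
        rw [Translation.val_updJ_self] at hb
        exact .inr hb
      · rw [Translation.val_updJ_of_ne _ _ hax, Translation.val_id, Atom.atoms_toEntry] at hb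
        exact .inl (Set.mem_singleton_iff.1 hb ▸ ha)
    · exact .inl hb.1

/-- A witness has its formula as a structural part, and that formula is larger than each constant in
it. Occurrence of witnesses in formulas is thereby well-founded. -/
theorem sizeOf_wit_lt {k k' : WitKey C D} (h : k.atom ∈ k'.body.atoms) :
    sizeOf k.wit < sizeOf k'.wit := by
  have h1 : sizeOf k.wit < sizeOf k'.body.1 := by
    cases k with
    | all x φ hx => exact RawFm.sizeOf_lt_of_mem_conP (RawFm.constP_mem_atoms.1 h)
    | allJ u φ hu => exact RawFm.sizeOf_lt_of_mem_conJ (RawFm.constJ_mem_atoms.1 h)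
  have h2 : sizeOf k'.body.1 < sizeOf k'.wit := by
    cases k' <;> simp [body, wit]
  exact h1.trans h2

theorem atom_notMem_body (k : WitKey C D) : k.atom ∉ k.body.atoms :=
  fun h => (sizeOf_wit_lt h).false

theorem atom_notMem_fm {k k' : WitKey C D} (hne : k' ≠ k) (h : sizeOf k'.wit ≤ sizeOf k.wit) :
    k.atom ∉ k'.fm.atoms := by
  intro hm
  rcases k'.atoms_fm_subset hm with hm | hm
  · exact (sizeOf_wit_lt hm).not_ge h
  · exact hne (atom_injective hm.symm)

theorem consistent_insert {T Φ : Set (Fm (Wit C D) (Wit C D))} (hT : IsSufficient T)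
    (hΦ : Consistent T Φ) (k : WitKey C D) (hk : ∀ ψ ∈ Φ, k.atom ∉ ψ.atoms) :
    Consistent T (insert k.fm Φ) := by
  have hb := k.atom_notMem_body
  cases k with
  | all x φ h => exact hΦ.insert_witness hT h hk hb
  | allJ u φ h => exact hΦ.insert_witnessJ hT h hk hb

-- By compactness only finitely many witness axioms matter. Adding them by increasing size keeps
-- each new witness out of the axioms already present.
open Classical in
theorem consistent_union_range {T Φ : Set (Fm (Wit C D) (Wit C D))} (hT : IsSufficient T)
    (hΦ : Consistent T Φ) (hk : ∀ k : WitKey C D, ∀ ψ ∈ Φ, k.atom ∉ ψ.atoms) :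
    Consistent T (Φ ∪ Set.range (fm : WitKey C D → _)) := by
  have key : ∀ s : Finset (WitKey C D), Consistent T (Φ ∪ fm '' s) := by
    intro s
    -- The inserted key has a witness of maximal size; `atom_notMem_fm` also handles other keys of
    -- equal size.
    refine Finset.induction_on_max_value (fun k : WitKey C D => sizeOf k.wit) s ?_ ?_
    · simpa using hΦ
    · intro k s hks hmax ih
      rw [Finset.coe_insert, Set.image_insert_eq, Set.union_insert]
      refine consistent_insert hT ih k ?_
      rintro ψ (hψ | ⟨k', hk', rfl⟩)
      · exact hk k ψ hψ
      · exact atom_notMem_fm (fun e => hks (e ▸ hk')) (hmax k' hk')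
  refine consistent_of_finite fun F hF hfin => ?_
  -- The members of `F` outside `Φ` are witness axioms, and finitely many keys produce them.
  have hsub : ((hfin.sdiff (t := Φ)).toFinset : Set _) ⊆ (fm : WitKey C D → _) '' Set.univ := by
    intro α hα
    rw [Set.Finite.coe_toFinset] at hα
    rw [Set.image_univ]
    exact (hF hα.1).resolve_left hα.2
  obtain ⟨s, -, hs⟩ := Finset.subset_set_image_iff.1 hsub
  refine (key s).mono fun α hα => ?_
  by_cases h : α ∈ Φ
  · exact .inl h
  · refine .inr ?_
    have : α ∈ (hfin.sdiff (t := Φ)).toFinset := by simp [hα, h]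
    rw [← hs] at this
    simpa using this

end WitKey

end

/-- The translation that renames the constants. -/
def Translation.ofConsts {C D C' D' : Type*} (g : C → C') (f : D → D') :
    Translation C D C' D' :=
  ⟨Fm.var, fun d => .const (f d), Tm.var, fun c => .const (g c)⟩

section

variable {C : Type u} {D : Type v}

/-- The inclusion of the given language into the extended one. -/
def Wit.incl : Translation C D (Wit C D) (Wit C D) := Translation.ofConsts Wit.baseJ Wit.baseP

/-- A left inverse of the inclusion. -/
def Wit.proj : Translation (Wit C D) (Wit C D) C D where
  varP := Fm.var
  constP
    | .baseP d => .const d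
    | _ => .var 0
  varJ := Tm.var
  constJ
    | .baseJ c => .const c
    | _ => .var 0

theorem Wit.tr_incl_tr_proj (φ : Fm C D) : (φ.tr Wit.incl).tr Wit.proj = φ.tr Translation.id := by
  rw [Fm.tr_tr]
  refine φ.tr_congr fun a _ => ?_
  cases a <;> rfl

theorem Wit.atom_notMem_tr_incl (k : WitKey C D) (φ : Fm C D) :
    k.atom ∉ (φ.tr Wit.incl).atoms := by
  rw [Fm.atoms_tr]
  rintro ⟨a, -, h⟩
  cases a <;> cases k <;>
    simp [WitKey.atom, Wit.incl, Translation.ofConsts, Translation.val, Entry.atoms, Fm.atoms,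
      Tm.atoms, RawFm.atoms, Fm.var, Fm.const] at h

/-- A contradiction in the extended language translates back along `Wit.proj`, where witnesses
become variables and the premises return as alpha-variants of themselves. -/
theorem Consistent.tr_incl {T Φ : Set (Fm C D)} {T' : Set (Fm (Wit C D) (Wit C D))}
    (hT : IsSufficient T) (hT' : IsSufficient T') (h : Consistent T Φ) :
    Consistent T' ((·.tr Wit.incl) '' Φ) := by
  rintro ⟨φ, h1, h2⟩
  have hcut : ∀ ψ ∈ (·.tr Wit.proj) '' ((·.tr Wit.incl) '' Φ), Derivable T Φ ψ := by
    rintro _ ⟨_, ⟨ψ, hψ, rfl⟩, rfl⟩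
    simp only [Wit.tr_incl_tr_proj]
    exact .alpha (alphaEq_tr_id ψ) (.hyp hψ)
  exact h ⟨_, (h1.tr hT' hT Wit.proj).cut hcut, (h2.tr hT' hT Wit.proj).cut hcut⟩

/-- Witness axioms survive in any maximal extension. They reduce each quantified formula to its
instance at the witness, and elimination gives the other direction. -/
theorem Consistent.exists_isHenkin {T Φ : Set (Fm C D)} {T' : Set (Fm (Wit C D) (Wit C D))}
    (hT : IsSufficient T) (hT' : IsSufficient T') (h : Consistent T Φ) :
    ∃ Ψ, (·.tr Wit.incl) '' Φ ⊆ Ψ ∧ IsHenkin T' Ψ := by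
  obtain ⟨Ψ, hsub, hmax⟩ := (WitKey.consistent_union_range hT' (h.tr_incl hT hT') (by
    rintro k _ ⟨φ, -, rfl⟩
    exact Wit.atom_notMem_tr_incl k φ)).exists_maximal
  have hax : ∀ k : WitKey C D, Derivable T' Ψ k.fm := fun k => .hyp (hsub (.inr ⟨k, rfl⟩))
  refine ⟨Ψ, Set.subset_union_left.trans hsub, hmax, fun φ u hu => ?_, fun φ x hx => ?_⟩
  · exact ⟨fun h' c => (Derivable.ax (.allJ_elim φ u _ hu)).mp h',
      fun h' => (hax (.allJ u φ hu)).mp (h' _)⟩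
  · exact ⟨fun h' d => (Derivable.ax (.all_elim φ x _ hx)).mp h',
      fun h' => (hax (.all x φ hx)).mp (h' _)⟩

end

/-! ### Reducts -/

section

variable {C : Type u} {D : Type v} {C' D' : Type*}

theorem Fm.mem_fvP_of_tr_ofConsts {g : C → C'} {f : D → D'} {φ : Fm C D} {x : ℕ}
    (h : x ∈ (φ.tr (Translation.ofConsts g f)).fvP) : x ∈ φ.fvP := by
  obtain ⟨a, ha, hx⟩ := Fm.mem_fvP_tr.1 h
  cases a <;>
    simp [Translation.ofConsts, Translation.val, Entry.atoms, Fm.atoms,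
      Tm.atoms, RawFm.atoms, Fm.var, Fm.const] at hx
  subst hx
  exact Fm.varP_mem_atoms.1 ha

theorem Fm.mem_fvJ_of_tr_ofConsts {g : C → C'} {f : D → D'} {φ : Fm C D} {u : ℕ}
    (h : u ∈ (φ.tr (Translation.ofConsts g f)).fvJ) : u ∈ φ.fvJ := by
  obtain ⟨a, ha, hx⟩ := Fm.mem_fvJ_tr.1 h
  cases a <;>
    simp [Translation.ofConsts, Translation.val, Entry.atoms, Fm.atoms,
      Tm.atoms, RawFm.atoms, Fm.var, Fm.const] at hx
  subst hx
  exact Fm.varJ_mem_atoms.1 ha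

theorem Tm.fvJ_tr_ofConsts (g : C → C') (f : D → D') (t : Tm C) :
    (t.tr (Translation.ofConsts g f)).fvJ = t.fvJ := by
  induction t with
  | var | const => rfl
  | app _ _ h1 h2 | sum _ _ h1 h2 => simp only [tr, fvJ, h1, h2]

/-- The translate of a substitution that moves variables only. -/
noncomputable def Subst.push (σ : Subst C D) (ι : Translation C D C' D') : Subst C' D' where
  varP x := (σ.varP x).tr ι
  constP := Fm.const
  varJ u := (σ.varJ u).tr ι
  constJ := Tm.const

/-- Because `σ` fixes the constants, its translate can fix all constants of the new language and
still commute with the renaming. This carries the substitution property over to reducts. -/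
theorem Subst.val_push {σ : Subst C D} (hσ : σ.OnVars) (g : C → C') (f : D → D') (a : Atom C D) :
    (σ.toTr.comp (Translation.ofConsts g f)).val a =
      ((Translation.ofConsts g f).comp (σ.push (Translation.ofConsts g f)).toTr).val a := by
  cases a with
  | varP | varJ => rfl
  | constP d =>
    simp only [Translation.val, Translation.comp, toTr, hσ.1]
    rfl
  | constJ c =>
    simp only [Translation.val, Translation.comp, toTr, hσ.2]
    rfl

theorem Fm.tr_subst {σ : Subst C D} (hσ : σ.OnVars) (g : C → C') (f : D → D') (φ : Fm C D) :
    (φ.subst σ).tr (Translation.ofConsts g f) =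
      (φ.tr (Translation.ofConsts g f)).subst (σ.push (Translation.ofConsts g f)) := by
  rw [Fm.subst_eq_tr, Fm.subst_eq_tr, Fm.tr_tr, Fm.tr_tr]
  exact φ.tr_congr fun a _ => Subst.val_push hσ g f a

theorem Tm.tr_subst {σ : Subst C D} (hσ : σ.OnVars) (g : C → C') (f : D → D') (t : Tm C) :
    (t.subst σ).tr (Translation.ofConsts g f) =
      (t.tr (Translation.ofConsts g f)).subst (σ.push (Translation.ofConsts g f)) := by
  rw [Tm.subst_eq_tr, Tm.subst_eq_tr, Tm.tr_tr, Tm.tr_tr]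
  exact t.tr_congr fun a _ => Subst.val_push hσ g f a

/-- In contrast with `alphaEq_substP_tr` this is an equality, since the values of a renaming are
atomic and contain no bound variables to normalize. -/
theorem Fm.tr_updP_ofConsts (g : C → C') (f : D → D') (φ : Fm C D) (x : ℕ) (ψ : Fm C' D') :
    φ.tr ((Translation.ofConsts g f).updP x ψ) =
      (φ.tr (Translation.ofConsts g f)).substP x ψ := by
  rw [Fm.substP_eq_tr, Fm.tr_tr]
  exact φ.tr_congr fun a _ => by cases a <;> rfl

theorem Fm.tr_updJ_ofConsts (g : C → C') (f : D → D') (φ : Fm C D) (u : ℕ) (t : Tm C') :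
    φ.tr ((Translation.ofConsts g f).updJ u t) =
      (φ.tr (Translation.ofConsts g f)).substJ u t := by
  rw [Fm.substJ_eq_tr, Fm.tr_tr]
  exact φ.tr_congr fun a _ => by cases a <;> rfl

/-- The translated quantifier may bind a different variable. The substitution property converts its
body back, and coincidence discards the auxiliary variable. -/
theorem Model.all_true_tr {C' : Type*} {D' : Type*} (𝓜 : Model.{_, _, w} C' D') (g : C → C')
    (f : D → D') {φ : Fm C D} {x : ℕ} (h : x ∈ φ.fvP) (γ : Assignment 𝓜.M 𝓜.L) :
    𝓜.Γ ((Fm.all x φ h).tr (Translation.ofConsts g f)) γ ∈ 𝓜.TRUE ↔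
      ∀ m, 𝓜.Γ (φ.tr (Translation.ofConsts g f)) (γ.updP x m) ∈ 𝓜.TRUE := by
  obtain ⟨y, hy, e⟩ := Fm.exists_tr_all φ x h (Translation.ofConsts g f)
  rw [e, 𝓜.all_true]
  refine forall_congr' fun m => ?_
  rw [Fm.tr_updP_ofConsts, 𝓜.Γ_substP, 𝓜.ep]
  refine iff_of_eq (congrArg (· ∈ 𝓜.TRUE) (𝓜.cp _ _ _ (fun z hz => ?_) fun _ _ => rfl))
  by_cases hzx : z = x
  · subst hzx
    simp [Assignment.updP]
  -- The new bound variable was chosen outside the other free variables, so updating it changes none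
  -- of them.
  · have hzy : z ≠ y := by
      rintro rfl
      exact hy ⟨.varP z, ⟨Fm.varP_mem_atoms.2 (Fm.mem_fvP_of_tr_ofConsts hz),
        fun h => hzx (by simpa using h)⟩, Set.mem_singleton _⟩
    simp [Assignment.updP, hzx, hzy]

theorem Model.allJ_true_tr {C' : Type*} {D' : Type*} (𝓜 : Model.{_, _, w} C' D') (g : C → C')
    (f : D → D') {φ : Fm C D} {u : ℕ} (h : u ∈ φ.fvJ) (γ : Assignment 𝓜.M 𝓜.L) :
    𝓜.Γ ((Fm.allJ u φ h).tr (Translation.ofConsts g f)) γ ∈ 𝓜.TRUE ↔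
      ∀ l, 𝓜.Γ (φ.tr (Translation.ofConsts g f)) (γ.updJ u l) ∈ 𝓜.TRUE := by
  obtain ⟨v, hv, e⟩ := Fm.exists_tr_allJ φ u h (Translation.ofConsts g f)
  rw [e, 𝓜.allJ_true]
  refine forall_congr' fun l => ?_
  rw [Fm.tr_updJ_ofConsts, 𝓜.Γ_substJ, 𝓜.epJ]
  refine iff_of_eq (congrArg (· ∈ 𝓜.TRUE) (𝓜.cp _ _ _ (fun _ _ => rfl) fun z hz => ?_))
  by_cases hzu : z = u
  · subst hzu
    simp [Assignment.updJ]
  · have hzv : z ≠ v := by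
      rintro rfl
      exact hv ⟨.varJ z, ⟨Fm.varJ_mem_atoms.2 (Fm.mem_fvJ_of_tr_ofConsts hz),
        fun h => hzu (by simpa using h)⟩, Set.mem_singleton _⟩
    simp [Assignment.updJ, hzu, hzv]

/-- The reduct of a model along a renaming of constants. -/
noncomputable def Model.reduct {C' : Type*} {D' : Type*} (𝓜 : Model.{_, _, w} C' D') (g : C → C')
    (f : D → D') : Model.{u, v, w} C D where
  L := 𝓜.L
  M := 𝓜.M
  order := 𝓜.order
  add := 𝓜.add
  mul := 𝓜.mul
  TRUE := 𝓜.TRUE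
  FALSE := 𝓜.FALSE
  NECESSARY := 𝓜.NECESSARY
  REASON := 𝓜.REASON
  Ref := 𝓜.Ref
  Γ φ γ := 𝓜.Γ (φ.tr (Translation.ofConsts g f)) γ
  ΓJ t γ := 𝓜.ΓJ (t.tr (Translation.ofConsts g f)) γ
  true_union_false := 𝓜.true_union_false
  true_inter_false := 𝓜.true_inter_false
  necessary_subset := 𝓜.necessary_subset
  necessary_eq := 𝓜.necessary_eq
  le_iff := 𝓜.le_iff
  ref_trans := 𝓜.ref_trans
  ep x γ := 𝓜.ep x γ
  epJ u γ := 𝓜.epJ u γ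
  cp _ _ _ hP hJ := 𝓜.cp _ _ _ (fun x hx => hP x (Fm.mem_fvP_of_tr_ofConsts hx))
    fun u hu => hJ u (Fm.mem_fvJ_of_tr_ofConsts hu)
  cpJ _ _ _ hJ := 𝓜.cpJ _ _ _ fun u hu => hJ u (by rwa [Tm.fvJ_tr_ofConsts] at hu)
  sp φ σ γ hσ := by
    rw [Fm.tr_subst hσ]
    exact 𝓜.sp _ _ γ ⟨fun _ => rfl, fun _ => rfl⟩
  spJ t σ γ hσ := by
    rw [Tm.tr_subst hσ]
    exact 𝓜.spJ _ _ γ ⟨fun _ => rfl, fun _ => rfl⟩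
  rp φ ψ γ h := 𝓜.rp _ _ γ (h.tr _)
  hp_sum s t γ := 𝓜.hp_sum _ _ γ
  hp_app s t γ := 𝓜.hp_app _ _ γ
  imp_true φ ψ γ := 𝓜.imp_true (φ.tr _) (ψ.tr _) γ
  neg_true φ γ := 𝓜.neg_true (φ.tr _) γ
  isTrue_true φ γ := 𝓜.isTrue_true (φ.tr _) γ
  isFalse_true φ γ := 𝓜.isFalse_true (φ.tr _) γ
  eqv_true φ ψ γ := 𝓜.eqv_true (φ.tr _) (ψ.tr _) γ
  ref_true φ ψ γ := 𝓜.ref_true (φ.tr _) (ψ.tr _) γ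
  eqJ_true s t γ := 𝓜.eqJ_true (s.tr _) (t.tr _) γ
  leJ_true s t γ := 𝓜.leJ_true (s.tr _) (t.tr _) γ
  box_true φ γ := 𝓜.box_true (φ.tr _) γ
  just_true φ t γ := 𝓜.just_true (φ.tr _) (t.tr _) γ
  app_reason φ ψ s t γ := 𝓜.app_reason (φ.tr _) (ψ.tr _) (s.tr _) (t.tr _) γ
  sum_reason φ s t γ := 𝓜.sum_reason (φ.tr _) (s.tr _) (t.tr _) γ
  allJ_true _ _ h γ := 𝓜.allJ_true_tr g f h γ
  all_true _ _ h γ := 𝓜.all_true_tr g f h γ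

end

/-! ### Model existence and completeness -/

section

variable {C : Type u} {D : Type v} {T Φ : Set (Fm C D)}

theorem isSufficient_isTautology : IsSufficient {φ : Fm C D | IsTautology φ} :=
  ⟨fun _ h => h, fun _ h => .base h⟩

/-- In the extended language all tautologies serve as the sufficient set, so nothing has to be
transported from `T`. -/
theorem hasModel_of_consistent (hT : IsSufficient T) (h : Consistent T Φ) :
    HasModel.{u, v, max u v w} Φ := by
  obtain ⟨Ψ, hsub, hΨ⟩ := h.exists_isHenkin hT isSufficient_isTautology
  obtain ⟨𝓜, γ, hsat⟩ :=
    hasModel_of_isHenkin.{max u v, max u v, w} isSufficient_isTautology hΨ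
  exact ⟨𝓜.reduct Wit.baseJ Wit.baseP, γ, fun φ hφ => hsat _ (hsub ⟨φ, hφ, rfl⟩)⟩

theorem derivable_of_entails (hT : IsSufficient T) {φ : Fm C D}
    (h : Entails.{u, v, max u v w} Φ φ) : Derivable T Φ φ := by
  by_contra hφ
  have hc : Consistent T (insert φ.neg Φ) := by
    by_contra hc
    exact hφ ((derivable_neg_of_not_consistent hT hc).taut₁ hT fun V hV h => by
      simpa [hV.neg] using h)
  obtain ⟨𝓜, γ, hsat⟩ := hasModel_of_consistent.{u, v, w} hT hc
  exact ((𝓜.isValuation γ).neg φ).1 (hsat _ (.inl rfl))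
    (h 𝓜 γ fun ψ hψ => hsat ψ (.inr hψ))

end

end EpsilonJ

theorem theorem660 {C : Type u} {D : Type v} (T : Set (EpsilonJ.Fm C D))
    (hT : EpsilonJ.IsSufficient T) :
    (∀ Φ : Set (EpsilonJ.Fm C D), EpsilonJ.IsHenkin T Φ →
      EpsilonJ.HasModel.{u, v, max u v w} Φ) ∧
    (∀ Φ : Set (EpsilonJ.Fm C D), EpsilonJ.Consistent T Φ →
      EpsilonJ.HasModel.{u, v, max u v w} Φ) ∧
    (∀ (Φ : Set (EpsilonJ.Fm C D)) (φ : EpsilonJ.Fm C D),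
      EpsilonJ.Entails.{u, v, max u v w} Φ φ ↔ EpsilonJ.Derivable T Φ φ) :=
  ⟨fun _ h => EpsilonJ.hasModel_of_isHenkin.{u, v, w} hT h,
    fun _ h => EpsilonJ.hasModel_of_consistent.{u, v, w} hT h,
    fun _ _ => ⟨EpsilonJ.derivable_of_entails.{u, v, w} hT,
      fun h 𝓜 γ hγ => 𝓜.sat_of_derivable hT h γ hγ⟩⟩
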